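/- All trees are finite. The subtree (fringe tree) of a rooted tree at a node $v$ consists of $v$ and all its descendants. The random binary search tree $\mathcal T_n$ is the (unlabelled) binary tree obtained by inserting $n$ distinct keys in uniformly random order. The random recursive tree $\Lambda_n$ has nodes $1,\dots,n$, with root $1$, and node $i=2,\dots,n$ is attached as a child to a uniformly random one of the nodes $1,\dots,i-1$, independently of the other choices; it is regarded as an unlabelled ordered tree (children ordered by their labels), or as an unlabelled unordered rooted tree. $|T|$ is the number of nodes of $T$. (i) Let $T^1,\dots,T^d$ be a fixed sequence of distinct nonempty binary trees, let $X_n^{T}$ be the number of subtrees of $\mathcal T_n$ that are copies of $T$, and let $\mathbf X_n=(X_n^{T^1},\dots,X_n^{T^d})$, $\boldsymbol\mu_n=\mathbb E\,\mathbf X_n$. For binary trees $T,T'$ with $|T|=k\ge m=|T'|\ge 1$ let $p_{k,T}=\mathbb P(\mathcal T_k=T)$, $p_{m,T'}=\mathbb P(\mathcal T_m=T')$, let $q^{T}_{T'}$ be the number of subtrees of $T$ that are copies of $T'$, and let $$\sigma_{T,T'}=\sigma_{T',T}=\frac{2}{(k+1)(k+2)}\,q^{T}_{T'}\,p_{k,T}-\gamma(k,m)\,p_{k,T}\,p_{m,T'},$$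 $$\gamma(k,m)=\frac{4(k+m+3)}{(k+1)(k+2)(m+1)(m+2)}-\frac{4(k^2+3km+m^2+4k+4m+3)}{(k+1)(m+1)(k+m+1)(k+m+2)(k+m+3)}.$$ Let $\Gamma=(\sigma_{T^i,T^j})_{i,j=1}^d$. Then, for all $i,j$, $$\lim_{n\to\infty}\frac1n\operatorname{Cov}(X_n^{T^i},X_n^{T^j})=\sigma_{T^i,T^j},$$ the matrix $\Gamma$ is positive semidefinite and non-singular, and, as $n\to\infty$, $$n^{-1/2}(\mathbf X_n-\boldsymbol\mu_n)\xrightarrow{d}\mathcal N(0,\Gamma).$$ (ii) Let $\Lambda^1,\dots,\Lambda^d$ be a fixed sequence of distinct ordered trees, or of distinct unordered rooted trees, let $\hat X_n^{\Lambda}$ be the number of subtrees of $\Lambda_n$ that are copies of $\Lambda$ (as ordered, respectively unordered, trees), and let $\hat{\mathbf X}_n=(\hat X_n^{\Lambda^1},\dots,\hat X_n^{\Lambda^d})$, $\hat{\boldsymbol\mu}_n=\mathbb E\,\hat{\mathbf X}_n$. For trees $\Lambda,\Lambda'$ with $|\Lambda|=k\ge m=|\Lambda'|\ge1$ let $\hat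 p_{k,\Lambda}=\mathbb P(\Lambda_k=\Lambda)$, $\hat p_{m,\Lambda'}=\mathbb P(\Lambda_m=\Lambda')$, let $\hat q^{\Lambda}_{\Lambda'}$ be the number of subtrees of $\Lambda$ that are copies of $\Lambda'$, and let $$\hat\sigma_{\Lambda,\Lambda'}=\hat\sigma_{\Lambda',\Lambda}=\frac{1}{k(k+1)}\,\hat q^{\Lambda}_{\Lambda'}\,\hat p_{k,\Lambda}-\frac{k^2+km+m^2+k+m}{k(k+1)m(m+1)(k+m+1)}\,\hat p_{k,\Lambda}\,\hat p_{m,\Lambda'}.$$ Let $\hat\Gamma=(\hat\sigma_{\Lambda^i,\Lambda^j})_{i,j=1}^d$. Then, for all $i,j$, $$\lim_{n\to\infty}\frac1n\operatorname{Cov}(\hat X_n^{\Lambda^i},\hat X_n^{\Lambda^j})=\hat\sigma_{\Lambda^i,\Lambda^j},$$ the matrix $\hat\Gamma$ is positive semidefinite and non-singular, and, as $n\to\infty$, $$n^{-1/2}(\hat{\mathbf X}_n-\hat{\boldsymbol\mu}_n)\xrightarrow{d}\mathcal N(0,\hat\Gamma).$$ -/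

import Mathlib

open MeasureTheory ProbabilityTheory Filter Topology

noncomputable section

namespace FringeTrees

/-! ### Fringe subtrees -/

/-- A type of trees in which every tree `t` has a finite multiset `fringe t` of fringe subtrees:
one entry for each node `v` of `t`, namely the tree formed by `v` and all its descendants. -/
class HasFringe (τ : Type) where
  /-- the multiset of fringe subtrees, one for each node -/
  fringe : τ → Multiset τ

/-- The number of nodes of a tree. -/
def size {τ : Type} [HasFringe τ] (t : τ) : ℕ := (HasFringe.fringe t).card

open Classical in
/-- `copies T t` is the number of fringe subtrees of `t` that are copies of `T`. -/
def copies {τ : Type} [HasFringe τ] (T t : τ) : ℕ := (HasFringe.fringe t).count T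

/-! ### Binary trees and the random binary search tree -/

/-- Fringe subtrees of a binary tree. The empty tree has no node. -/
def binaryFringe {α : Type} : BinaryTree α → Multiset (BinaryTree α)
  | .nil => 0
  | .node a l r => .node a l r ::ₘ (binaryFringe l + binaryFringe r)

instance {α : Type} : HasFringe (BinaryTree α) := ⟨binaryFringe⟩

instance {α : Type} : MeasurableSpace (BinaryTree α) := ⊤

/-- Insertion of a key: at each node the key proceeds to the left child if it is smaller than the
key stored there and to the right child otherwise, and it is stored in the first empty place. -/
def bstInsert {n : ℕ} (k : Fin n) : BinaryTree (Fin n) → BinaryTree (Fin n)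
  | .nil => .node k .nil .nil
  | .node a l r => if k < a then .node a (bstInsert k l) r else .node a l (bstInsert k r)

/-- The binary search tree obtained by inserting the given keys one after the other. -/
def bstOfList {n : ℕ} (keys : List (Fin n)) : BinaryTree (Fin n) :=
  keys.foldl (fun t k => bstInsert k t) .nil

/-- The (shape of the) random binary search tree with `n` nodes: `n` distinct keys are inserted in
uniformly random order, and the keys are then forgotten. -/
def randomBST (n : ℕ) : PMF (BinaryTree Unit) :=
  (PMF.uniformOfFintype (Equiv.Perm (Fin n))).map fun π =>
    (bstOfList (List.ofFn fun i => π i)).map fun _ => ()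

/-! ### Ordered and unordered rooted trees -/

/-- Finite ordered rooted trees (the children of each node are linearly ordered) with nodes
labelled by `α`. Such a tree is nonempty. -/
inductive OrderedTree (α : Type) : Type
  | node (label : α) (children : List (OrderedTree α)) : OrderedTree α

/-- Fringe subtrees of an ordered tree. -/
def orderedFringe {α : Type} : OrderedTree α → Multiset (OrderedTree α)
  | .node a cs => .node a cs ::ₘ (cs.map orderedFringe).sum

instance {α : Type} : HasFringe (OrderedTree α) := ⟨orderedFringe⟩

instance {α : Type} : MeasurableSpace (OrderedTree α) := ⊤

/-- Relabelling of an ordered tree. -/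
def OrderedTree.map {α β : Type} (f : α → β) : OrderedTree α → OrderedTree β
  | .node a cs => .node (f a) (cs.map (OrderedTree.map f))

/-- Isomorphism of ordered trees as unordered rooted trees: the roots have the same label, and
there is a bijection between the children of the roots such that the subtrees rooted at
corresponding children are isomorphic. -/
inductive Iso {α : Type} : OrderedTree α → OrderedTree α → Prop
  | node (a : α) (cs cs' : List (OrderedTree α)) (e : Fin cs.length ≃ Fin cs'.length)
      (h : ∀ i, Iso (cs.get i) (cs'.get (e i))) : Iso (.node a cs) (.node a cs')

theorem Iso.refl {α : Type} : ∀ t : OrderedTree α, Iso t t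
  | .node a cs => .node a cs cs (Equiv.refl _) fun i => Iso.refl (cs.get i)
  termination_by t => sizeOf t
  decreasing_by
    have := List.sizeOf_get cs i
    simp only [OrderedTree.node.sizeOf_spec]
    omega

theorem Iso.symm {α : Type} {s t : OrderedTree α} (h : Iso s t) : Iso t s := by
  induction h with
  | node a cs cs' e _ ih =>
    refine .node a cs' cs e.symm fun i => ?_
    have := ih (e.symm i)
    rwa [e.apply_symm_apply] at this

theorem Iso.trans {α : Type} {s t u : OrderedTree α} (h : Iso s t) (h' : Iso t u) : Iso s u := by
  induction h generalizing u with
  | node a cs cs' e _ ih =>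
    cases h' with
    | node _ _ cs'' e' h' => exact .node a cs cs'' (e.trans e') fun i => ih i (h' (e i))

instance isoSetoid : Setoid (OrderedTree Unit) where
  r := Iso
  iseqv := ⟨Iso.refl, Iso.symm, Iso.trans⟩

/-- Finite unordered (unlabelled) rooted trees: ordered trees up to reordering the children of
the nodes. -/
def UnorderedTree : Type := Quotient isoSetoid

/-- The unordered tree obtained by forgetting the ordering of the children. -/
def toUnordered (t : OrderedTree Unit) : UnorderedTree := Quotient.mk isoSetoid t

theorem map_orderedFringe_eq {s t : OrderedTree Unit} (h : Iso s t) :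
    (orderedFringe s).map toUnordered = (orderedFringe t).map toUnordered := by
  induction h with
  | node a cs cs' e h ih =>
    have key : ∀ l : List (OrderedTree Unit), ((l.map orderedFringe).sum).map toUnordered =
        ∑ i : Fin l.length, (orderedFringe (l.get i)).map toUnordered := by
      intro l
      induction l with
      | nil => simp
      | cons b l ihl =>
        simp only [List.map_cons, List.sum_cons, Multiset.map_add, ihl]
        exact (Fin.sum_univ_succ (n := l.length)
          (fun i => (orderedFringe ((b :: l).get i)).map toUnordered)).symm
    rw [orderedFringe, orderedFringe, Multiset.map_cons, Multiset.map_cons, key, key]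
    congr 1
    · exact Quotient.sound (s := isoSetoid) (Iso.node a cs cs' e h)
    · exact Fintype.sum_equiv e _ _ ih

/-- Fringe subtrees of an unordered tree, as unordered trees. -/
def unorderedFringe (t : UnorderedTree) : Multiset UnorderedTree :=
  Quotient.lift (fun s => (orderedFringe s).map toUnordered)
    (fun _ _ h => map_orderedFringe_eq h) t

instance : HasFringe UnorderedTree := ⟨unorderedFringe⟩

instance : MeasurableSpace UnorderedTree := ⊤

/-! ### The random recursive tree -/

/-- Attach a new node with label `i`, as the last child, to the node with label `j`. -/
def attachTo (j i : ℕ) : OrderedTree ℕ → OrderedTree ℕ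
  | .node a cs =>
    if a = j then .node a (cs ++ [.node i []]) else .node a (cs.map (attachTo j i))

/-- The random recursive tree with `n` nodes, labelled `1, …, n`: start with a root labelled `1`;
the node `i = 2, …, n` is attached to a uniformly random one of the nodes `1, …, i - 1`.
Children are ordered by their labels. (For `n = 0` the value is irrelevant.) -/
def recursiveTree : ℕ → PMF (OrderedTree ℕ)
  | 0 => PMF.pure (.node 1 [])
  | 1 => PMF.pure (.node 1 [])
  | n + 2 => (recursiveTree (n + 1)).bind fun t =>
      (PMF.uniformOfFintype (Fin (n + 1))).map fun j => attachTo (j + 1) (n + 2) t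

/-- The random recursive tree as an unlabelled ordered tree. -/
def randomRRT (n : ℕ) : PMF (OrderedTree Unit) :=
  (recursiveTree n).map (OrderedTree.map fun _ => ())

/-- The random recursive tree as an unlabelled unordered tree. -/
def randomUnorderedRRT (n : ℕ) : PMF UnorderedTree := (randomRRT n).map toUnordered

/-! ### Asymptotic covariances -/

/-- The probability that the random tree of the same size as `T` is equal to `T`. -/
def shapeProb {τ : Type} [HasFringe τ] (law : ℕ → PMF τ) (T : τ) : ℝ := (law (size T) T).toReal

/-- The coefficient `γ(k, m)` for the binary search tree. -/
def gammaBST (k m : ℝ) : ℝ :=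
  4 * (k + m + 3) / ((k + 1) * (k + 2) * (m + 1) * (m + 2)) -
    4 * (k ^ 2 + 3 * k * m + m ^ 2 + 4 * k + 4 * m + 3) /
      ((k + 1) * (m + 1) * (k + m + 1) * (k + m + 2) * (k + m + 3))

/-- The asymptotic covariance `σ_{T,T'}` for the binary search tree when `|T'| ≤ |T|`. -/
def sigmaBSTOfLE (T T' : BinaryTree Unit) : ℝ :=
  2 / (((size T : ℝ) + 1) * ((size T : ℝ) + 2)) * (copies T' T : ℝ) * shapeProb randomBST T -
    gammaBST (size T) (size T') * shapeProb randomBST T * shapeProb randomBST T'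

/-- The asymptotic covariance `σ_{T,T'} = σ_{T',T}` for the binary search tree. -/
def sigmaBST (T T' : BinaryTree Unit) : ℝ :=
  if size T' ≤ size T then sigmaBSTOfLE T T' else sigmaBSTOfLE T' T

/-- The coefficient `γ̂(k, m)` for the random recursive tree. -/
def gammaRRT (k m : ℝ) : ℝ :=
  (k ^ 2 + k * m + m ^ 2 + k + m) / (k * (k + 1) * m * (m + 1) * (k + m + 1))

/-- The asymptotic covariance `σ̂_{Λ,Λ'}` for the random recursive tree, given by its laws as
ordered or as unordered tree, when `|Λ'| ≤ |Λ|`. -/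
def sigmaRRTOfLE {τ : Type} [HasFringe τ] (law : ℕ → PMF τ) (L L' : τ) : ℝ :=
  1 / ((size L : ℝ) * ((size L : ℝ) + 1)) * (copies L' L : ℝ) * shapeProb law L -
    gammaRRT (size L) (size L') * shapeProb law L * shapeProb law L'

/-- The asymptotic covariance `σ̂_{Λ,Λ'} = σ̂_{Λ',Λ}` for the random recursive tree. -/
def sigmaRRT {τ : Type} [HasFringe τ] (law : ℕ → PMF τ) (L L' : τ) : ℝ :=
  if size L' ≤ size L then sigmaRRTOfLE law L L' else sigmaRRTOfLE law L' L

/-! ### Joint asymptotic normality of subtree counts -/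

/-- The vector of the numbers of copies of `T 0, …, T (d - 1)` in a tree. -/
def countVector {τ : Type} [HasFringe τ] {d : ℕ} (T : Fin d → τ) (t : τ) :
    EuclideanSpace ℝ (Fin d) :=
  WithLp.toLp 2 fun i => (copies (T i) t : ℝ)

/-- The mean vector of `countVector T` for the random tree with law `P`. -/
def meanVector {τ : Type} [HasFringe τ] [MeasurableSpace τ] {d : ℕ} (P : PMF τ) (T : Fin d → τ) :
    EuclideanSpace ℝ (Fin d) :=
  WithLp.toLp 2 fun i => ∫ t, (copies (T i) t : ℝ) ∂P.toMeasure

/-- For random trees with `n` nodes and law `law n`, `n = 1, 2, …`: the covariances of the counts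
of copies of the `T i`, divided by `n`, converge to the entries of `Γ`; the matrix `Γ` is
non-singular (and positive semidefinite, so that there is a normal distribution `N(0, Γ)`); and the
centred vector of counts, divided by `√n`, converges in distribution to `N(0, Γ)`. -/
structure JointNormalLimit {τ : Type} [HasFringe τ] [MeasurableSpace τ] {d : ℕ}
    (law : ℕ → PMF τ) (T : Fin d → τ) (Γ : Matrix (Fin d) (Fin d) ℝ) : Prop where
  tendsto_cov : ∀ i j, Tendsto
    (fun n : ℕ => 1 / (n : ℝ) *
      cov[fun t => (copies (T i) t : ℝ), fun t => (copies (T j) t : ℝ); (law n).toMeasure])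
    atTop (𝓝 (Γ i j))
  posSemidef : Γ.PosSemidef
  nonsingular : Γ.det ≠ 0
  tendstoInDistribution : TendstoInDistribution
    (fun (n : ℕ) (t : τ) => (√(n : ℝ))⁻¹ • (countVector T t - meanVector (law n) T))
    atTop (id : EuclideanSpace ℝ (Fin d) → EuclideanSpace ℝ (Fin d))
    (fun n => (law n).toMeasure) (multivariateGaussian 0 Γ)

end FringeTrees

end

/-! Give the keys in sorted order independent uniform priorities `u 1, …, u n` and insert them by
decreasing priority. The random binary search tree becomes the Cartesian tree of the priorities
(`bstOfList_eq_cartTree`, `map_shape`). A fringe subtree with `k` nodes is then a run of `k`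
consecutive variables lying below both neighbours, and its shape depends only on the relative order
inside the run. Hence the number of copies of `T` is, up to a bounded boundary error, a sum over all
shifts of one indicator reading `k + 2` consecutive coordinates (`copies_shape_eq_sum`).

The random recursive tree on `n + 1` nodes is the image of the binary search tree on `n` nodes under
the rotation correspondence (`randomRRT_succ`). A fringe subtree with `k` nodes is now a run of `k`
variables whose last one is its maximum and lies below the left neighbour of the run. Ordered and
unordered trees are treated together through a map `q` commuting with fringe subtrees (`FringeHom`).

Sums of a bounded window functional form a finite-range dependent stationary sum. Covariances over
distant lags vanish, so the covariance of two such sums grows exactly linearly. Large blocks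
separated by gaps are independent, so the classical central limit theorem applies to them, and the
gaps are negligible in `L²` (`tendsto_charFun_windowSum`). Linear combinations of window functionals
are again window functionals, which gives joint convergence by characteristic functions
(`jointNormalLimit_of_windows`).

For the covariances, one window inside the other contributes the number of copies, partial overlap
is impossible, and two windows sharing one boundary variable contribute an elementary moment of
three uniform variables (`asympCov_indicator`, `lintegral_min_pow_mul_min_pow`,
`lintegral_ltIndicator_mul_pow_mul`).

For non-singularity, let `c` be in the kernel of the limit matrix. Positive semidefiniteness of the
matrix enlarged by an arbitrary further tree `S` forces the combination to be asymptotically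
uncorrelated with the count of `S`. The covariance formula then says that `∑ c i * copies (T i) S`
depends only on the size of `S` once `S` is large. Joining and extending trees shows that this is
possible only for `c = 0` (`IsFringeClass.eq_zero_of_size`). -/

noncomputable section

namespace FringeTrees

/-! ### Cartesian trees -/

section Cartesian

variable {α β κ : Type} [LinearOrder κ]

/-- Insertion of a new leftmost node into a Cartesian tree, ordered by decreasing keys. -/
def cartInsert (key : α → κ) (x : α) : BinaryTree α → BinaryTree α
  | .nil => .node x .nil .nil
  | .node y l r =>
    if key y < key x then .node x .nil (.node y l r) else .node y (cartInsert key x l) r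

/-- The Cartesian tree of a list: its inorder traversal is the list, and each node has a larger key
than its descendants. -/
def cartTree (key : α → κ) (l : List α) : BinaryTree α := l.foldr (cartInsert key) .nil

@[simp] theorem cartTree_nil (key : α → κ) : cartTree key [] = .nil := rfl

theorem cartTree_cons (key : α → κ) (x : α) (l : List α) :
    cartTree key (x :: l) = cartInsert key x (cartTree key l) := rfl

theorem root_mem_of_cartTree_eq (key : α → κ) {l : List α} {y : α} {a b : BinaryTree α}
    (h : cartTree key l = .node y a b) : y ∈ l := by
  induction l generalizing y a b with
  | nil => simp at h
  | cons z l ih =>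
    rw [cartTree_cons] at h
    cases hc : cartTree key l with
    | nil =>
      rw [hc, cartInsert] at h
      simp_all
    | node w c d =>
      rw [hc, cartInsert] at h
      split_ifs at h
      · simp_all
      · have := ih hc
        simp_all

theorem cartTree_cons_of_max (key : α → κ) {x : α} {l : List α} (h : ∀ y ∈ l, key y < key x) :
    cartTree key (x :: l) = .node x .nil (cartTree key l) := by
  rw [cartTree_cons]
  cases hc : cartTree key l with
  | nil => rfl
  | node w c d => rw [cartInsert, if_pos (h w (root_mem_of_cartTree_eq key hc))]

/-- Inserting from the right, `x` first takes the whole tree of `l₂` as its right subtree; every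
later element has a smaller key and so descends into the left subtree. -/
theorem cartTree_append_of_max (key : α → κ) {x : α} {l₁ l₂ : List α}
    (h₁ : ∀ y ∈ l₁, key y < key x) (h₂ : ∀ y ∈ l₂, key y < key x) :
    cartTree key (l₁ ++ x :: l₂) = .node x (cartTree key l₁) (cartTree key l₂) := by
  induction l₁ with
  | nil => exact cartTree_cons_of_max key h₂
  | cons z l ih =>
    rw [List.cons_append, cartTree_cons, ih fun y hy => h₁ y (List.mem_cons_of_mem _ hy),
      cartInsert, if_neg (h₁ z List.mem_cons_self).not_gt, cartTree_cons]

theorem cartInsert_map (f : β → α) (key : α → κ) (x : β) (t : BinaryTree β) :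
    cartInsert key (f x) (t.map f) = (cartInsert (key ∘ f) x t).map f := by
  induction t with
  | nil => rfl
  | node y l r ihl ihr =>
    rw [BinaryTree.map, cartInsert, cartInsert, ihl]
    simp only [Function.comp_apply]
    split_ifs <;> rfl

theorem cartTree_map (f : β → α) (key : α → κ) (l : List β) :
    cartTree key (l.map f) = (cartTree (key ∘ f) l).map f := by
  induction l with
  | nil => rfl
  | cons x l ih => rw [List.map_cons, cartTree_cons, ih, cartInsert_map, ← cartTree_cons]

/-- A Cartesian tree depends only on the relative order of the keys. -/
theorem cartTree_congr {κ' : Type} [LinearOrder κ'] {key : α → κ} {key' : α → κ'} {l : List α}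
    (h : ∀ x ∈ l, ∀ y ∈ l, key x < key y ↔ key' x < key' y) :
    cartTree key l = cartTree key' l := by
  -- The equality of the two relabellings says that all nodes of `t` lie in `S`, which is what
  -- allows their keys to be compared through the hypothesis.
  have aux : ∀ (x : α) (t : BinaryTree α) (S : Set α), x ∈ S →
      (∀ x ∈ S, ∀ y ∈ S, key x < key y ↔ key' x < key' y) →
      (t.map (· ∈ S) = t.map fun _ => True) →
      cartInsert key x t = cartInsert key' x t ∧
        (cartInsert key x t).map (· ∈ S) = (cartInsert key x t).map fun _ => True := by
    intro x t S hx hS ht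
    induction t with
    | nil => simp [cartInsert, BinaryTree.map, hx]
    | node y l r ihl ihr =>
      simp only [BinaryTree.map, BinaryTree.node.injEq, eq_iff_iff, iff_true] at ht
      obtain ⟨hy, hl, hr⟩ := ht
      obtain ⟨h1, h2⟩ := ihl hl
      simp only [cartInsert, hS y hy x hx]
      split_ifs
      · simp [BinaryTree.map, hx, hy, hl, hr]
      · rw [← h1]
        simp [BinaryTree.map, hy, h2, hr]
  have main : ∀ l' : List α, (∀ x ∈ l', x ∈ l) → cartTree key l' = cartTree key' l' ∧
      (cartTree key l').map (· ∈ {x | x ∈ l}) = (cartTree key l').map fun _ => True := by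
    intro l' hl'
    induction l' with
    | nil => exact ⟨rfl, rfl⟩
    | cons x l' ih =>
      obtain ⟨h1, h2⟩ := ih fun y hy => hl' y (List.mem_cons_of_mem _ hy)
      rw [cartTree_cons, cartTree_cons, ← h1]
      exact aux x _ {x | x ∈ l} (hl' x List.mem_cons_self) h h2
  exact (main l fun _ h => h).1

/-- A nonempty list with distinct keys splits at its largest key. -/
theorem exists_split_at_max (key : α → κ) {l : List α} (hl : l ≠ [])
    (hd : (l.map key).Nodup) : ∃ l₁ x l₂, l = l₁ ++ x :: l₂ ∧ (∀ y ∈ l₁, key y < key x) ∧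
      ∀ y ∈ l₂, key y < key x := by
  classical
  obtain ⟨x, hx, hmax⟩ := l.toFinset.exists_max_image key (by simpa using hl)
  obtain ⟨l₁, l₂, rfl⟩ := List.append_of_mem (List.mem_toFinset.1 hx)
  refine ⟨l₁, x, l₂, rfl, fun y hy => ?_, fun y hy => ?_⟩
  all_goals
    refine lt_of_le_of_ne (hmax y (by simp [hy])) fun he => ?_
    rw [List.map_append, List.map_cons, List.nodup_middle, List.nodup_cons] at hd
    refine hd.1 ?_
    rw [← he, ← List.map_append]
    exact List.mem_map_of_mem (by simp [hy])

end Cartesian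

/-! ### The binary search tree as a Cartesian tree -/

/-- Once the root is fixed, the keys below it and the remaining keys form two streams that never
interact. -/
theorem foldl_bstInsert_node {n : ℕ} (a : Fin n) (ks : List (Fin n)) (l r : BinaryTree (Fin n)) :
    ks.foldl (fun t k => bstInsert k t) (.node a l r) =
      .node a ((ks.filter (· < a)).foldl (fun t k => bstInsert k t) l)
        ((ks.filter (¬ · < a)).foldl (fun t k => bstInsert k t) r) := by
  induction ks generalizing l r with
  | nil => rfl
  | cons k ks ih =>
    rw [List.foldl_cons, bstInsert]
    by_cases h : k < a
    · rw [if_pos h, ih]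
      simp [h, not_le.2 h]
    · rw [if_neg h, ih]
      simp [h, not_lt.1 h]

theorem bstOfList_cons {n : ℕ} (a : Fin n) (ks : List (Fin n)) :
    bstOfList (a :: ks) = .node a (bstOfList (ks.filter (· < a)))
      (bstOfList (ks.filter (¬ · < a))) := by
  rw [bstOfList, List.foldl_cons, bstInsert, foldl_bstInsert_node]
  rfl

/-- Inserting keys by decreasing priority gives the Cartesian tree of the priorities. -/
theorem bstOfList_eq_cartTree {n : ℕ} {κ : Type} [LinearOrder κ] (u : Fin n → κ)
    (ks ps : List (Fin n)) (hp : ks.Perm ps) (hps : ps.Pairwise (· < ·))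
    (hks : ks.Pairwise fun i j => u j < u i) : bstOfList ks = cartTree u ps := by
  induction hN : ks.length using Nat.strong_induction_on generalizing ks ps with
  | _ N ih =>
    cases ks with
    | nil =>
      obtain rfl := hp.symm.eq_nil
      rfl
    | cons a ks =>
      -- The first key inserted has the largest priority, so it is the root on both sides; since
      -- `ps` is sorted, the smaller keys are `p₁` and the larger ones `p₂`.
      obtain ⟨p₁, p₂, rfl⟩ := List.append_of_mem (hp.subset List.mem_cons_self)
      rw [List.pairwise_append] at hps
      obtain ⟨hp1, hp2, h12⟩ := hps
      rw [List.pairwise_cons] at hp2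
      have hp' : ks.Perm (p₁ ++ p₂) := by
        rw [← List.perm_cons a]
        exact hp.trans List.perm_middle
      rw [List.pairwise_cons] at hks
      rw [bstOfList_cons, cartTree_append_of_max u
        (fun y hy => hks.1 y (hp'.symm.subset (by simp [hy])))
        (fun y hy => hks.1 y (hp'.symm.subset (by simp [hy])))]
      have hlen : ks.length < N := by rw [← hN]; simp
      congr 1
      · refine ih _ (lt_of_le_of_lt (List.length_filter_le _ _) hlen) _ _ ?_ hp1
          (hks.2.filter _) rfl
        refine (hp'.filter _).trans ?_
        rw [List.filter_append, List.filter_eq_self.2, List.filter_eq_nil_iff.2, List.append_nil]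
        · intro y hy
          simpa using (hp2.1 y hy).le
        · intro y hy
          simpa using h12 y hy a List.mem_cons_self
      · refine ih _ (lt_of_le_of_lt (List.length_filter_le _ _) hlen) _ _ ?_ hp2.2
          (hks.2.filter _) rfl
        refine (hp'.filter _).trans ?_
        rw [List.filter_append, List.filter_eq_nil_iff.2, List.filter_eq_self.2, List.nil_append]
        · intro y hy
          simpa using (hp2.1 y hy).le
        · intro y hy
          simpa using h12 y hy a List.mem_cons_self

/-! ### Sizes and numbers of copies -/

@[simp] theorem size_nil {α : Type} : size (BinaryTree.nil : BinaryTree α) = 0 := rfl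

@[simp] theorem size_binaryNode {α : Type} (a : α) (l r : BinaryTree α) :
    size (BinaryTree.node a l r) = size l + size r + 1 := by
  simp [size, HasFringe.fringe, binaryFringe]

@[simp] theorem copies_nil {α : Type} (T : BinaryTree α) : copies T .nil = 0 := by
  simp [copies, HasFringe.fringe, binaryFringe]

theorem copies_binaryNode (T : BinaryTree Unit) (a : Unit) (l r : BinaryTree Unit) :
    copies T (.node a l r) =
      copies T l + copies T r + if .node a l r = T then 1 else 0 := by
  simp only [copies, HasFringe.fringe, binaryFringe, Multiset.count_cons, Multiset.count_add,
    eq_comm (a := T)]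

@[simp] theorem size_map {α β : Type} (f : α → β) (t : BinaryTree α) :
    size (t.map f) = size t := by
  induction t with
  | nil => rfl
  | node a l r ihl ihr => rw [BinaryTree.map, size_binaryNode, size_binaryNode, ihl, ihr]

@[simp] theorem size_cartTree {α κ : Type} [LinearOrder κ] (key : α → κ) (l : List α) :
    size (cartTree key l) = l.length := by
  have aux : ∀ (x : α) (t : BinaryTree α), size (cartInsert key x t) = size t + 1 := by
    intro x t
    induction t with
    | nil => simp [cartInsert]
    | node y l r ihl ihr =>
      rw [cartInsert]
      split_ifs
      · simp
      · simp [ihl]; omega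
  induction l with
  | nil => rfl
  | cons x l ih => rw [cartTree_cons, aux, ih, List.length_cons]

theorem size_ne_zero {α : Type} {T : BinaryTree α} (h : T ≠ .nil) : size T ≠ 0 := by
  cases T with
  | nil => exact absurd rfl h
  | node a l r => simp

/-! ### Fringe trees of Cartesian trees as windows -/

/-- The shape of the Cartesian tree of `u a, …, u (a + k - 1)`. -/
def shape (u : ℕ → ℝ) (a k : ℕ) : BinaryTree Unit :=
  (cartTree u (List.range' a k)).map fun _ => ()

@[simp] theorem size_shape (u : ℕ → ℝ) (a k : ℕ) : size (shape u a k) = k := by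
  simp [shape]

theorem shape_zero (u : ℕ → ℝ) (a : ℕ) : shape u a 0 = .nil := rfl

theorem shape_split (u : ℕ → ℝ) (a p q : ℕ)
    (h₁ : ∀ j, a ≤ j → j < a + p → u j < u (a + p))
    (h₂ : ∀ j, a + p < j → j < a + p + 1 + q → u j < u (a + p)) :
    shape u a (p + 1 + q) = .node () (shape u a p) (shape u (a + p + 1) q) := by
  have : List.range' a (p + 1 + q) = List.range' a p ++ (a + p) :: List.range' (a + p + 1) q := by
    rw [add_assoc, ← List.range'_append_1, Nat.add_comm 1 q, List.range'_succ]
  rw [shape, this, cartTree_append_of_max]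
  · rfl
  · intro y hy
    rw [List.mem_range'_1] at hy
    exact h₁ y hy.1 hy.2
  · intro y hy
    rw [List.mem_range'_1] at hy
    exact h₂ y hy.1 hy.2

/-- Measurability, scale invariance and locality of shapes all come from this: only the comparisons
inside the block matter, not its position or the values. -/
theorem shape_congr {u v : ℕ → ℝ} {a b k : ℕ}
    (h : ∀ i < k, ∀ j < k, u (a + i) < u (a + j) ↔ v (b + i) < v (b + j)) :
    shape u a k = shape v b k := by
  have key : ∀ (w : ℕ → ℝ) (c : ℕ), shape w c k =
      (cartTree (fun i => w (c + i)) (List.range' 0 k)).map fun _ => () := by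
    intro w c
    rw [shape, show List.range' c k = (List.range' 0 k).map (c + ·) by
      rw [List.map_add_range']; simp, cartTree_map, ← BinaryTree.comp_map]
    rfl
  rw [key, key]
  congr 1
  refine cartTree_congr fun i hi j hj => ?_
  rw [List.mem_range'_1] at hi hj
  exact h i (by omega) j (by omega)

/-- A nonempty block has a position of its maximum. -/
theorem exists_block_max (u : ℕ → ℝ) (a n : ℕ) (hn : n ≠ 0)
    (hu : Set.InjOn u (Set.Ico a (a + n))) : ∃ p q, n = p + 1 + q ∧
      ∀ j, a ≤ j → j < a + n → j ≠ a + p → u j < u (a + p) := by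
  obtain ⟨x, hx, hmax⟩ := (Finset.Ico a (a + n)).exists_max_image u ⟨a, by simp; omega⟩
  rw [Finset.mem_Ico] at hx
  refine ⟨x - a, a + n - x - 1, by omega, fun j h1 h2 h3 => ?_⟩
  have hxa : a + (x - a) = x := by omega
  rw [hxa] at h3 ⊢
  refine lt_of_le_of_ne (hmax j (by simp [h1, h2])) fun he => h3 ?_
  exact hu (by simp [h1, h2]) (by simpa using hx) he

/-- The block of length `k` after position `i` lies below its two neighbours. -/
def IsFringeBlock (u : ℕ → ℝ) (i k : ℕ) : Prop :=
  ∀ j, i < j → j < i + k + 1 → u j < u i ∧ u j < u (i + k + 1)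

open Classical in
/-- Copies of `T` in the Cartesian tree of a fringe block are the fringe blocks of shape `T`. -/
theorem copies_shape_eq_sum (T : BinaryTree Unit) (hT : T ≠ .nil) (u : ℕ → ℝ) (a n : ℕ)
    (hu : Set.InjOn u (Set.Ico (a + 1) (a + 1 + n))) (hf : IsFringeBlock u a n) :
    copies T (shape u (a + 1) n) = ∑ i ∈ Finset.range (n + 1),
      if i + size T ≤ n ∧ IsFringeBlock u (a + i) (size T) ∧ shape u (a + i + 1) (size T) = T
      then 1 else 0 := by
  have hk := size_ne_zero hT
  set k := size T with hkdef
  induction n using Nat.strong_induction_on generalizing a with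
  | _ n ih =>
    rcases Nat.eq_zero_or_pos n with rfl | hn
    · rw [shape_zero, copies_nil, eq_comm]
      refine Finset.sum_eq_zero fun i _ => if_neg fun h => ?_
      omega
    obtain ⟨p, q, rfl, hmax⟩ := exists_block_max u (a + 1) n hn.ne' hu
    have hsplit := shape_split u (a + 1) p q (fun j h1 h2 => hmax j h1 (by omega) (by omega))
      (fun j h1 h2 => hmax j (by omega) (by omega) (by omega))
    have hroot := hf (a + 1 + p) (by omega) (by omega)
    -- Split at the maximum of the block. Both sides of it are again fringe blocks, with the maximum
    -- as a common neighbour, and the `n + 1` starting positions split as `(p + 1) + (q + 1)`.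
    rw [hsplit, copies_binaryNode, ← hsplit,
      ih p (by omega) a (hu.mono (Set.Ico_subset_Ico_right (by omega))) ?_,
      ih q (by omega) (a + 1 + p) (hu.mono (Set.Ico_subset_Ico (by omega) (by omega))) ?_,
      show p + 1 + q + 1 = (p + 1) + (q + 1) by ring,
      Finset.sum_range_add (n := p + 1) (m := q + 1), add_right_comm]
    · congr 1
      -- The copy at the root is booked under the starting position `0`, so that the left part can
      -- be compared term by term.
      · have : (if shape u (a + 1) (p + 1 + q) = T then 1 else 0 : ℕ) =
            ∑ i ∈ Finset.range (p + 1), if i = 0 ∧ shape u (a + 1) (p + 1 + q) = T then 1 else 0 := by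
          rw [Finset.sum_range_succ', Finset.sum_eq_zero (fun i _ => if_neg (by simp))]
          simp
        rw [this, ← Finset.sum_add_distrib]
        refine Finset.sum_congr rfl fun i hi => ?_
        rw [Finset.mem_range] at hi
        by_cases hik : i + k ≤ p
        · rw [if_neg (c := i = 0 ∧ _), add_zero]
          · refine if_congr (and_congr_left fun _ => ?_) rfl rfl
            omega
          · rintro ⟨rfl, h⟩
            have : k = p + 1 + q := by rw [hkdef, ← h, size_shape]
            omega
        · rw [if_neg (c := i + k ≤ p ∧ _) (fun h => hik h.1), zero_add, eq_comm]
          refine if_congr ⟨?_, ?_⟩ rfl rfl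
          -- A window containing the maximum lies below its neighbours, so both neighbours must be
          -- outside the block, and the window is the whole block.
          · rintro ⟨h1, h2, h3⟩
            have h4 := h2 (a + 1 + p) (by omega) (by omega)
            have hi0 : i = 0 := by
              by_contra hne
              exact lt_asymm h4.1 (hmax (a + i) (by omega) (by omega) (by omega))
            subst hi0
            have hkn : k = p + 1 + q := by
              by_contra hne
              exact lt_asymm h4.2 (hmax (a + 0 + k + 1) (by omega) (by omega) (by omega))
            refine ⟨rfl, ?_⟩
            rw [← h3, hkn]
          · rintro ⟨rfl, h⟩
            have hkn : k = p + 1 + q := by rw [hkdef, ← h, size_shape]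
            rw [hkn]
            exact ⟨by omega, hf, h⟩
      · refine Finset.sum_congr rfl fun i _ => ?_
        rw [show a + 1 + p + i = a + (p + 1 + i) by ring]
        refine if_congr (and_congr_left fun _ => ?_) rfl rfl
        omega
    · intro j h1 h2
      refine ⟨?_, ?_⟩
      · exact hmax j (by omega) (by omega) (by omega)
      · have := (hf j (by omega) (by omega)).2
        convert this using 2
        omega
    · intro j h1 h2
      refine ⟨(hf j (by omega) (by omega)).1, ?_⟩
      have := hmax j (by omega) (by omega) (by omega)
      convert this using 2
      omega

/-! ### The rotation correspondence -/

/-- The rotation correspondence: left child is first child, right child is next sibling. -/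
def rotate {α β : Type} (f : α → β) : BinaryTree α → List (OrderedTree β)
  | .nil => []
  | .node a l r => .node (f a) (rotate f l) :: rotate f r

/-- The ordered tree whose root has the forest corresponding to a binary tree. -/
def rotateTree (t : BinaryTree Unit) : OrderedTree Unit := .node () (rotate id t)

theorem rotate_comp_map {α β γ : Type} (f : β → γ) (g : α → β) (t : BinaryTree α) :
    rotate f (t.map g) = rotate (f ∘ g) t := by
  induction t with
  | nil => rfl
  | node a l r ihl ihr => simp [BinaryTree.map, rotate, ihl, ihr]

theorem map_rotate {α β γ : Type} (f : β → γ) (g : α → β) (t : BinaryTree α) :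
    (rotate g t).map (OrderedTree.map f) = rotate (f ∘ g) t := by
  induction t with
  | nil => rfl
  | node a l r ihl ihr => simp [rotate, OrderedTree.map, ihl, ihr]

/-- The inverse of the rotation correspondence, on the children of the root. -/
theorem exists_rotate_eq (cs : List (OrderedTree Unit)) : ∃ t, rotate id t = cs := by
  match cs with
  | [] => exact ⟨.nil, rfl⟩
  | .node a ds :: es =>
    obtain ⟨l, hl⟩ := exists_rotate_eq ds
    obtain ⟨r, hr⟩ := exists_rotate_eq es
    exact ⟨.node a l r, by rw [rotate, hl, hr, id]⟩
  termination_by sizeOf cs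

theorem exists_rotateTree_eq (t : OrderedTree Unit) : ∃ s, rotateTree s = t := by
  obtain ⟨a, cs⟩ := t
  obtain ⟨s, hs⟩ := exists_rotate_eq cs
  exact ⟨s, by rw [rotateTree, hs]⟩

/-! ### Sizes and copies for images of ordered trees -/

/-- A map from ordered trees to another type of trees that commutes with taking fringe trees. -/
structure FringeHom {τ : Type} [HasFringe τ] (q : OrderedTree Unit → τ) : Prop where
  surjective : Function.Surjective q
  fringe_eq : ∀ t, HasFringe.fringe (q t) = (orderedFringe t).map q

theorem fringeHom_id : FringeHom (id : OrderedTree Unit → OrderedTree Unit) :=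
  ⟨Function.surjective_id, fun t => by simp [HasFringe.fringe]⟩

theorem fringeHom_toUnordered : FringeHom toUnordered :=
  ⟨Quotient.mk_surjective, fun _ => rfl⟩

section FringeHom

variable {τ : Type} [HasFringe τ] {q : OrderedTree Unit → τ}

/-- The total number of nodes of the images of the trees in a list. -/
def forestSize (q : OrderedTree Unit → τ) (ts : List (OrderedTree Unit)) : ℕ :=
  (ts.map fun t => size (q t)).sum

/-- The total number of copies of a tree in the images of the trees in a list. -/
def forestCopies (q : OrderedTree Unit → τ) (L : τ) (ts : List (OrderedTree Unit)) : ℕ :=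
  (ts.map fun t => copies L (q t)).sum

theorem FringeHom.size_node (hq : FringeHom q) (a : Unit) (cs : List (OrderedTree Unit)) :
    size (q (.node a cs)) = forestSize q cs + 1 := by
  rw [size, hq.fringe_eq, orderedFringe, Multiset.map_cons, Multiset.card_cons, forestSize]
  congr 1
  induction cs with
  | nil => rfl
  | cons c cs ih =>
    rw [List.map_cons, List.sum_cons, Multiset.map_add, Multiset.card_add, ih, List.map_cons,
      List.sum_cons, size, hq.fringe_eq]

open Classical in
theorem FringeHom.copies_node (hq : FringeHom q) (L : τ) (a : Unit)
    (cs : List (OrderedTree Unit)) :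
    copies L (q (.node a cs)) =
      forestCopies q L cs + if q (.node a cs) = L then 1 else 0 := by
  rw [copies, hq.fringe_eq, orderedFringe, Multiset.map_cons, Multiset.count_cons, forestCopies,
    if_congr (eq_comm (a := L)) rfl rfl]
  congr 1
  induction cs with
  | nil => rfl
  | cons c cs ih =>
    rw [List.map_cons, List.sum_cons, Multiset.map_add, Multiset.count_add, ih, List.map_cons,
      List.sum_cons, copies, hq.fringe_eq]

theorem FringeHom.forestSize_rotate (hq : FringeHom q) (t : BinaryTree Unit) :
    forestSize q (rotate id t) = size t := by
  induction t with
  | nil => rfl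
  | node a l r ihl ihr =>
    rw [size_binaryNode, ← ihl, ← ihr, rotate, forestSize, List.map_cons, List.sum_cons,
      hq.size_node, forestSize, forestSize]
    ring

@[simp] theorem FringeHom.size_rotateTree (hq : FringeHom q) (t : BinaryTree Unit) :
    size (q (rotateTree t)) = size t + 1 := by
  rw [rotateTree, hq.size_node, hq.forestSize_rotate]

theorem FringeHom.exists_rotateTree (hq : FringeHom q) (L : τ) : ∃ s, q (rotateTree s) = L := by
  obtain ⟨t, rfl⟩ := hq.surjective L
  obtain ⟨s, rfl⟩ := exists_rotateTree_eq t
  exact ⟨s, rfl⟩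

theorem FringeHom.one_le_size (hq : FringeHom q) (L : τ) : 1 ≤ size L := by
  obtain ⟨s, rfl⟩ := hq.exists_rotateTree L
  rw [hq.size_rotateTree]
  omega

/-- The last element of the block of length `k` after position `i` is its maximum, and it lies
below the left neighbour of the block. -/
def IsRecursiveBlock (u : ℕ → ℝ) (i k : ℕ) : Prop :=
  u (i + k) < u i ∧ ∀ j, i < j → j < i + k → u j < u (i + k)

open Classical in
-- Under the rotation correspondence the maximum of the block is the root of the first tree of the
-- forest. The variables to its left are the descendants of that root and those to its right make up
-- the remaining trees. The first tree therefore occupies the left part together with the maximum,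
-- which comes last.
theorem FringeHom.forestCopies_shape_eq_sum (hq : FringeHom q) (L : τ) (u : ℕ → ℝ) (a n : ℕ)
    (hu : Set.InjOn u (Set.Ico (a + 1) (a + 1 + n)))
    (hf : ∀ j, a < j → j < a + n + 1 → u j < u a) :
    forestCopies q L (rotate id (shape u (a + 1) n)) = ∑ i ∈ Finset.range (n + 1),
      if i + size L ≤ n ∧ IsRecursiveBlock u (a + i) (size L) ∧
        q (rotateTree (shape u (a + i + 1) (size L - 1))) = L then 1 else 0 := by
  have hk := hq.one_le_size L
  set k := size L with hkdef
  induction n using Nat.strong_induction_on generalizing a with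
  | _ n ih =>
    rcases Nat.eq_zero_or_pos n with rfl | hn
    · rw [shape_zero, eq_comm]
      refine Finset.sum_eq_zero fun i _ => if_neg fun h => ?_
      omega
    obtain ⟨p, r, rfl, hmax⟩ := exists_block_max u (a + 1) n hn.ne' hu
    have hsplit := shape_split u (a + 1) p r (fun j h1 h2 => hmax j h1 (by omega) (by omega))
      (fun j h1 h2 => hmax j (by omega) (by omega) (by omega))
    have hroot := hf (a + 1 + p) (by omega) (by omega)
    have hnode : forestCopies q L (rotate id (shape u (a + 1) (p + 1 + r))) =
        forestCopies q L (rotate id (shape u (a + 1) p)) +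
        (if q (rotateTree (shape u (a + 1) p)) = L then 1 else 0) +
        forestCopies q L (rotate id (shape u (a + 1 + p + 1) r)) := by
      rw [hsplit, rotate, forestCopies, List.map_cons, List.sum_cons, hq.copies_node]
      rfl
    rw [hnode,
      ih p (by omega) a (hu.mono (Set.Ico_subset_Ico_right (by omega)))
        (fun j h1 h2 => hf j h1 (by omega)),
      ih r (by omega) (a + 1 + p) (hu.mono (Set.Ico_subset_Ico (by omega) (by omega)))
        (fun j h1 h2 => hmax j (by omega) (by omega) (by omega)),
      show p + 1 + r + 1 = (p + 1) + (r + 1) by ring,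
      Finset.sum_range_add (n := p + 1) (m := r + 1)]
    congr 1
    · have : (if q (rotateTree (shape u (a + 1) p)) = L then 1 else 0) =
          ∑ i ∈ Finset.range (p + 1),
            if i = 0 ∧ q (rotateTree (shape u (a + 1) p)) = L then 1 else 0 := by
        rw [Finset.sum_range_succ', Finset.sum_eq_zero (fun i _ => if_neg (by simp))]
        simp
      rw [this, ← Finset.sum_add_distrib]
      refine Finset.sum_congr rfl fun i hi => ?_
      rw [Finset.mem_range] at hi
      by_cases hik : i + k ≤ p
      · rw [if_neg (c := i = 0 ∧ _), add_zero]
        · refine if_congr (and_congr_left fun _ => ?_) rfl rfl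
          omega
        · rintro ⟨rfl, h⟩
          have : k = p + 1 := by rw [hkdef, ← h, hq.size_rotateTree, size_shape]
          omega
      · rw [if_neg (c := i + k ≤ p ∧ _) (fun h => hik h.1), zero_add, eq_comm]
        refine if_congr ⟨?_, ?_⟩ rfl rfl
        -- A window reaching the maximum of the block must end there, since its last element is its
        -- own maximum; its left neighbour is larger still, so it lies outside the block.
        · rintro ⟨h1, ⟨h2, h3⟩, h4⟩
          have hkn : i + k = p + 1 := by
            by_contra hne
            exact lt_asymm (h3 (a + 1 + p) (by omega) (by omega))
              (hmax (a + i + k) (by omega) (by omega) (by omega))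
          have hi0 : i = 0 := by
            by_contra hne
            rw [show a + i + k = a + 1 + p by omega] at h2
            exact lt_asymm h2 (hmax (a + i) (by omega) (by omega) (by omega))
          subst hi0
          refine ⟨rfl, ?_⟩
          rw [← h4, show k - 1 = p by omega, add_zero]
        · rintro ⟨rfl, h⟩
          have hkn : k = p + 1 := by rw [hkdef, ← h, hq.size_rotateTree, size_shape]
          rw [hkn]
          refine ⟨by omega, ⟨?_, fun j h1 h2 => ?_⟩, h⟩
          · rwa [show a + 0 + (p + 1) = a + 1 + p by ring]
          · rw [show a + 0 + (p + 1) = a + 1 + p by ring]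
            exact hmax j (by omega) (by omega) (by omega)
    · refine Finset.sum_congr rfl fun i _ => ?_
      rw [show a + 1 + p + i = a + (p + 1 + i) by ring]
      refine if_congr (and_congr_left fun _ => ?_) rfl rfl
      omega

open Classical in
/-- Copies of `L` in the recursive tree of a block are the blocks of shape `L`. -/
theorem FringeHom.copies_rotateTree_shape_eq_sum (hq : FringeHom q) (L : τ) (u : ℕ → ℝ)
    (a n : ℕ) (hu : Set.InjOn u (Set.Ico (a + 1) (a + 1 + n)))
    (hf : IsRecursiveBlock u a (n + 1)) :
    copies L (q (rotateTree (shape u (a + 1) n))) = ∑ i ∈ Finset.range (n + 2),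
      if i + size L ≤ n + 1 ∧ IsRecursiveBlock u (a + i) (size L) ∧
        q (rotateTree (shape u (a + i + 1) (size L - 1))) = L then 1 else 0 := by
  have hk := hq.one_le_size L
  rw [rotateTree, hq.copies_node, ← rotateTree, hq.forestCopies_shape_eq_sum L u a n hu
    (fun j h1 h2 => (hf.2 j h1 (by omega)).trans hf.1), Finset.sum_range_succ _ (n + 1),
    if_neg (c := n + 1 + size L ≤ n + 1 ∧ _) (fun h => by omega), add_zero]
  have : (if q (rotateTree (shape u (a + 1) n)) = L then 1 else 0) =
      ∑ i ∈ Finset.range (n + 1),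
        if i = 0 ∧ q (rotateTree (shape u (a + 1) n)) = L then 1 else 0 := by
    rw [Finset.sum_range_succ', Finset.sum_eq_zero (fun i _ => if_neg (by simp))]
    simp
  rw [this, ← Finset.sum_add_distrib]
  refine Finset.sum_congr rfl fun i hi => ?_
  rw [Finset.mem_range] at hi
  by_cases hik : i + size L ≤ n
  · rw [if_neg (c := i = 0 ∧ _), add_zero]
    · refine if_congr (and_congr_left fun _ => ?_) rfl rfl
      omega
    · rintro ⟨rfl, h⟩
      have : size L = n + 1 := by rw [← h, hq.size_rotateTree, size_shape]
      omega
  · rw [if_neg (c := i + size L ≤ n ∧ _) (fun h => hik h.1), zero_add, eq_comm]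
    refine if_congr ⟨?_, ?_⟩ rfl rfl
    · rintro ⟨h1, ⟨h2, h3⟩, h4⟩
      have hi0 : i = 0 := by
        by_contra hne
        rw [show a + i + size L = a + (n + 1) by omega] at h2
        exact lt_asymm h2 (hf.2 (a + i) (by omega) (by omega))
      subst hi0
      refine ⟨rfl, ?_⟩
      rw [← h4, show size L - 1 = n by omega, add_zero]
    · rintro ⟨rfl, h⟩
      have hkn : size L = n + 1 := by rw [← h, hq.size_rotateTree, size_shape]
      rw [hkn]
      exact ⟨by omega, hf, h⟩

end FringeHom

/-! ### The random recursive tree and the random binary search tree -/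

/-- The forest of increasing trees whose list of labels, in postorder, is the given one. -/
def labelForest (l : List ℕ) : List (OrderedTree ℕ) := rotate id (cartTree (fun a => -(a : ℤ)) l)

theorem labelForest_append_of_min {a : ℕ} {l₁ l₂ : List ℕ} (h₁ : ∀ y ∈ l₁, a < y)
    (h₂ : ∀ y ∈ l₂, a < y) :
    labelForest (l₁ ++ a :: l₂) = .node a (labelForest l₁) :: labelForest l₂ := by
  rw [labelForest, cartTree_append_of_max]
  · rfl
  · intro y hy
    simpa using h₁ y hy
  · intro y hy
    simpa using h₂ y hy

theorem exists_split_at_min {l : List ℕ} (hl : l ≠ []) (hd : l.Nodup) :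
    ∃ l₁ a l₂, l = l₁ ++ a :: l₂ ∧ (∀ y ∈ l₁, a < y) ∧ ∀ y ∈ l₂, a < y := by
  obtain ⟨l₁, a, l₂, h, h₁, h₂⟩ := exists_split_at_max (fun a : ℕ => -(a : ℤ)) hl
    (hd.map fun a b h => by simpa using h)
  exact ⟨l₁, a, l₂, h, fun y hy => by simpa using h₁ y hy, fun y hy => by simpa using h₂ y hy⟩

theorem map_attachTo_labelForest_of_notMem (j x : ℕ) (l : List ℕ) (hd : l.Nodup) (hj : j ∉ l) :
    (labelForest l).map (attachTo j x) = labelForest l := by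
  induction hN : l.length using Nat.strong_induction_on generalizing l with
  | _ N ih =>
    rcases eq_or_ne l [] with rfl | hl
    · rfl
    obtain ⟨l₁, a, l₂, rfl, h₁, h₂⟩ := exists_split_at_min hl hd
    simp only [List.length_append, List.length_cons] at hN
    simp only [List.mem_append, List.mem_cons, not_or] at hj
    have hd' := List.nodup_append.1 hd
    rw [labelForest_append_of_min h₁ h₂, List.map_cons, attachTo, if_neg (Ne.symm hj.2.1),
      ih l₁.length (by omega) l₁ hd'.1 hj.1 rfl,
      ih l₂.length (by omega) l₂ (List.nodup_cons.1 hd'.2.1).2 hj.2.2 rfl]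

/-- The largest label never becomes a root above other labels: at every split it stays to the right
of the minimum, and ends as a separate last tree. -/
theorem labelForest_append_singleton (x : ℕ) (l : List ℕ) (hd : l.Nodup) (hx : ∀ y ∈ l, y < x) :
    labelForest (l ++ [x]) = labelForest l ++ [.node x []] := by
  induction hN : l.length using Nat.strong_induction_on generalizing l with
  | _ N ih =>
    rcases eq_or_ne l [] with rfl | hl
    · rfl
    obtain ⟨l₁, a, l₂, rfl, h₁, h₂⟩ := exists_split_at_min hl hd
    simp only [List.length_append, List.length_cons] at hN
    have hd' := List.nodup_append.1 hd
    rw [List.append_assoc, List.cons_append, labelForest_append_of_min h₁ h₂,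
      labelForest_append_of_min h₁, ih l₂.length (by omega) l₂ (List.nodup_cons.1 hd'.2.1).2
      (fun y hy => hx y (by simp [hy])) rfl, List.cons_append]
    intro y hy
    rcases List.mem_append.1 hy with hy | hy
    · exact h₂ y hy
    · rw [List.mem_singleton.1 hy]
      exact hx a (by simp)

/-- In postorder a node follows immediately after its descendants, so a new last child stands
directly before its parent. -/
theorem map_attachTo_labelForest (j x : ℕ) (l₁ l₂ : List ℕ) (hd : (l₁ ++ j :: l₂).Nodup)
    (hx : ∀ y ∈ l₁ ++ j :: l₂, y < x) :
    (labelForest (l₁ ++ j :: l₂)).map (attachTo j x) = labelForest (l₁ ++ x :: j :: l₂) := by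
  induction hN : (l₁ ++ j :: l₂).length using Nat.strong_induction_on generalizing l₁ l₂ with
  | _ N ih =>
    -- The smallest label `a` is the root of the first tree. According to whether it stands before
    -- `j`, is `j`, or stands after `j`, the node `j` is in a later tree, is this root, or is a
    -- descendant of it.
    have hmin : ∃ a ∈ l₁ ++ j :: l₂, ∀ y ∈ l₁ ++ j :: l₂, y ≠ a → a < y := by
      obtain ⟨m₁, a, m₂, h, h₁, h₂⟩ := exists_split_at_min (l := l₁ ++ j :: l₂) (by simp) hd
      refine ⟨a, by simp [h], fun y hy hya => ?_⟩
      rw [h, List.mem_append, List.mem_cons] at hy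
      rcases hy with hy | hy | hy
      · exact h₁ y hy
      · exact absurd hy hya
      · exact h₂ y hy
    obtain ⟨a, ha, hmin⟩ := hmin
    simp only [List.length_append, List.length_cons] at hN
    rw [List.mem_append, List.mem_cons] at ha
    rcases ha with ha | rfl | ha
    · obtain ⟨m₁, m₂, rfl⟩ := List.append_of_mem ha
      simp only [List.append_assoc, List.cons_append] at hd hx hmin hN ⊢
      have hd1 := List.nodup_append.1 hd
      have hd2 := List.nodup_cons.1 hd1.2.1
      have hm1 : ∀ y ∈ m₁, a < y := fun y hy => hmin y (by simp [hy])
        (hd1.2.2 y hy a List.mem_cons_self)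
      have hm2 : ∀ y ∈ m₂ ++ j :: l₂, a < y := fun y hy => hmin y
        (List.mem_append_right _ (List.mem_cons_of_mem _ hy)) (fun h => hd2.1 (h ▸ hy))
      have hja : j ≠ a := (hm2 j (by simp)).ne'
      have hjm : j ∉ m₁ := fun h => hd1.2.2 j h j (by simp) rfl
      simp only [List.length_append, List.length_cons] at hN
      rw [labelForest_append_of_min hm1 hm2, labelForest_append_of_min hm1, List.map_cons, attachTo,
        if_neg hja.symm, map_attachTo_labelForest_of_notMem j x m₁ hd1.1 hjm,
        ih (m₂ ++ j :: l₂).length (by simp; omega) m₂ l₂ hd2.2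
          (fun y hy => hx y (List.mem_append_right _ (List.mem_cons_of_mem _ hy))) rfl]
      intro y hy
      rw [List.mem_append, List.mem_cons] at hy
      rcases hy with hy | rfl | hy
      · exact hm2 y (by simp [hy])
      · exact hx a (by simp)
      · exact hm2 y (List.mem_append_right _ hy)
    · have hd1 := List.nodup_append.1 hd
      have hd2 := List.nodup_cons.1 hd1.2.1
      have hm1 : ∀ y ∈ l₁, a < y := fun y hy => hmin y (by simp [hy])
        (hd1.2.2 y hy a List.mem_cons_self)
      have hm2 : ∀ y ∈ l₂, a < y := fun y hy => hmin y (by simp [hy]) (fun h => hd2.1 (h ▸ hy))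
      rw [show l₁ ++ x :: a :: l₂ = (l₁ ++ [x]) ++ a :: l₂ by simp,
        labelForest_append_of_min hm1 hm2, labelForest_append_of_min _ hm2, List.map_cons, attachTo,
        if_pos rfl, labelForest_append_singleton x l₁ hd1.1 (fun y hy => hx y (by simp [hy])),
        map_attachTo_labelForest_of_notMem a x l₂ hd2.2 hd2.1]
      intro y hy
      rcases List.mem_append.1 hy with hy | hy
      · exact hm1 y hy
      · rw [List.mem_singleton.1 hy]
        exact hx a (by simp)
    · obtain ⟨m₁, m₂, rfl⟩ := List.append_of_mem ha
      rw [show l₁ ++ j :: (m₁ ++ a :: m₂) = (l₁ ++ j :: m₁) ++ a :: m₂ by simp] at hd hx hmin ⊢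
      rw [show l₁ ++ x :: j :: (m₁ ++ a :: m₂) = (l₁ ++ x :: j :: m₁) ++ a :: m₂ by simp]
      have hd1 := List.nodup_append.1 hd
      have hd2 := List.nodup_cons.1 hd1.2.1
      have hm1 : ∀ y ∈ l₁ ++ j :: m₁, a < y := fun y hy => hmin y (List.mem_append_left _ hy)
        (hd1.2.2 y hy a List.mem_cons_self)
      have hm2 : ∀ y ∈ m₂, a < y := fun y hy => hmin y (by simp [hy]) (fun h => hd2.1 (h ▸ hy))
      have hja : j ≠ a := (hm1 j (by simp)).ne'
      have hjm : j ∉ m₂ := fun h => hd1.2.2 j (by simp) j (by simp [h]) rfl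
      simp only [List.length_append, List.length_cons] at hN
      rw [labelForest_append_of_min hm1 hm2, labelForest_append_of_min _ hm2, List.map_cons, attachTo,
        if_neg hja.symm, map_attachTo_labelForest_of_notMem j x m₂ hd2.2 hjm,
        ih (l₁ ++ j :: m₁).length (by simp; omega) l₁ m₁ hd1.1
          (fun y hy => hx y (List.mem_append_left _ hy)) rfl]
      intro y hy
      rw [List.mem_append, List.mem_cons] at hy
      rcases hy with hy | rfl | hy
      · exact hm1 y (by simp [hy])
      · exact hx a (by simp)
      · exact hm1 y (List.mem_append_right _ hy)

/-- The labels `σ i + 2` in the order of the positions `i`. -/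
def labels {n : ℕ} (σ : Equiv.Perm (Fin n)) : List ℕ := List.ofFn fun i => (σ i : ℕ) + 2

theorem nodup_labels {n : ℕ} (σ : Equiv.Perm (Fin n)) : (labels σ).Nodup := by
  rw [labels, List.nodup_ofFn]
  intro i j h
  exact σ.injective (Fin.ext (by simpa using h))

theorem mem_labels_lt {n : ℕ} (σ : Equiv.Perm (Fin n)) : ∀ y ∈ labels σ, y < n + 2 := by
  intro y hy
  rw [labels, List.mem_ofFn] at hy
  obtain ⟨i, rfl⟩ := hy
  have := (σ i).isLt
  omega

/-- Insertion of a new maximal value at position `p` of a permutation. -/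
def insertMax {n : ℕ} (σ : Equiv.Perm (Fin n)) (p : Fin (n + 1)) : Equiv.Perm (Fin (n + 1)) :=
  (finSuccEquiv' p).trans ((Equiv.optionCongr σ).trans (finSuccEquiv' (Fin.last n)).symm)

theorem insertMax_self {n : ℕ} (σ : Equiv.Perm (Fin n)) (p : Fin (n + 1)) :
    insertMax σ p p = Fin.last n := by
  simp [insertMax]

theorem insertMax_succAbove {n : ℕ} (σ : Equiv.Perm (Fin n)) (p : Fin (n + 1)) (i : Fin n) :
    insertMax σ p (p.succAbove i) = (σ i).castSucc := by
  simp [insertMax]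

theorem insertMax_injective (n : ℕ) : Function.Injective fun x : Equiv.Perm (Fin n) × Fin (n + 1) =>
    insertMax x.1 x.2 := by
  rintro ⟨σ, p⟩ ⟨τ, q⟩ h
  simp only at h
  have hpq : p = q := (insertMax τ q).injective (by rw [← h, insertMax_self, h, insertMax_self])
  subst hpq
  refine Prod.ext (Equiv.ext fun i => ?_) rfl
  have := insertMax_succAbove σ p i
  rw [h, insertMax_succAbove] at this
  exact (Fin.castSucc_injective _ this).symm

theorem insertIdx_append_length {α : Type} (l₁ l₂ : List α) (x : α) :
    (l₁ ++ l₂).insertIdx l₁.length x = l₁ ++ x :: l₂ := by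
  induction l₁ with
  | nil => simp
  | cons a l ih => simp [ih]

theorem labels_insertMax {n : ℕ} (σ : Equiv.Perm (Fin n)) (p : Fin (n + 1)) :
    labels (insertMax σ p) = (labels σ).insertIdx p (n + 2) := by
  have hl : (labels σ).length = n := by simp [labels]
  have hl' : ((labels σ).insertIdx p (n + 2)).length = n + 1 := by
    rw [List.length_insertIdx_of_le_length (by rw [hl]; omega), hl]
  refine List.ext_getElem (by rw [hl']; simp [labels]) fun i h1 h2 => ?_
  rw [hl'] at h2
  rw [List.getElem_insertIdx]
  simp only [labels, List.getElem_ofFn]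
  split_ifs with h3 h4
  · have : (⟨i, h2⟩ : Fin (n + 1)) = p.succAbove ⟨i, by omega⟩ := by
      rw [Fin.succAbove_of_castSucc_lt]
      · rfl
      · exact h3
    rw [this, insertMax_succAbove]
    rfl
  · have : (⟨i, h2⟩ : Fin (n + 1)) = p := Fin.ext h4
    rw [this, insertMax_self]
    rfl
  · have : (⟨i, h2⟩ : Fin (n + 1)) = p.succAbove ⟨i - 1, by omega⟩ := by
      rw [Fin.succAbove_of_le_castSucc]
      · ext
        simp
        omega
      · rw [Fin.le_def]
        simp
        omega
    rw [this, insertMax_succAbove]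
    rfl

/-- The position before which a new child of the node labelled `j + 1` is inserted. -/
def attachPosition {n : ℕ} (σ : Equiv.Perm (Fin n)) (j : Fin (n + 1)) : Fin (n + 1) :=
  Fin.cases (Fin.last n) (fun i => (σ.symm i).castSucc) j

theorem attachPosition_injective {n : ℕ} (σ : Equiv.Perm (Fin n)) :
    Function.Injective (attachPosition σ) := by
  intro i j
  refine Fin.cases ?_ (fun i => ?_) i <;> refine Fin.cases ?_ (fun j => ?_) j
  · simp
  · intro h
    exact absurd h.symm (Fin.castSucc_lt_last _).ne
  · intro h
    exact absurd h (Fin.castSucc_lt_last _).ne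
  · intro h
    simpa [attachPosition] using h

/-- The root `1` is absent from `labels σ` and would come last in postorder; hence a child of the
root is appended at the end of the list. -/
theorem attachTo_labelForest {n : ℕ} (σ : Equiv.Perm (Fin n)) (j : Fin (n + 1)) :
    attachTo (j + 1) (n + 2) (.node 1 (labelForest (labels σ))) =
      .node 1 (labelForest (labels (insertMax σ (attachPosition σ j)))) := by
  have hl : (labels σ).length = n := by simp [labels]
  rw [labels_insertMax]
  refine Fin.cases ?_ (fun i => ?_) j
  · have : (labels σ).insertIdx (attachPosition σ 0 : Fin (n + 1)) (n + 2) =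
        labels σ ++ [n + 2] := by
      have := insertIdx_append_length (labels σ) [] (n + 2)
      rwa [List.append_nil, hl] at this
    rw [this, labelForest_append_singleton _ _ (nodup_labels σ) (mem_labels_lt σ), attachTo]
    simp
  · set p := σ.symm i with hp
    have hpos : ((attachPosition σ i.succ : Fin (n + 1)) : ℕ) = p := by
      simp [attachPosition, hp]
    have hget : (labels σ)[(p : ℕ)]'(by omega) = i + 2 := by
      simp [labels, hp]
    have hsplit : labels σ = (labels σ).take p ++ ((i : ℕ) + 2) :: (labels σ).drop (p + 1) := by
      rw [← hget, List.getElem_cons_drop, List.take_append_drop]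
    have hlen : ((labels σ).take p).length = p := by
      rw [List.length_take, hl]
      omega
    have hins : (labels σ).insertIdx p (n + 2) =
        (labels σ).take p ++ (n + 2) :: ((i : ℕ) + 2) :: (labels σ).drop (p + 1) := by
      have := insertIdx_append_length ((labels σ).take p)
        (((i : ℕ) + 2) :: (labels σ).drop (p + 1)) (n + 2)
      rwa [← hsplit, hlen] at this
    rw [hpos, hins, ← map_attachTo_labelForest, ← hsplit, attachTo, if_neg]
    · rw [Fin.val_succ]
    · simp
    · rw [← hsplit]
      exact nodup_labels σ
    · rw [← hsplit]
      exact mem_labels_lt σ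

theorem recursiveTree_succ_succ (n : ℕ) :
    recursiveTree (n + 2) = (recursiveTree (n + 1)).bind fun t =>
      (PMF.uniformOfFintype (Fin (n + 1))).map fun j : Fin (n + 1) => attachTo (j + 1) (n + 2) t := by
  rw [recursiveTree]
  congr 1
  funext t
  exact PMF.map_comp (fun j : Fin (n + 1) => (j : ℕ)) _ fun j => attachTo (j + 1) (n + 2) t

/-- The pair of a permutation and the uniformly chosen parent determines bijectively the permutation
with the new maximum inserted, so each growth step carries the uniform law on `Perm (Fin n)` to the
uniform law on `Perm (Fin (n + 1))`. -/
theorem recursiveTree_succ (n : ℕ) :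
    recursiveTree (n + 1) = (PMF.uniformOfFintype (Equiv.Perm (Fin n))).map fun σ =>
      .node 1 (labelForest (labels σ)) := by
  induction n with
  | zero =>
    have : (fun σ : Equiv.Perm (Fin 0) => OrderedTree.node 1 (labelForest (labels σ))) =
        Function.const _ (.node 1 []) := by
      funext σ
      rw [labels, List.ofFn_zero]
      rfl
    rw [this, PMF.map_const]
    rfl
  | succ n ih =>
    rw [recursiveTree_succ_succ, ih, PMF.bind_map]
    have hbij : Function.Bijective fun x : Equiv.Perm (Fin n) × Fin (n + 1) =>
        insertMax x.1 (attachPosition x.1 x.2) := by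
      rw [Fintype.bijective_iff_injective_and_card]
      constructor
      · rintro ⟨σ, i⟩ ⟨τ, j⟩ h
        have := insertMax_injective n (a₁ := (σ, _)) (a₂ := (τ, _)) h
        simp only [Prod.mk.injEq] at this
        obtain ⟨rfl, h⟩ := this
        rw [attachPosition_injective σ h]
      · simp [Fintype.card_perm, Nat.factorial_succ, mul_comm]
    have huniv : PMF.uniformOfFintype (Equiv.Perm (Fin (n + 1))) =
        (PMF.uniformOfFintype (Equiv.Perm (Fin n))).bind fun σ =>
          (PMF.uniformOfFintype (Fin (n + 1))).map fun j => insertMax σ (attachPosition σ j) := by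
      ext π
      obtain ⟨⟨τ, i⟩, rfl⟩ := hbij.2 π
      simp only [PMF.uniformOfFintype_apply, PMF.bind_apply, PMF.map_apply, tsum_fintype]
      have : ∀ σ j, insertMax τ (attachPosition τ i) = insertMax σ (attachPosition σ j) ↔
          τ = σ ∧ i = j := fun σ j => by
        rw [← Prod.mk.injEq]
        exact hbij.1.eq_iff (a := (τ, i)) (b := (σ, j))
      simp only [this, Finset.mul_sum]
      rw [Finset.sum_eq_single τ, Finset.sum_eq_single i]
      · simp only [and_self, if_true, Fintype.card_perm, Fintype.card_fin, Nat.factorial_succ]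
        push_cast
        rw [ENNReal.mul_inv (by simp) (by simp), mul_comm]
      · intro b _ hb
        simp [hb.symm]
      · simp
      · intro b _ hb
        simp [hb.symm]
      · simp
    rw [huniv, PMF.map_bind]
    congr 1
    funext σ
    rw [PMF.map_comp]
    simp only [Function.comp_apply]
    congr 1
    funext j
    exact attachTo_labelForest σ j

theorem uniformOfFintype_map_equiv {α β : Type} [Fintype α] [Nonempty α] [Fintype β] [Nonempty β]
    (e : α ≃ β) : (PMF.uniformOfFintype α).map e = PMF.uniformOfFintype β := by
  ext b
  rw [PMF.map_apply, tsum_fintype, Finset.sum_eq_single (e.symm b)]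
  · simp [Fintype.card_congr e]
  · intro a _ ha
    rw [if_neg]
    rintro rfl
    simp at ha
  · simp

theorem perm_ofFn_finRange {n : ℕ} (π : Equiv.Perm (Fin n)) :
    (List.ofFn fun i => π i).Perm (List.finRange n) := by
  rw [List.perm_ext_iff_of_nodup (List.nodup_ofFn.2 π.injective) (List.nodup_finRange n)]
  intro a
  simp only [List.mem_ofFn, List.mem_finRange, iff_true]
  exact π.surjective a

theorem bstOfList_ofFn_eq_cartTree {n : ℕ} {κ : Type} [LinearOrder κ] (π : Equiv.Perm (Fin n))
    (u : Fin n → κ) (hu : StrictAnti fun i => u (π i)) :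
    bstOfList (List.ofFn fun i => π i) = cartTree u (List.finRange n) :=
  bstOfList_eq_cartTree u _ _ (perm_ofFn_finRange π) (List.pairwise_lt_finRange n)
    (List.pairwise_ofFn.2 fun _ _ h => hu h)

/-- The random recursive tree is the image of the random binary search tree. -/
theorem randomRRT_succ (n : ℕ) : randomRRT (n + 1) = (randomBST n).map rotateTree := by
  -- The inverse of a uniform permutation is uniform. If `π` is the insertion order of the keys,
  -- then `π⁻¹ i` is the insertion time of key `i`; shifted by `2` it is the label of the
  -- corresponding node of the recursive tree.
  rw [randomRRT, recursiveTree_succ, randomBST, PMF.map_comp, PMF.map_comp,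
    ← uniformOfFintype_map_equiv (Equiv.inv (Equiv.Perm (Fin n))), PMF.map_comp,
    uniformOfFintype_map_equiv]
  congr 1
  funext π
  simp only [Function.comp_apply, Equiv.inv_apply]
  rw [bstOfList_ofFn_eq_cartTree π (fun i => -(((π⁻¹ i : ℕ) + 2 : ℕ) : ℤ)) (fun i j h => by
    have : (i : ℕ) < j := h
    simp
    omega), OrderedTree.map, labelForest, map_rotate, labels, List.ofFn_eq_map,
    cartTree_map, rotate_comp_map, rotateTree, rotate_comp_map]
  rfl

/-! ### Window functionals of independent sequences -/

/-- The law of a sequence of independent random variables with law `ν`. -/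
abbrev iidMeasure (ν : Measure ℝ) [IsProbabilityMeasure ν] : Measure (ℕ → ℝ) :=
  Measure.infinitePi fun _ => ν

/-- The shift of sequences. -/
def shift (a : ℕ) (u : ℕ → ℝ) : ℕ → ℝ := fun j => u (a + j)

theorem shift_shift (a b : ℕ) (u : ℕ → ℝ) : shift a (shift b u) = shift (b + a) u := by
  funext j
  simp [shift, add_assoc]

@[simp] theorem shift_zero (u : ℕ → ℝ) : shift 0 u = u := by
  funext j
  simp [shift]

theorem measurable_shift (a : ℕ) : Measurable (shift a) :=
  measurable_pi_lambda _ fun j => measurable_pi_apply (a + j)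

theorem measurePreserving_shift (ν : Measure ℝ) [IsProbabilityMeasure ν] (a : ℕ) :
    MeasurePreserving (shift a) (iidMeasure ν) (iidMeasure ν) :=
  ⟨measurable_shift a, Measure.map_infinitePi_infinitePi_of_inj (P := fun _ : ℕ => ν)
    (add_right_injective a)⟩

/-- Functions of disjoint sets of coordinates are independent. -/
theorem indepFun_of_dependsOn (ν : Measure ℝ) [IsProbabilityMeasure ν] {β γ : Type*}
    [MeasurableSpace β] [MeasurableSpace γ] {f : (ℕ → ℝ) → β} {g : (ℕ → ℝ) → γ}
    (hf : Measurable f) (hg : Measurable g) (S T : Finset ℕ) (hST : Disjoint S T)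
    (hfS : DependsOn f (S : Set ℕ)) (hgT : DependsOn g (T : Set ℕ)) :
    IndepFun f g (iidMeasure ν) := by
  classical
  have hind : iIndepFun (fun i (u : ℕ → ℝ) => u i) (iidMeasure ν) :=
    iIndepFun_infinitePi (X := fun _ x => x) fun _ => measurable_id
  have h := hind.indepFun_finset S T hST fun i => measurable_pi_apply i
  -- Extension by zero: a function depending only on the coordinates in `R` factors through the
  -- restriction to `R` followed by this map.
  let ext : ∀ R : Finset ℕ, (R → ℝ) → ℕ → ℝ := fun R x i => if h : i ∈ R then x ⟨i, h⟩ else 0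
  have hext : ∀ R, Measurable (ext R) := fun R => by
    refine measurable_pi_lambda _ fun i => ?_
    by_cases h : i ∈ R
    · simpa [ext, h] using measurable_pi_apply (⟨i, h⟩ : R)
    · simp [ext, h]
  have h2 := h.comp (hf.comp (hext S)) (hg.comp (hext T))
  have e1 : (f ∘ ext S) ∘ (fun (a : ℕ → ℝ) (i : S) => a i) = f := by
    funext u
    refine hfS fun i hi => ?_
    simp only [Finset.mem_coe] at hi
    simp [ext, hi]
  have e2 : (g ∘ ext T) ∘ (fun (a : ℕ → ℝ) (i : T) => a i) = g := by
    funext u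
    refine hgT fun i hi => ?_
    simp only [Finset.mem_coe] at hi
    simp [ext, hi]
  rwa [e1, e2] at h2

/-- Bounded measurable functions of the first `w` coordinates. -/
structure IsWindow (g : (ℕ → ℝ) → ℝ) (w : ℕ) (C : ℝ) : Prop where
  measurable : Measurable g
  dependsOn : DependsOn g (Set.Iio w)
  bound : ∀ u, |g u| ≤ C

/-! ### Covariances of window functionals at given lags -/

section Window

variable {ν : Measure ℝ} [IsProbabilityMeasure ν] {g h : (ℕ → ℝ) → ℝ} {w : ℕ} {C D : ℝ}

theorem dependsOn_comp_shift {β : Type*} {g : (ℕ → ℝ) → β} (hg : DependsOn g (Set.Iio w)) (i : ℕ) :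
    DependsOn (fun u => g (shift i u)) (Finset.Ico i (i + w) : Set ℕ) := by
  intro u v huv
  refine hg fun j hj => huv (i + j) ?_
  simp only [Set.mem_Iio] at hj
  simp [hj]

theorem IsWindow.comp_shift (hg : IsWindow g w C) (i : ℕ) :
    IsWindow (fun u => g (shift i u)) (i + w) C where
  measurable := hg.measurable.comp (measurable_shift i)
  dependsOn := (dependsOn_comp_shift hg.dependsOn i).mono fun j hj => by
    simp only [Finset.coe_Ico, Set.mem_Ico] at hj
    exact hj.2
  bound u := hg.bound _

theorem memLp_of_bound {Ω : Type*} [MeasurableSpace Ω] {μ : Measure Ω} [IsFiniteMeasure μ]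
    {f : Ω → ℝ} (hf : Measurable f) {C : ℝ} (hC : ∀ u, |f u| ≤ C) (p : ENNReal) : MemLp f p μ :=
  MemLp.of_bound hf.aestronglyMeasurable C (Eventually.of_forall hC)

theorem IsWindow.memLp (hg : IsWindow g w C) (p : ENNReal) : MemLp g p (iidMeasure ν) :=
  memLp_of_bound hg.measurable hg.bound p

theorem covariance_comp_shift (hg : Measurable g) (hh : Measurable h) (a : ℕ) :
    cov[fun u => g (shift a u), fun u => h (shift a u); iidMeasure ν] =
      cov[g, h; iidMeasure ν] := by
  have := covariance_map_fun (μ := iidMeasure ν) (X := g) (Y := h) (Z := shift a)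
    hg.aestronglyMeasurable hh.aestronglyMeasurable (measurable_shift a).aemeasurable
  rw [← this, (measurePreserving_shift ν a).map_eq]

/-- The covariance of two window functionals at the positions `i` and `j`. -/
def windowCov (ν : Measure ℝ) [IsProbabilityMeasure ν] (g h : (ℕ → ℝ) → ℝ) (i j : ℕ) : ℝ :=
  cov[fun u => g (shift i u), fun u => h (shift j u); iidMeasure ν]

theorem windowCov_add (hg : Measurable g) (hh : Measurable h) (a i j : ℕ) :
    windowCov ν g h (a + i) (a + j) = windowCov ν g h i j := by
  have := covariance_comp_shift (ν := ν) (hg.comp (measurable_shift i))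
    (hh.comp (measurable_shift j)) a
  simp only [Function.comp_apply, shift_shift] at this
  exact this

theorem windowCov_eq_zero {w' : ℕ} (hg : IsWindow g w C) (hh : IsWindow h w' D) {i j : ℕ}
    (hij : i + w ≤ j ∨ j + w' ≤ i) : windowCov ν g h i j = 0 := by
  refine IndepFun.covariance_eq_zero ?_ ((hg.comp_shift i).memLp 2) ((hh.comp_shift j).memLp 2)
  refine indepFun_of_dependsOn ν (hg.comp_shift i).measurable (hh.comp_shift j).measurable
    (Finset.Ico i (i + w)) (Finset.Ico j (j + w')) ?_ (dependsOn_comp_shift hg.dependsOn i)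
    (dependsOn_comp_shift hh.dependsOn j)
  rw [Finset.disjoint_left]
  intro a ha hb
  rw [Finset.mem_Ico] at ha hb
  omega

theorem abs_windowCov_le (hg : IsWindow g w C) (hh : IsWindow h w D) (i j : ℕ) :
    |windowCov ν g h i j| ≤ 4 * (C * D) := by
  have hC : 0 ≤ C := (abs_nonneg _).trans (hg.bound 0)
  have key : ∀ (f : (ℕ → ℝ) → ℝ) (E : ℝ), (∀ u, |f u| ≤ E) → ∀ u,
      |f u - ∫ v, f v ∂iidMeasure ν| ≤ 2 * E := by
    intro f E hf u
    have h1 : |∫ v, f v ∂iidMeasure ν| ≤ E := by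
      have := norm_integral_le_of_norm_le_const (μ := iidMeasure ν) (f := f) (Eventually.of_forall hf)
      simpa using this
    calc _ ≤ |f u| + |∫ v, f v ∂iidMeasure ν| := abs_sub _ _
      _ ≤ 2 * E := by linarith [hf u]
  rw [windowCov, covariance]
  have := norm_integral_le_of_norm_le_const (μ := iidMeasure ν)
    (f := fun u => (g (shift i u) - ∫ v, g (shift i v) ∂iidMeasure ν) *
      (h (shift j u) - ∫ v, h (shift j v) ∂iidMeasure ν)) (C := (2 * C) * (2 * D))
    (Eventually.of_forall fun u => by
      rw [Real.norm_eq_abs, abs_mul]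
      exact mul_le_mul (key _ C (fun u => hg.bound _) u) (key _ D (fun u => hh.bound _) u)
        (abs_nonneg _) (by linarith))
  simp only [probReal_univ, mul_one, Real.norm_eq_abs] at this
  calc _ ≤ _ := this
    _ = _ := by ring

/-- Sums of a window functional over the first `n` windows. -/
def windowSum (g : (ℕ → ℝ) → ℝ) (n : ℕ) (u : ℕ → ℝ) : ℝ :=
  ∑ i ∈ Finset.range n, g (shift i u)

theorem IsWindow.windowSum (hg : IsWindow g w C) (n : ℕ) :
    IsWindow (windowSum g n) (n + w) (n * C) where
  measurable := Finset.measurable_sum _ fun i _ => (hg.comp_shift i).measurable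
  dependsOn := fun u v huv => Finset.sum_congr rfl fun i hi =>
    (hg.comp_shift i).dependsOn fun j hj => huv j (by
      simp only [Set.mem_Iio, Finset.mem_range] at *
      omega)
  bound u := by
    refine (Finset.abs_sum_le_sum_abs _ _).trans ?_
    calc _ ≤ ∑ i ∈ Finset.range n, C := Finset.sum_le_sum fun i _ => hg.bound _
      _ = _ := by simp

theorem covariance_windowSum (hg : IsWindow g w C) (hh : IsWindow h w D) (n m : ℕ) :
    cov[windowSum g n, windowSum h m; iidMeasure ν] =
      ∑ i ∈ Finset.range n, ∑ j ∈ Finset.range m, windowCov ν g h i j :=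
  covariance_fun_sum_fun_sum' (fun i _ => (hg.comp_shift i).memLp 2)
    (fun j _ => (hh.comp_shift j).memLp 2)

/-- The asymptotic covariance of sums of window functionals. -/
def asympCov (ν : Measure ℝ) [IsProbabilityMeasure ν] (g h : (ℕ → ℝ) → ℝ) (w : ℕ) : ℝ :=
  (∑ l ∈ Finset.range w, windowCov ν g h 0 l) + ∑ l ∈ Finset.range w, windowCov ν g h (l + 1) 0

/-- The covariance of two window sums is exactly affine in `n` for `n ≥ w`, so its linear
coefficient is the limit. -/
theorem tendsto_div_of_increments {A : ℕ → ℝ} {c : ℝ} {w : ℕ}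
    (hA : ∀ n, w ≤ n → A (n + 1) = A n + c) :
    Tendsto (fun n : ℕ => 1 / (n : ℝ) * A n) atTop (𝓝 c) := by
  have h1 : ∀ n, A (w + n) = A w + n * c := by
    intro n
    induction n with
    | zero => simp
    | succ n ih => rw [← add_assoc, hA _ (by omega), ih]; push_cast; ring
  have h2 : Tendsto (fun n : ℕ => c + (A w - w * c) / (n : ℝ)) atTop (𝓝 (c + 0)) :=
    tendsto_const_nhds.add (tendsto_const_div_atTop_nhds_zero_nat _)
  rw [add_zero] at h2
  refine h2.congr' ?_
  filter_upwards [eventually_ge_atTop (max w 1)] with n hn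
  obtain ⟨k, rfl⟩ := Nat.exists_eq_add_of_le ((le_max_left w 1).trans hn)
  have : ((w + k : ℕ) : ℝ) ≠ 0 := by
    have := (le_max_right w 1).trans hn
    positivity
  rw [h1 k]
  field_simp
  push_cast
  ring

theorem tendsto_covariance_windowSum (hg : IsWindow g w C) (hh : IsWindow h w D) :
    Tendsto (fun n : ℕ => 1 / (n : ℝ) * cov[windowSum g n, windowSum h n; iidMeasure ν]) atTop
      (𝓝 (asympCov ν g h w)) := by
  refine tendsto_div_of_increments (w := w) fun n hn => ?_
  rw [covariance_windowSum hg hh, covariance_windowSum hg hh, Finset.sum_range_succ]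
  simp only [Finset.sum_range_succ, Finset.sum_add_distrib]
  -- Passing from `n` to `n + 1` adds a row and a column to the double sum. Only the last `w`
  -- entries of the row survive; the column is treated below together with the diagonal entry, which
  -- is why lag `0` appears only in the first sum of `asympCov`.
  have h1 : ∑ j ∈ Finset.range n, windowCov ν g h n j =
      ∑ l ∈ Finset.range w, windowCov ν g h (l + 1) 0 := by
    rw [← Finset.sum_range_reflect]
    obtain ⟨k, rfl⟩ := Nat.exists_eq_add_of_le hn
    rw [Finset.sum_range_add, Finset.sum_eq_zero (s := Finset.range k), add_zero]
    · refine Finset.sum_congr rfl fun l hl => ?_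
      rw [Finset.mem_range] at hl
      rw [← windowCov_add hg.measurable hh.measurable (w + k - 1 - l) (l + 1) 0]
      congr 1 <;> omega
    · intro l hl
      rw [Finset.mem_range] at hl
      exact windowCov_eq_zero hg hh (by omega)
  have h2 : ∑ i ∈ Finset.range n, windowCov ν g h i n + windowCov ν g h n n =
      ∑ l ∈ Finset.range w, windowCov ν g h 0 l := by
    rw [← Finset.sum_range_succ (fun i => windowCov ν g h i n), ← Finset.sum_range_reflect]
    obtain ⟨k, rfl⟩ := Nat.exists_eq_add_of_le hn
    rw [add_assoc, Finset.sum_range_add, Finset.sum_eq_zero (s := Finset.range (k + 1)), add_zero]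
    · refine Finset.sum_congr rfl fun l hl => ?_
      rw [Finset.mem_range] at hl
      rw [← windowCov_add hg.measurable hh.measurable (w + k - l) 0 l]
      congr 1 <;> omega
    · intro l hl
      rw [Finset.mem_range] at hl
      exact windowCov_eq_zero hg hh (by omega)
  rw [asympCov, ← h1, ← h2]
  ring

/-- The variance of a sum over arbitrary windows is at most linear in their number. -/
theorem variance_sum_windows_le (hg : IsWindow g w C) (A : Finset ℕ) :
    Var[fun u => ∑ i ∈ A, g (shift i u); iidMeasure ν] ≤ A.card * (2 * w * (4 * (C * C))) := by
  rw [← covariance_self (Finset.measurable_sum _ fun i _ =>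
    (hg.comp_shift i).measurable).aemeasurable,
    covariance_fun_sum_fun_sum' (fun i _ => (hg.comp_shift i).memLp 2)
      (fun i _ => (hg.comp_shift i).memLp 2), ← nsmul_eq_mul]
  refine Finset.sum_le_card_nsmul _ _ _ fun i _ => ?_
  have hC : 0 ≤ 4 * (C * C) := (abs_nonneg _).trans (abs_windowCov_le (ν := ν) hg hg 0 0)
  have hsub : (A.filter fun j => ¬ (i + w ≤ j ∨ j + w ≤ i)) ⊆ Finset.Ico (i + 1 - w) (i + w) := by
    intro j hj
    rw [Finset.mem_filter] at hj
    rw [Finset.mem_Ico]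
    omega
  have hcard := (Finset.card_le_card hsub).trans_eq (Nat.card_Ico _ _)
  calc ∑ j ∈ A, windowCov ν g g i j
      = ∑ j ∈ A.filter (fun j => ¬ (i + w ≤ j ∨ j + w ≤ i)), windowCov ν g g i j := by
        rw [Finset.sum_filter_of_ne]
        intro j _ hj h
        exact hj (windowCov_eq_zero hg hg h)
    _ ≤ (A.filter fun j => ¬ (i + w ≤ j ∨ j + w ≤ i)).card • (4 * (C * C)) :=
        Finset.sum_le_card_nsmul _ _ _ fun j _ => (le_abs_self _).trans (abs_windowCov_le hg hg i j)
    _ ≤ _ := by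
        rw [nsmul_eq_mul]
        refine mul_le_mul_of_nonneg_right ?_ hC
        have : (A.filter fun j => ¬ (i + w ≤ j ∨ j + w ≤ i)).card ≤ 2 * w := by omega
        exact_mod_cast this

end Window

/-! ### The central limit theorem for window functionals -/

/-! ### Characteristic functions: `L²` perturbation and the limit for independent sums -/

section CharFun

variable {Ω : Type*} [MeasurableSpace Ω] {P : Measure Ω} [IsProbabilityMeasure P]

theorem sq_integral_le_integral_sq {Z : Ω → ℝ} (hZ : MemLp Z 2 P) :
    (∫ ω, Z ω ∂P) ^ 2 ≤ ∫ ω, Z ω ^ 2 ∂P := by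
  have h := variance_nonneg Z P
  rw [variance_eq_sub hZ] at h
  simpa using h

/-- By `|exp (i x) - 1| ≤ |x|` and Cauchy–Schwarz. It lets a variable be replaced by an `L²`-close
one inside a limit of characteristic functions. -/
theorem norm_charFun_map_sub_le {X Y : Ω → ℝ} (hX : Measurable X) (hY : Measurable Y)
    (hXY : MemLp (fun ω => X ω - Y ω) 2 P) (t : ℝ) :
    ‖charFun (P.map X) t - charFun (P.map Y) t‖ ≤ |t| * √(∫ ω, (X ω - Y ω) ^ 2 ∂P) := by
  have hexp : ∀ Z : Ω → ℝ, Measurable Z → Integrable (fun ω => Complex.exp (t * Z ω * Complex.I)) P := by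
    intro Z hZ
    refine Integrable.of_bound (by fun_prop) 1 (Eventually.of_forall fun ω => ?_)
    rw [← Complex.ofReal_mul, Complex.norm_exp_ofReal_mul_I]
  have hrw : ∀ Z : Ω → ℝ, Measurable Z → charFun (P.map Z) t =
      ∫ ω, Complex.exp (t * Z ω * Complex.I) ∂P := by
    intro Z hZ
    rw [charFun_apply_real, integral_map hZ.aemeasurable (by fun_prop)]
  rw [hrw X hX, hrw Y hY, ← integral_sub (hexp X hX) (hexp Y hY)]
  have hpt : ∀ ω, ‖Complex.exp (t * X ω * Complex.I) - Complex.exp (t * Y ω * Complex.I)‖ ≤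
      |t| * |X ω - Y ω| := by
    intro ω
    have h1 : Complex.exp (t * X ω * Complex.I) - Complex.exp (t * Y ω * Complex.I) =
        Complex.exp ((t * Y ω : ℝ) * Complex.I) *
          (Complex.exp (Complex.I * (t * (X ω - Y ω) : ℝ)) - 1) := by
      rw [mul_sub, ← Complex.exp_add, mul_one]
      congr 2
      · push_cast
        ring
      · push_cast
        ring
    rw [h1, norm_mul, Complex.norm_exp_ofReal_mul_I, one_mul, ← abs_mul]
    exact Real.norm_exp_I_mul_ofReal_sub_one_le
  have hint : Integrable (fun ω => X ω - Y ω) P := hXY.integrable (by norm_num)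
  refine (norm_integral_le_of_norm_le (hint.abs.const_mul |t|)
    (Eventually.of_forall hpt)).trans ?_
  rw [integral_const_mul]
  refine mul_le_mul_of_nonneg_left ?_ (abs_nonneg t)
  refine Real.le_sqrt_of_sq_le ?_
  have := sq_integral_le_integral_sq hXY.abs
  simpa using this

/-- The classical central limit theorem after normalizing the variance to `1`; zero variance cannot
be normalized and means that `X` vanishes almost surely. -/
theorem tendsto_charFun_pow {X : Ω → ℝ} (hX : Measurable X) (hX2 : MemLp X 2 P)
    (h0 : ∫ ω, X ω ∂P = 0) (t : ℝ) :
    Tendsto (fun n : ℕ => charFun (P.map X) ((√n)⁻¹ * t) ^ n) atTop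
      (𝓝 (Complex.exp (-((∫ ω, X ω ^ 2 ∂P : ℝ) * t ^ 2 / 2 : ℝ)))) := by
  set v := ∫ ω, X ω ^ 2 ∂P with hv
  have hv0 : 0 ≤ v := integral_nonneg fun ω => sq_nonneg _
  rcases hv0.eq_or_lt with hv0 | hv0
  · have hX0 : X =ᵐ[P] fun _ => 0 := by
      have := (integral_eq_zero_iff_of_nonneg (fun ω => sq_nonneg (X ω)) hX2.integrable_sq).1
        hv0.symm
      filter_upwards [this] with ω hω
      simpa using hω
    have hc : ∀ s, charFun (P.map X) s = 1 := by
      intro s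
      rw [Measure.map_congr hX0, Measure.map_const]
      simp
    simp [hc, ← hv0]
  · have hs : √v ≠ 0 := (Real.sqrt_pos.2 hv0).ne'
    have h := tendsto_charFun_inv_sqrt_mul_pow (P := P) (X := fun ω => (√v)⁻¹ * X ω)
      (hX.const_mul _).aemeasurable (by rw [integral_const_mul, h0, mul_zero])
      (by
        simp only [Pi.pow_apply, mul_pow]
        rw [integral_const_mul, ← hv, inv_pow, Real.sq_sqrt hv0.le]
        field_simp) (√v * t)
    convert h using 2
    · rw [charFun_map_mul_comp hX.aemeasurable]
      congr 2
      field_simp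
    · congr 1
      have : ((√v : ℝ) : ℂ) ^ 2 = v := by
        rw [← Complex.ofReal_pow, Real.sq_sqrt hv0.le]
      push_cast
      rw [mul_pow, this]
      ring

end CharFun

/-! ### Independent blocks separated by gaps -/

section Blocks

variable {ν : Measure ℝ} [IsProbabilityMeasure ν] {g h : (ℕ → ℝ) → ℝ} {w : ℕ} {C D : ℝ}

theorem integral_comp_shift (hg : Measurable g) (i : ℕ) :
    ∫ u, g (shift i u) ∂iidMeasure ν = ∫ u, g u ∂iidMeasure ν := by
  rw [← (measurePreserving_shift ν i).map_eq,
    integral_map (measurable_shift i).aemeasurable hg.aestronglyMeasurable,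
    (measurePreserving_shift ν i).map_eq]

theorem IsWindow.finsetSum (hg : IsWindow g w C) (A : Finset ℕ) :
    ∃ N, IsWindow (fun u => ∑ i ∈ A, g (shift i u)) N (A.card * C) := by
  refine ⟨A.sup id + w, Finset.measurable_sum _ fun i _ => (hg.comp_shift i).measurable,
    fun u v huv => Finset.sum_congr rfl fun i hi =>
    (hg.comp_shift i).dependsOn fun j hj => huv j ?_, fun u => ?_⟩
  · have : i ≤ A.sup id := Finset.le_sup (f := id) hi
    simp only [Set.mem_Iio] at *
    omega
  · refine (Finset.abs_sum_le_sum_abs _ _).trans ?_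
    calc _ ≤ ∑ i ∈ A, C := Finset.sum_le_sum fun i _ => hg.bound _
      _ = _ := by simp

theorem integral_sum_shift_eq_zero (hg : IsWindow g w C) (h0 : ∫ u, g u ∂iidMeasure ν = 0)
    (A : Finset ℕ) : ∫ u, ∑ i ∈ A, g (shift i u) ∂iidMeasure ν = 0 := by
  rw [integral_finsetSum _ fun i _ => ((hg.comp_shift i).memLp 1).integrable le_rfl]
  exact Finset.sum_eq_zero fun i _ => by rw [integral_comp_shift hg.measurable, h0]

theorem integral_sq_sum_shift_le (hg : IsWindow g w C) (h0 : ∫ u, g u ∂iidMeasure ν = 0)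
    (A : Finset ℕ) :
    ∫ u, (∑ i ∈ A, g (shift i u)) ^ 2 ∂iidMeasure ν ≤ A.card * (2 * w * (4 * (C * C))) := by
  have h := variance_sum_windows_le (ν := ν) hg A
  rwa [variance_of_integral_eq_zero (Finset.measurable_sum _ fun i _ =>
    (hg.comp_shift i).measurable).aemeasurable (integral_sum_shift_eq_zero hg h0 A)] at h

/-- The positions in the first `b` places of the first `r` blocks of length `L`. -/
def blockPositions (r L b : ℕ) : Finset ℕ :=
  (Finset.range r ×ˢ Finset.range b).image fun x => x.1 * L + x.2

theorem blockPositions_injOn {r L b : ℕ} (hb : b ≤ L) :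
    Set.InjOn (fun x : ℕ × ℕ => x.1 * L + x.2) (Finset.range r ×ˢ Finset.range b : Finset _) := by
  rintro ⟨i, j⟩ h1 ⟨i', j'⟩ h2 h
  simp only [Finset.coe_product, Finset.coe_range, Set.mem_prod, Set.mem_Iio] at h1 h2 h
  have hL : 0 < L := by omega
  have e1 : ∀ i j, j < b → (i * L + j) / L = i := fun i j hj => by
    rw [add_comm, Nat.add_mul_div_right _ _ hL, Nat.div_eq_of_lt (by omega), zero_add]
  have hi : i = i' := by rw [← e1 i j h1.2, h, e1 i' j' h2.2]
  subst hi
  simpa using h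

theorem sum_blockPositions {r L b : ℕ} (hb : b ≤ L) (f : ℕ → ℝ) :
    ∑ i ∈ blockPositions r L b, f i = ∑ j ∈ Finset.range r, ∑ i ∈ Finset.range b, f (j * L + i) := by
  rw [blockPositions, Finset.sum_image (blockPositions_injOn hb), Finset.sum_product]

theorem card_blockPositions {r L b : ℕ} (hb : b ≤ L) : (blockPositions r L b).card = r * b := by
  rw [blockPositions, Finset.card_image_of_injOn (blockPositions_injOn hb)]
  simp

theorem blockPositions_subset {r L b n : ℕ} (hb : b ≤ L) (hn : r * L ≤ n) :
    blockPositions r L b ⊆ Finset.range n := by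
  intro x hx
  simp only [blockPositions, Finset.mem_image, Finset.mem_product, Finset.mem_range] at hx
  obtain ⟨⟨i, j⟩, ⟨hi, hj⟩, rfl⟩ := hx
  rw [Finset.mem_range]
  simp only at hi hj ⊢
  have : (i + 1) * L ≤ r * L := Nat.mul_le_mul_right _ hi
  rw [add_mul] at this
  omega

/-- A sum over `b` consecutive windows reads `b + w` coordinates. Blocks placed `b + w` apart
therefore read disjoint sets of coordinates and are independent and identically distributed. -/
theorem charFun_blocks (hg : IsWindow g w C) (b r : ℕ) (t : ℝ) :
    charFun ((iidMeasure ν).map fun u =>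
      ∑ i ∈ blockPositions r (b + w) b, g (shift i u)) t =
      charFun ((iidMeasure ν).map (windowSum g b)) t ^ r := by
  have hblock : ∀ r u, ∑ i ∈ blockPositions r (b + w) b, g (shift i u) =
      ∑ j ∈ Finset.range r, windowSum g b (shift (j * (b + w)) u) := by
    intro r u
    rw [sum_blockPositions (by omega)]
    simp only [windowSum, shift_shift]
  simp only [hblock]
  have hB := hg.windowSum b
  induction r with
  | zero =>
    simp only [Finset.range_zero, Finset.sum_empty, Measure.map_const]
    simp
  | succ r ih =>
    simp only [Finset.sum_range_succ]
    have hm : Measurable fun u => ∑ j ∈ Finset.range r, windowSum g b (shift (j * (b + w)) u) :=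
      Finset.measurable_sum _ fun j _ => (hB.comp_shift _).measurable
    rw [IndepFun.charFun_map_fun_add_eq_mul hm.aemeasurable
      (hB.comp_shift (r * (b + w))).measurable.aemeasurable, Pi.mul_apply, ih, pow_succ]
    · congr 2
      have := Measure.map_map (μ := iidMeasure ν) hB.measurable (measurable_shift (r * (b + w)))
      rw [(measurePreserving_shift ν _).map_eq] at this
      exact this.symm
    · refine indepFun_of_dependsOn ν hm (hB.comp_shift _).measurable (Finset.range (r * (b + w)))
        (Finset.Ico (r * (b + w)) (r * (b + w) + (b + w))) ?_ ?_
        (dependsOn_comp_shift hB.dependsOn _)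
      · rw [Finset.disjoint_left]
        intro a ha hb
        rw [Finset.mem_range] at ha
        rw [Finset.mem_Ico] at hb
        omega
      · intro u v huv
        refine Finset.sum_congr rfl fun j hj => dependsOn_comp_shift hB.dependsOn _ fun i hi => ?_
        refine huv i ?_
        rw [Finset.mem_range] at hj
        simp only [Finset.coe_Ico, Set.mem_Ico, Finset.coe_range, Set.mem_Iio] at hi ⊢
        have : (j + 1) * (b + w) ≤ r * (b + w) := Nat.mul_le_mul_right _ hj
        rw [add_mul] at this
        omega

end Blocks

/-! ### The blocking argument -/

section ScalarCLT

variable {ν : Measure ℝ} [IsProbabilityMeasure ν] {g : (ℕ → ℝ) → ℝ} {w : ℕ} {C : ℝ}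

/-- Two errors occur: the windows starting in a gap or in the incomplete last block, at most `r * w
+ L` of them, and the normalization by `√(r * L)` instead of `√n`. Both are controlled because the
variance over any set of windows is at most linear in its cardinality. -/
theorem integral_sq_normalized_diff_le (hg : IsWindow g w C)
    (h0 : ∫ u, g u ∂iidMeasure ν = 0) (b n : ℕ) (hb : 0 < b) (hn : b + w ≤ n) :
    ∫ u, ((√(n : ℝ))⁻¹ * windowSum g n u - (√((n / (b + w) * (b + w) : ℕ) : ℝ))⁻¹ *
        ∑ i ∈ blockPositions (n / (b + w)) (b + w) b, g (shift i u)) ^ 2 ∂iidMeasure ν ≤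
      2 * (2 * w * (4 * (C * C))) * ((w : ℝ) / (b + w : ℕ) + 2 * ((b + w : ℕ) / (n : ℝ))) := by
  set L := b + w with hL
  set r := n / L with hr
  set K : ℝ := 2 * w * (4 * (C * C)) with hK
  have hK0 : 0 ≤ K := by
    have : 0 ≤ C * C := mul_self_nonneg C
    positivity
  have hL0 : 0 < L := by omega
  have hrL : r * L ≤ n := Nat.div_mul_le_self n L
  have hnr : n < r * L + L := by
    have := Nat.lt_div_mul_add (a := n) hL0
    omega
  have hr1 : 1 ≤ r := (Nat.one_le_div_iff hL0).2 hn
  set A := blockPositions r L b with hA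
  have hAsub : A ⊆ Finset.range n := blockPositions_subset (by omega) hrL
  have hAcard : A.card = r * b := card_blockPositions (by omega)
  set R := Finset.range n \ A with hR
  have hRcard : (R.card : ℝ) ≤ r * w + L := by
    have h1 : R.card + r * b = n := by
      rw [hR, Finset.card_sdiff_of_subset hAsub, hAcard, Finset.card_range]
      have := Finset.card_le_card hAsub
      rw [hAcard, Finset.card_range] at this
      omega
    have h2 : R.card ≤ r * w + L := by
      rw [hL, mul_add] at hnr
      omega
    exact_mod_cast h2
  have hnpos : (0 : ℝ) < n := by
    have : 0 < n := by omega
    exact_mod_cast this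
  have hrLpos : (0 : ℝ) < (r * L : ℕ) := by
    have : 0 < r * L := Nat.mul_pos hr1 hL0
    exact_mod_cast this
  have hLpos : (0 : ℝ) < L := by exact_mod_cast hL0
  have hrLn : ((r * L : ℕ) : ℝ) ≤ n := by exact_mod_cast hrL
  have hs1 := Real.sqrt_pos.2 hnpos
  have hs2 := Real.sqrt_pos.2 hrLpos
  have hsplit : ∀ u, windowSum g n u = (∑ i ∈ R, g (shift i u)) + ∑ i ∈ A, g (shift i u) :=
    fun u => (Finset.sum_sdiff hAsub).symm
  obtain ⟨NR, hRw⟩ := hg.finsetSum R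
  obtain ⟨NA, hAw⟩ := hg.finsetSum A
  set c : ℝ := (√(n : ℝ))⁻¹ - (√((r * L : ℕ) : ℝ))⁻¹ with hc
  have hpt : ∀ u, ((√(n : ℝ))⁻¹ * windowSum g n u - (√((r * L : ℕ) : ℝ))⁻¹ *
      ∑ i ∈ A, g (shift i u)) ^ 2 ≤ 2 * (n : ℝ)⁻¹ * (∑ i ∈ R, g (shift i u)) ^ 2 +
      2 * c ^ 2 * (∑ i ∈ A, g (shift i u)) ^ 2 := by
    intro u
    rw [hsplit u]
    set x := ∑ i ∈ R, g (shift i u)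
    set y := ∑ i ∈ A, g (shift i u)
    have e1 : (√(n : ℝ))⁻¹ * (x + y) - (√((r * L : ℕ) : ℝ))⁻¹ * y = (√(n : ℝ))⁻¹ * x + c * y := by
      rw [hc]
      ring
    have e2 : (n : ℝ)⁻¹ = (√(n : ℝ))⁻¹ ^ 2 := by rw [inv_pow, Real.sq_sqrt hnpos.le]
    rw [e1, e2]
    nlinarith [sq_nonneg ((√(n : ℝ))⁻¹ * x - c * y)]
  have hi1 : Integrable (fun u => (∑ i ∈ R, g (shift i u)) ^ 2) (iidMeasure ν) :=
    (hRw.memLp 2).integrable_sq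
  have hi2 : Integrable (fun u => (∑ i ∈ A, g (shift i u)) ^ 2) (iidMeasure ν) :=
    (hAw.memLp 2).integrable_sq
  -- With `x = √(r * L / n)` the left side is `(1 - x) ^ 2 ≤ 1 - x ^ 2 ≤ L / n`, as fewer than `L`
  -- positions are cut off.
  have hc2 : c ^ 2 * (r * L : ℕ) ≤ L / n := by
    have e3 : c ^ 2 * (r * L : ℕ) = (1 - √((r * L : ℕ) : ℝ) / √(n : ℝ)) ^ 2 := by
      have e4 : c * √((r * L : ℕ) : ℝ) = √((r * L : ℕ) : ℝ) / √(n : ℝ) - 1 := by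
        rw [hc, sub_mul, inv_mul_cancel₀ hs2.ne', div_eq_inv_mul]
      calc c ^ 2 * (r * L : ℕ) = (c * √((r * L : ℕ) : ℝ)) ^ 2 := by
            rw [mul_pow, Real.sq_sqrt hrLpos.le]
        _ = _ := by
            rw [e4]
            ring
    set x := √((r * L : ℕ) : ℝ) / √(n : ℝ) with hx
    have hx0 : 0 ≤ x := by positivity
    have hx1 : x ≤ 1 := by
      rw [hx, div_le_one hs1]
      exact Real.sqrt_le_sqrt hrLn
    have hx2 : x ^ 2 = (r * L : ℕ) / n := by
      rw [hx, div_pow, Real.sq_sqrt hrLpos.le, Real.sq_sqrt hnpos.le]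
    have hx3 : 1 - x ^ 2 ≤ L / n := by
      rw [hx2, one_sub_div hnpos.ne', div_le_div_iff_of_pos_right hnpos]
      have : (n : ℝ) ≤ (r * L : ℕ) + L := by exact_mod_cast hnr.le
      linarith
    rw [e3]
    nlinarith
  have hrn : (r : ℝ) / n ≤ 1 / L := by
    rw [div_le_div_iff₀ hnpos hLpos, one_mul]
    exact_mod_cast hrL
  calc _ ≤ ∫ u, (2 * (n : ℝ)⁻¹ * (∑ i ∈ R, g (shift i u)) ^ 2 +
        2 * c ^ 2 * (∑ i ∈ A, g (shift i u)) ^ 2) ∂iidMeasure ν :=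
        integral_mono_of_nonneg (Eventually.of_forall fun u => sq_nonneg _)
          ((hi1.const_mul _).add (hi2.const_mul _)) (Eventually.of_forall hpt)
    _ = 2 * (n : ℝ)⁻¹ * ∫ u, (∑ i ∈ R, g (shift i u)) ^ 2 ∂iidMeasure ν +
        2 * c ^ 2 * ∫ u, (∑ i ∈ A, g (shift i u)) ^ 2 ∂iidMeasure ν := by
        rw [integral_add (hi1.const_mul _) (hi2.const_mul _), integral_const_mul,
          integral_const_mul]
    _ ≤ 2 * (n : ℝ)⁻¹ * (R.card * K) + 2 * c ^ 2 * (A.card * K) := by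
        gcongr
        · exact integral_sq_sum_shift_le hg h0 R
        · exact integral_sq_sum_shift_le hg h0 A
    _ ≤ 2 * (n : ℝ)⁻¹ * ((r * w + L) * K) + 2 * c ^ 2 * ((r * L : ℕ) * K) := by
        gcongr
        rw [hAcard]
        exact Nat.mul_le_mul_left r (by omega)
    _ = 2 * K * (w * (r / n) + L / n + c ^ 2 * (r * L : ℕ)) := by
        field_simp
    _ ≤ 2 * K * (w * (1 / L) + L / n + L / n) := by gcongr
    _ = _ := by ring

/-- The central limit theorem for bounded window functionals. -/
theorem tendsto_charFun_windowSum (hg : IsWindow g w C)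
    (h0 : ∫ u, g u ∂iidMeasure ν = 0) {σ : ℝ}
    (hσ : Tendsto (fun n : ℕ => 1 / (n : ℝ) * Var[windowSum g n; iidMeasure ν]) atTop (𝓝 σ))
    (t : ℝ) :
    Tendsto (fun n : ℕ => charFun ((iidMeasure ν).map fun u =>
      (√(n : ℝ))⁻¹ * windowSum g n u) t) atTop (𝓝 (Complex.exp (-(σ * t ^ 2 / 2 : ℝ)))) := by
  set K : ℝ := 2 * w * (4 * (C * C)) with hK
  set v : ℕ → ℝ := fun b => ∫ u, windowSum g b u ^ 2 ∂iidMeasure ν with hv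
  have hvar : ∀ b, Var[windowSum g b; iidMeasure ν] = v b := fun b =>
    variance_of_integral_eq_zero (hg.windowSum b).measurable.aemeasurable
      (integral_sum_shift_eq_zero hg h0 _)
  set lim : ℕ → ℂ := fun b => Complex.exp (-(v b * (t / √((b + w : ℕ) : ℝ)) ^ 2 / 2 : ℝ)) with hlim
  have hlimtends : Tendsto lim atTop (𝓝 (Complex.exp (-(σ * t ^ 2 / 2 : ℝ)))) := by
    have h1 : Tendsto (fun b : ℕ => (b : ℝ) / ((b : ℝ) + w)) atTop (𝓝 1) :=
      tendsto_natCast_div_add_atTop (w : ℝ)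
    have h2 := (hσ.mul h1).mul_const (t ^ 2 / 2)
    rw [mul_one] at h2
    have h3 : Tendsto (fun b : ℕ => v b * (t / √((b + w : ℕ) : ℝ)) ^ 2 / 2) atTop
        (𝓝 (σ * t ^ 2 / 2)) := by
      rw [mul_div_assoc]
      refine h2.congr' ?_
      filter_upwards [eventually_ge_atTop 1] with b hb
      have hb0 : (b : ℝ) ≠ 0 := by positivity
      have hbw : (0 : ℝ) < (b + w : ℕ) := by positivity
      rw [hvar, div_pow, Real.sq_sqrt hbw.le]
      push_cast at hbw ⊢
      field_simp
    have h4 : Continuous fun x : ℝ => Complex.exp (-(x : ℂ)) := by fun_prop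
    exact (h4.tendsto _).comp h3
  have herr : Tendsto (fun b : ℕ => |t| * √(2 * K * ((w : ℝ) / (b + w : ℕ) + 2 * 0))) atTop
      (𝓝 0) := by
    have h1 : Tendsto (fun b : ℕ => (w : ℝ) / (b + w : ℕ)) atTop (𝓝 0) :=
      (tendsto_const_div_atTop_nhds_zero_nat (w : ℝ)).comp (tendsto_add_atTop_nat w)
    have h2 : Continuous fun x : ℝ => |t| * √(2 * K * (x + 2 * 0)) := by fun_prop
    have h3 := (h2.tendsto 0).comp h1
    simpa [Function.comp_def] using h3
  rw [Metric.tendsto_atTop]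
  intro ε hε
  -- The order of choice matters: first `b`, so that the gaps are a small proportion and the block
  -- limit is near the target; only then `n`, with `b` fixed.
  obtain ⟨b, hb0, hb1, hb2⟩ : ∃ b : ℕ, 0 < b ∧
      |t| * √(2 * K * ((w : ℝ) / (b + w : ℕ) + 2 * 0)) < ε / 4 ∧
      dist (lim b) (Complex.exp (-(σ * t ^ 2 / 2 : ℝ))) < ε / 4 :=
    ((eventually_gt_atTop 0).and ((herr.eventually_lt_const (by positivity)).and
      (hlimtends.eventually (Metric.ball_mem_nhds _ (by positivity))))).exists
  set L := b + w with hL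
  have hL0 : L ≠ 0 := by omega
  have hLpos : (0 : ℝ) < L := by positivity
  have hchi : Tendsto (fun n : ℕ => charFun ((iidMeasure ν).map fun u =>
      (√((n / L * L : ℕ) : ℝ))⁻¹ * ∑ i ∈ blockPositions (n / L) L b, g (shift i u)) t) atTop
      (𝓝 (lim b)) := by
    have h1 := tendsto_charFun_pow (P := iidMeasure ν) (hg.windowSum b).measurable
      ((hg.windowSum b).memLp 2) (integral_sum_shift_eq_zero hg h0 _) (t / √(L : ℝ))
    refine (h1.comp (Nat.tendsto_div_const_atTop hL0)).congr fun n => ?_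
    obtain ⟨NA, hAw⟩ := hg.finsetSum (blockPositions (n / L) L b)
    rw [charFun_map_mul_comp hAw.measurable.aemeasurable, hL, charFun_blocks hg b, ← hL]
    simp only [Function.comp_apply]
    congr 2
    rw [Nat.cast_mul, Real.sqrt_mul (by positivity)]
    field_simp
  have herr2 : Tendsto (fun n : ℕ => |t| * √(2 * K * ((w : ℝ) / (b + w : ℕ) +
      2 * ((b + w : ℕ) / (n : ℝ))))) atTop
      (𝓝 (|t| * √(2 * K * ((w : ℝ) / (b + w : ℕ) + 2 * 0)))) := by
    have h2 : Continuous fun x : ℝ => |t| * √(2 * K * ((w : ℝ) / (b + w : ℕ) + 2 * x)) := by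
      fun_prop
    exact (h2.tendsto 0).comp (tendsto_const_div_atTop_nhds_zero_nat ((b + w : ℕ) : ℝ))
  obtain ⟨N, hN⟩ := eventually_atTop.1 ((eventually_ge_atTop L).and
    ((herr2.eventually_lt_const hb1).and
      (hchi.eventually (Metric.ball_mem_nhds _ (by positivity : 0 < ε / 4)))))
  refine ⟨N, fun n hn => ?_⟩
  obtain ⟨h1, h2, h3⟩ := hN n hn
  obtain ⟨NA, hAw⟩ := hg.finsetSum (blockPositions (n / L) L b)
  have h4 := norm_charFun_map_sub_le (P := iidMeasure ν)
    ((hg.windowSum n).measurable.const_mul (√(n : ℝ))⁻¹)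
    (hAw.measurable.const_mul (√((n / L * L : ℕ) : ℝ))⁻¹)
    ((((hg.windowSum n).memLp 2).const_mul _).sub ((hAw.memLp 2).const_mul _)) t
  have h5 := integral_sq_normalized_diff_le (ν := ν) hg h0 b n hb0 h1
  have h6 := h4.trans (mul_le_mul_of_nonneg_left (Real.sqrt_le_sqrt h5) (abs_nonneg t))
  rw [← dist_eq_norm] at h6
  have h7 := dist_triangle4 (charFun ((iidMeasure ν).map fun u => (√(n : ℝ))⁻¹ * windowSum g n u) t)
    (lim b) (Complex.exp (-(σ * t ^ 2 / 2 : ℝ)))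
    (y := charFun ((iidMeasure ν).map fun u =>
      (√((n / L * L : ℕ) : ℝ))⁻¹ * ∑ i ∈ blockPositions (n / L) L b, g (shift i u)) t)
  linarith

end ScalarCLT

/-! ### From window sums to subtree counts -/

/-- The variances of `a * X + Y` and `a * X - Y` are nonnegative. The free weight `a` serves to
balance a variance of order `n` against a bounded one. -/
theorem two_mul_abs_covariance_le {Ω : Type*} [MeasurableSpace Ω] {P : Measure Ω}
    [IsProbabilityMeasure P] {X Y : Ω → ℝ} (hX : MemLp X 2 P) (hY : MemLp Y 2 P) {a : ℝ}
    (ha : 0 < a) : 2 * |cov[X, Y; P]| ≤ a * Var[X; P] + a⁻¹ * Var[Y; P] := by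
  have h1 := variance_nonneg (fun ω => a * X ω + Y ω) P
  have h2 := variance_nonneg (fun ω => a * X ω - Y ω) P
  rw [variance_fun_add (hX.const_mul a) hY, variance_const_mul, covariance_const_mul_left] at h1
  rw [variance_fun_sub (hX.const_mul a) hY, variance_const_mul, covariance_const_mul_left] at h2
  have h3 : 2 * a * |cov[X, Y; P]| ≤ a ^ 2 * Var[X; P] + Var[Y; P] := by
    rcases abs_cases cov[X, Y; P] with ⟨h, _⟩ | ⟨h, _⟩ <;> rw [h] <;> nlinarith
  have h4 : a * (2 * |cov[X, Y; P]|) ≤ a * (a * Var[X; P] + a⁻¹ * Var[Y; P]) := by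
    rw [mul_add, ← mul_assoc a a⁻¹, mul_inv_cancel₀ ha.ne']
    nlinarith
  exact le_of_mul_le_mul_left h4 ha

theorem variance_le_of_ae_bound {Ω : Type*} [MeasurableSpace Ω] {P : Measure Ω}
    [IsProbabilityMeasure P] {X : Ω → ℝ} (hX : Measurable X) {B : ℝ} (hB : ∀ᵐ ω ∂P, |X ω| ≤ B) :
    Var[X; P] ≤ B ^ 2 := by
  have h := variance_le_sq_of_bounded (μ := P) (X := X) (a := -B) (b := B)
    (hB.mono fun ω hω => abs_le.1 hω) hX.aemeasurable
  calc _ ≤ _ := h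
    _ = _ := by ring

/-- Random variables `X n` that are, up to a bounded error, sums of a window functional. -/
structure IsApproxWindowSum (ν : Measure ℝ) [IsProbabilityMeasure ν] (X : ℕ → (ℕ → ℝ) → ℝ)
    (g : (ℕ → ℝ) → ℝ) (w : ℕ) (C B : ℝ) : Prop where
  isWindow : IsWindow g w C
  measurable : ∀ n, Measurable (X n)
  approx : ∀ n, ∀ᵐ u ∂iidMeasure ν, |X n u - windowSum g n u| ≤ B

/-! ### Transfer of the limits across bounded errors -/

section Approx

variable {ν : Measure ℝ} [IsProbabilityMeasure ν] {X Y : ℕ → (ℕ → ℝ) → ℝ}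
  {g h : (ℕ → ℝ) → ℝ} {w : ℕ} {C D B E : ℝ}

theorem IsApproxWindowSum.memLp (hX : IsApproxWindowSum ν X g w C B) (n : ℕ) (p : ENNReal) :
    MemLp (X n) p (iidMeasure ν) := by
  refine MemLp.of_bound (hX.measurable n).aestronglyMeasurable (B + n * C) ?_
  filter_upwards [hX.approx n] with u hu
  have h1 := (hX.isWindow.windowSum n).bound u
  rw [Real.norm_eq_abs]
  calc |X n u| = |(X n u - windowSum g n u) + windowSum g n u| := by rw [sub_add_cancel]
    _ ≤ _ := (abs_add_le _ _).trans (add_le_add hu h1)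

theorem IsApproxWindowSum.memLp_sub (hX : IsApproxWindowSum ν X g w C B) (n : ℕ) (p : ENNReal) :
    MemLp (fun u => X n u - windowSum g n u) p (iidMeasure ν) :=
  (hX.memLp n p).sub ((hX.isWindow.windowSum n).memLp p)

theorem IsApproxWindowSum.variance_sub_le (hX : IsApproxWindowSum ν X g w C B) (n : ℕ) :
    Var[fun u => X n u - windowSum g n u; iidMeasure ν] ≤ B ^ 2 :=
  variance_le_of_ae_bound ((hX.measurable n).sub (hX.isWindow.windowSum n).measurable)
    (hX.approx n)

theorem variance_windowSum_le (hg : IsWindow g w C) (n : ℕ) :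
    Var[windowSum g n; iidMeasure ν] ≤ n * (2 * w * (4 * (C * C))) := by
  have := variance_sum_windows_le (ν := ν) hg (Finset.range n)
  rwa [Finset.card_range] at this

/-- The covariances of the window sums with the bounded errors are `O(√n)`, which vanishes after
division by `n`. -/
theorem IsApproxWindowSum.tendsto_covariance (hX : IsApproxWindowSum ν X g w C B)
    (hY : IsApproxWindowSum ν Y h w D E) :
    Tendsto (fun n : ℕ => 1 / (n : ℝ) * cov[X n, Y n; iidMeasure ν]) atTop
      (𝓝 (asympCov ν g h w)) := by
  have hmain := tendsto_covariance_windowSum (ν := ν) hX.isWindow hY.isWindow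
  set K : ℝ := 2 * w * (4 * (C * C)) with hK
  set K' : ℝ := 2 * w * (4 * (D * D)) with hK'
  have hdiff : Tendsto (fun n : ℕ => 1 / (n : ℝ) * (cov[X n, Y n; iidMeasure ν] -
      cov[windowSum g n, windowSum h n; iidMeasure ν])) atTop (𝓝 0) := by
    have hlim : Tendsto (fun n : ℕ => (K + E ^ 2 + K' + B ^ 2 + B ^ 2 + E ^ 2) / √(n : ℝ)) atTop
        (𝓝 0) :=
      tendsto_const_nhds.div_atTop (Real.tendsto_sqrt_atTop.comp tendsto_natCast_atTop_atTop)
    refine squeeze_zero_norm' ?_ hlim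
    filter_upwards [eventually_ge_atTop 1] with n hn
    have hn1 : (1 : ℝ) ≤ n := by exact_mod_cast hn
    have hn0 : (0 : ℝ) < n := by linarith
    have hs : 0 < √(n : ℝ) := Real.sqrt_pos.2 hn0
    have hs1 : 1 ≤ √(n : ℝ) := Real.one_le_sqrt.2 hn1
    have hsq : √(n : ℝ) * √(n : ℝ) = n := Real.mul_self_sqrt hn0.le
    set S := windowSum g n
    set S' := windowSum h n
    set e : (ℕ → ℝ) → ℝ := fun u => X n u - S u with he
    set e' : (ℕ → ℝ) → ℝ := fun u => Y n u - S' u with he'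
    have mS : MemLp S 2 (iidMeasure ν) := (hX.isWindow.windowSum n).memLp 2
    have mS' : MemLp S' 2 (iidMeasure ν) := (hY.isWindow.windowSum n).memLp 2
    have me : MemLp e 2 (iidMeasure ν) := hX.memLp_sub n 2
    have me' : MemLp e' 2 (iidMeasure ν) := hY.memLp_sub n 2
    have hXe : X n = S + e := by
      funext u
      simp [he]
    have hYe : Y n = S' + e' := by
      funext u
      simp [he']
    rw [hXe, hYe, covariance_add_left mS me (mS'.add me'), covariance_add_right mS mS' me',
      covariance_add_right me mS' me']
    have vS : Var[S; iidMeasure ν] ≤ n * K := variance_windowSum_le hX.isWindow n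
    have vS' : Var[S'; iidMeasure ν] ≤ n * K' := variance_windowSum_le hY.isWindow n
    have ve : Var[e; iidMeasure ν] ≤ B ^ 2 := hX.variance_sub_le n
    have ve' : Var[e'; iidMeasure ν] ≤ E ^ 2 := hY.variance_sub_le n
    -- The weight `√n` always goes to the bounded error and its inverse to the window sum, so both
    -- terms are `O(√n)`.
    have c1 := two_mul_abs_covariance_le mS me' (inv_pos.2 hs)
    have c2 := two_mul_abs_covariance_le me mS' hs
    have c3 := two_mul_abs_covariance_le me me' hs
    have d1 : (√(n : ℝ))⁻¹ * Var[S; iidMeasure ν] ≤ √(n : ℝ) * K := by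
      rw [inv_mul_le_iff₀ hs, ← mul_assoc, hsq]
      exact vS
    have d2 : (√(n : ℝ))⁻¹ * Var[S'; iidMeasure ν] ≤ √(n : ℝ) * K' := by
      rw [inv_mul_le_iff₀ hs, ← mul_assoc, hsq]
      exact vS'
    have d3 : √(n : ℝ) * Var[e'; iidMeasure ν] ≤ √(n : ℝ) * E ^ 2 :=
      mul_le_mul_of_nonneg_left ve' hs.le
    have d4 : √(n : ℝ) * Var[e; iidMeasure ν] ≤ √(n : ℝ) * B ^ 2 :=
      mul_le_mul_of_nonneg_left ve hs.le
    have d5 : (√(n : ℝ))⁻¹ * Var[e'; iidMeasure ν] ≤ √(n : ℝ) * E ^ 2 := by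
      refine le_trans ?_ d3
      refine mul_le_mul_of_nonneg_right ?_ (variance_nonneg _ _)
      exact (inv_le_one_of_one_le₀ hs1).trans hs1
    rw [inv_inv] at c1
    rw [Real.norm_eq_abs, abs_mul, abs_of_nonneg (by positivity : (0 : ℝ) ≤ 1 / n), one_div,
      inv_mul_le_iff₀ hn0, mul_div_assoc', le_div_iff₀ hs]
    have habs : |cov[S, S'; iidMeasure ν] + cov[S, e'; iidMeasure ν] +
        (cov[e, S'; iidMeasure ν] + cov[e, e'; iidMeasure ν]) - cov[S, S'; iidMeasure ν]| ≤
        |cov[S, e'; iidMeasure ν]| + |cov[e, S'; iidMeasure ν]| + |cov[e, e'; iidMeasure ν]| := by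
      rw [show ∀ a b c d : ℝ, a + b + (c + d) - a = b + c + d by intros; ring]
      exact abs_add_three _ _ _
    have hK0 : 0 ≤ √(n : ℝ) * K := le_trans (mul_nonneg (inv_pos.2 hs).le (variance_nonneg _ _)) d1
    have hK0' : 0 ≤ √(n : ℝ) * K' := le_trans (mul_nonneg (inv_pos.2 hs).le (variance_nonneg _ _)) d2
    have hB0 : 0 ≤ √(n : ℝ) * B ^ 2 := by positivity
    have hE0 : 0 ≤ √(n : ℝ) * E ^ 2 := by positivity
    have htot : |cov[S, S'; iidMeasure ν] + cov[S, e'; iidMeasure ν] +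
        (cov[e, S'; iidMeasure ν] + cov[e, e'; iidMeasure ν]) - cov[S, S'; iidMeasure ν]| ≤
        √(n : ℝ) * (K + E ^ 2 + K' + B ^ 2 + B ^ 2 + E ^ 2) := by
      linarith
    calc _ ≤ _ := mul_le_mul_of_nonneg_right htot hs.le
      _ = √(n : ℝ) * √(n : ℝ) * (K + E ^ 2 + K' + B ^ 2 + B ^ 2 + E ^ 2) := by ring
      _ = _ := by rw [hsq]
  have := hmain.add hdiff
  rw [add_zero] at this
  refine this.congr fun n => ?_
  ring

theorem IsWindow.sub_const (hg : IsWindow g w C) (c : ℝ) :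
    IsWindow (fun u => g u - c) w (C + |c|) where
  measurable := hg.measurable.sub_const c
  dependsOn := fun _ _ huv => congrArg (· - c) (hg.dependsOn huv)
  bound u := (abs_sub _ _).trans (add_le_add_left (hg.bound u) _)

theorem IsApproxWindowSum.tendsto_charFun (hX : IsApproxWindowSum ν X g w C B) {σ : ℝ}
    (hσ : Tendsto (fun n : ℕ => 1 / (n : ℝ) * Var[X n; iidMeasure ν]) atTop (𝓝 σ)) (t : ℝ) :
    Tendsto (fun n : ℕ => charFun ((iidMeasure ν).map fun u =>
      (√(n : ℝ))⁻¹ * (X n u - ∫ v, X n v ∂iidMeasure ν)) t) atTop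
      (𝓝 (Complex.exp (-(σ * t ^ 2 / 2 : ℝ)))) := by
  -- The bounded error does not change the limiting variance, so `σ` is also that of the pure window
  -- sums.
  have hS2 : asympCov ν g g w = σ := by
    refine tendsto_nhds_unique (hX.tendsto_covariance hX) (hσ.congr fun n => ?_)
    rw [covariance_self (hX.measurable n).aemeasurable]
  set c := ∫ u, g u ∂iidMeasure ν with hc
  have hg0 := hX.isWindow.sub_const c
  have hS : ∀ n u, windowSum (fun u => g u - c) n u = windowSum g n u - n * c := by
    intro n u
    simp [windowSum]
  have hmean : ∀ n : ℕ, ∫ u, windowSum g n u ∂iidMeasure ν = n * c := by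
    intro n
    simp only [windowSum]
    rw [integral_finsetSum _ fun i _ => ((hX.isWindow.comp_shift i).memLp 1).integrable le_rfl]
    simp [integral_comp_shift hX.isWindow.measurable, hc]
  have h1 := tendsto_charFun_windowSum (ν := ν) hg0 (by
    rw [integral_sub ((hX.isWindow.memLp 1).integrable le_rfl) (integrable_const _)]
    simp [hc]) (σ := σ) (by
    rw [← hS2]
    refine (tendsto_covariance_windowSum (ν := ν) hX.isWindow hX.isWindow).congr fun n => ?_
    rw [covariance_self (hX.isWindow.windowSum n).measurable.aemeasurable]
    congr 1
    rw [show windowSum (fun u => g u - c) n = fun u => windowSum g n u - n * c from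
      funext (hS n), variance_sub_const
      (hX.isWindow.windowSum n).measurable.aestronglyMeasurable]) t
  have hdiff : Tendsto (fun n : ℕ => charFun ((iidMeasure ν).map fun u =>
      (√(n : ℝ))⁻¹ * (X n u - ∫ v, X n v ∂iidMeasure ν)) t - charFun ((iidMeasure ν).map fun u =>
      (√(n : ℝ))⁻¹ * windowSum (fun u => g u - c) n u) t) atTop (𝓝 0) := by
    have hlim : Tendsto (fun n : ℕ => |t| * √(B ^ 2 / (n : ℝ))) atTop (𝓝 0) := by
      have h2 : Continuous fun x : ℝ => |t| * √x := by fun_prop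
      have := (h2.tendsto 0).comp (tendsto_const_div_atTop_nhds_zero_nat (B ^ 2))
      simpa [Function.comp_def] using this
    refine squeeze_zero_norm (fun n => ?_) hlim
    have mX : MemLp (fun u => (√(n : ℝ))⁻¹ * (X n u - ∫ v, X n v ∂iidMeasure ν)) 2 (iidMeasure ν) :=
      ((hX.memLp n 2).sub (memLp_const _)).const_mul _
    refine (norm_charFun_map_sub_le (((hX.measurable n).sub_const _).const_mul _)
      ((hg0.windowSum n).measurable.const_mul _)
      (mX.sub (((hg0.windowSum n).memLp 2).const_mul _)) t).trans ?_
    refine mul_le_mul_of_nonneg_left (Real.sqrt_le_sqrt ?_) (abs_nonneg t)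
    have hv := hX.variance_sub_le n
    rw [variance_eq_integral (X := fun u => X n u - windowSum g n u)
      ((hX.measurable n).sub (hX.isWindow.windowSum n).measurable).aemeasurable,
      integral_sub ((hX.memLp n 1).integrable le_rfl)
      (((hX.isWindow.windowSum n).memLp 1).integrable le_rfl), hmean] at hv
    calc ∫ u, ((√(n : ℝ))⁻¹ * (X n u - ∫ v, X n v ∂iidMeasure ν) -
          (√(n : ℝ))⁻¹ * windowSum (fun u => g u - c) n u) ^ 2 ∂iidMeasure ν
        = ∫ u, (n : ℝ)⁻¹ * (X n u - windowSum g n u -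
          (∫ v, X n v ∂iidMeasure ν - n * c)) ^ 2 ∂iidMeasure ν := by
          congr 1
          funext u
          rw [hS, ← mul_sub, mul_pow, inv_pow, Real.sq_sqrt (Nat.cast_nonneg n)]
          ring
      _ = (n : ℝ)⁻¹ * ∫ u, (X n u - windowSum g n u -
          (∫ v, X n v ∂iidMeasure ν - n * c)) ^ 2 ∂iidMeasure ν := integral_const_mul _ _
      _ ≤ (n : ℝ)⁻¹ * B ^ 2 := mul_le_mul_of_nonneg_left hv (by positivity)
      _ = _ := by ring
  have := h1.add hdiff
  rw [add_zero] at this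
  refine this.congr fun n => ?_
  ring

/-- The device behind the vector-valued limit: a linear combination of counts is again approximated
by sums of a single window functional. -/
theorem IsApproxWindowSum.sum {ι : Type*} [Fintype ι] {X : ι → ℕ → (ℕ → ℝ) → ℝ}
    {g : ι → (ℕ → ℝ) → ℝ} {C B : ι → ℝ} (hX : ∀ i, IsApproxWindowSum ν (X i) (g i) w (C i) (B i))
    (t : ι → ℝ) :
    IsApproxWindowSum ν (fun n u => ∑ i, t i * X i n u) (fun u => ∑ i, t i * g i u) w
      (∑ i, |t i| * C i) (∑ i, |t i| * B i) where
  isWindow :=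
    { measurable := Finset.measurable_sum _ fun i _ => (hX i).isWindow.measurable.const_mul _
      dependsOn := fun u v huv => Finset.sum_congr rfl fun i _ => by
        rw [(hX i).isWindow.dependsOn huv]
      bound := fun u => (Finset.abs_sum_le_sum_abs _ _).trans (Finset.sum_le_sum fun i _ => by
        rw [abs_mul]
        exact mul_le_mul_of_nonneg_left ((hX i).isWindow.bound u) (abs_nonneg _)) }
  measurable n := Finset.measurable_sum _ fun i _ => ((hX i).measurable n).const_mul _
  approx n := by
    have h : ∀ᵐ u ∂iidMeasure ν, ∀ i, |X i n u - windowSum (g i) n u| ≤ B i :=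
      ae_all_iff.2 fun i => (hX i).approx n
    filter_upwards [h] with u hu
    have : ∑ i, t i * X i n u - windowSum (fun u => ∑ i, t i * g i u) n u =
        ∑ i, t i * (X i n u - windowSum (g i) n u) := by
      simp only [windowSum, mul_sub, Finset.sum_sub_distrib, Finset.mul_sum]
      rw [Finset.sum_comm]
    rw [this]
    refine (Finset.abs_sum_le_sum_abs _ _).trans (Finset.sum_le_sum fun i _ => ?_)
    rw [abs_mul]
    exact mul_le_mul_of_nonneg_left (hu i) (abs_nonneg _)

theorem tendsto_variance_sum {ι : Type*} [Fintype ι] {X : ι → ℕ → (ℕ → ℝ) → ℝ}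
    {Γ : ι → ι → ℝ} (hX : ∀ i n, MemLp (X i n) 2 (iidMeasure ν))
    (hXm : ∀ i n, Measurable (X i n))
    (hΓ : ∀ i j, Tendsto (fun n : ℕ => 1 / (n : ℝ) * cov[X i n, X j n; iidMeasure ν]) atTop
      (𝓝 (Γ i j))) (t : ι → ℝ) :
    Tendsto (fun n : ℕ => 1 / (n : ℝ) * Var[fun u => ∑ i, t i * X i n u; iidMeasure ν]) atTop
      (𝓝 (∑ i, ∑ j, t i * (t j * Γ i j))) := by
  have h : Tendsto (fun n : ℕ => ∑ i, ∑ j, t i * (t j *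
      (1 / (n : ℝ) * cov[X i n, X j n; iidMeasure ν]))) atTop
      (𝓝 (∑ i, ∑ j, t i * (t j * Γ i j))) :=
    tendsto_finsetSum _ fun i _ => tendsto_finsetSum _ fun j _ =>
      ((hΓ i j).const_mul _).const_mul _
  refine h.congr fun n => ?_
  rw [← covariance_self (Finset.measurable_sum _ fun i _ => (hXm i n).const_mul _).aemeasurable,
    covariance_fun_sum_fun_sum (fun i => (hX i n).const_mul _) (fun i => (hX i n).const_mul _)]
  simp only [covariance_const_mul_left, covariance_const_mul_right, Finset.mul_sum]
  refine Finset.sum_congr rfl fun i _ => Finset.sum_congr rfl fun j _ => ?_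
  ring

end Approx

/-! ### Joint normal limits -/

/-- Random trees built from independent random variables, with counts that are approximately sums
of window functionals. -/
structure IsWindowModel {τ : Type} [HasFringe τ] [MeasurableSpace τ] (ν : Measure ℝ)
    [IsProbabilityMeasure ν] (law : ℕ → PMF τ) (tree : ℕ → (ℕ → ℝ) → τ) : Prop where
  measurableSet : ∀ s : Set τ, MeasurableSet s
  measurable : ∀ n, Measurable (tree n)
  map_eq : ∀ n, (iidMeasure ν).map (tree n) = (law n).toMeasure

section Model

variable {τ : Type} [HasFringe τ] [MeasurableSpace τ] {ν : Measure ℝ} [IsProbabilityMeasure ν]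
  {law : ℕ → PMF τ} {tree : ℕ → (ℕ → ℝ) → τ}

theorem IsWindowModel.measurable_of (hm : IsWindowModel ν law tree) {β : Type*}
    [MeasurableSpace β] (f : τ → β) : Measurable f := fun _ _ => hm.measurableSet _

theorem IsWindowModel.covariance_eq (hm : IsWindowModel ν law tree) (f f' : τ → ℝ) (n : ℕ) :
    cov[f, f'; (law n).toMeasure] =
      cov[fun u => f (tree n u), fun u => f' (tree n u); iidMeasure ν] := by
  rw [← hm.map_eq n]
  exact covariance_map_fun (hm.measurable_of f).aestronglyMeasurable
    (hm.measurable_of f').aestronglyMeasurable (hm.measurable n).aemeasurable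

theorem IsWindowModel.tendsto_covariance (hm : IsWindowModel ν law tree) {T T' : τ}
    {g h : (ℕ → ℝ) → ℝ} {w : ℕ} {C B D E : ℝ}
    (hT : IsApproxWindowSum ν (fun n u => (copies T (tree n u) : ℝ)) g w C B)
    (hT' : IsApproxWindowSum ν (fun n u => (copies T' (tree n u) : ℝ)) h w D E) :
    Tendsto (fun n : ℕ => 1 / (n : ℝ) *
      cov[fun t => (copies T t : ℝ), fun t => (copies T' t : ℝ); (law n).toMeasure]) atTop
      (𝓝 (asympCov ν g h w)) := by
  refine (hT.tendsto_covariance hT').congr fun n => ?_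
  rw [hm.covariance_eq]

/-- Asymptotic covariances form a nonnegative quadratic form. -/
theorem quadraticForm_nonneg {ι : Type*} [Fintype ι] {T : ι → τ} {Γ : ι → ι → ℝ}
    (hm : IsWindowModel ν law tree) {g : ι → (ℕ → ℝ) → ℝ} {w : ℕ} {C B : ι → ℝ}
    (hT : ∀ i, IsApproxWindowSum ν (fun n u => (copies (T i) (tree n u) : ℝ)) (g i) w (C i) (B i))
    (hΓ : ∀ i j, Tendsto (fun n : ℕ => 1 / (n : ℝ) *
      cov[fun t => (copies (T i) t : ℝ), fun t => (copies (T j) t : ℝ); (law n).toMeasure]) atTop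
      (𝓝 (Γ i j))) (t : ι → ℝ) : 0 ≤ ∑ i, ∑ j, t i * (t j * Γ i j) := by
  refine ge_of_tendsto' (tendsto_variance_sum (ν := ν)
    (X := fun i n u => (copies (T i) (tree n u) : ℝ)) (fun i n => (hT i).memLp n 2)
    (fun i n => (hT i).measurable n) (fun i j => ?_) t) fun n => ?_
  · refine (hΓ i j).congr fun n => ?_
    rw [hm.covariance_eq]
  · exact mul_nonneg (by positivity) (variance_nonneg _ _)

/-- The characteristic function of the vector at `t` is that of the scalar `⟨t, ·⟩` at `1`, so the
scalar limit theorem for linear combinations suffices. Symmetry and positivity of `Γ` are inherited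
from the covariances in the limit. -/
theorem jointNormalLimit_of_windows {d : ℕ} {T : Fin d → τ} {Γ : Matrix (Fin d) (Fin d) ℝ}
    (hm : IsWindowModel ν law tree) {g : Fin d → (ℕ → ℝ) → ℝ} {w : ℕ} {C B : Fin d → ℝ}
    (hT : ∀ i, IsApproxWindowSum ν (fun n u => (copies (T i) (tree n u) : ℝ)) (g i) w (C i) (B i))
    (hΓ : ∀ i j, asympCov ν (g i) (g j) w = Γ i j) (hdet : Γ.det ≠ 0) :
    JointNormalLimit law T Γ := by
  have hcov : ∀ i j, Tendsto (fun n : ℕ => 1 / (n : ℝ) *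
      cov[fun t => (copies (T i) t : ℝ), fun t => (copies (T j) t : ℝ); (law n).toMeasure]) atTop
      (𝓝 (Γ i j)) := fun i j => by
    rw [← hΓ i j]
    exact hm.tendsto_covariance (hT i) (hT j)
  have hdot : ∀ t : Fin d → ℝ, t ⬝ᵥ Γ.mulVec t = ∑ i, ∑ j, t i * (t j * Γ i j) := by
    intro t
    simp only [dotProduct, Matrix.mulVec, Finset.mul_sum]
    exact Finset.sum_congr rfl fun i _ => Finset.sum_congr rfl fun j _ => by ring
  have hpsd : Γ.PosSemidef := by
    refine Matrix.PosSemidef.of_dotProduct_mulVec_nonneg ?_ fun t => ?_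
    · ext i j
      rw [Matrix.conjTranspose_apply, star_trivial]
      refine tendsto_nhds_unique (hcov j i) ((hcov i j).congr fun n => ?_)
      rw [covariance_comm]
    · rw [star_trivial, hdot]
      exact quadraticForm_nonneg hm hT hcov t
  refine ⟨hcov, hpsd, hdet, ?_⟩
  have hmeasT : ∀ n : ℕ, Measurable fun t : τ =>
      (√(n : ℝ))⁻¹ • (countVector T t - meanVector (law n) T) := fun n => hm.measurable_of _
  refine ⟨fun n => (hmeasT n).aemeasurable, by fun_prop, ?_⟩
  refine ProbabilityMeasure.tendsto_iff_tendsto_charFun.2 fun t => ?_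
  have hX := IsApproxWindowSum.sum hT t
  have hvar := tendsto_variance_sum (ν := ν) (X := fun i n u => (copies (T i) (tree n u) : ℝ))
    (Γ := fun i j => Γ i j) (fun i n => (hT i).memLp n 2) (fun i n => (hT i).measurable n)
    (fun i j => (hcov i j).congr fun n => by rw [hm.covariance_eq]) t
  -- The direction `t` is already contained in the linear combination, hence the evaluation at `1`.
  have hmain := hX.tendsto_charFun hvar 1
  simp only [ProbabilityMeasure.coe_mk, Measure.map_id]
  rw [charFun_multivariateGaussian hpsd]
  have e1 : Complex.exp (((inner ℝ t (0 : EuclideanSpace ℝ (Fin d)) : ℝ) : ℂ) * Complex.I -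
      ((t.ofLp ⬝ᵥ Γ.mulVec t.ofLp : ℝ) : ℂ) / 2) =
      Complex.exp (-((∑ i, ∑ j, t i * (t j * Γ i j)) * 1 ^ 2 / 2 : ℝ)) := by
    rw [inner_zero_right, hdot]
    congr 1
    push_cast
    ring
  rw [e1]
  refine hmain.congr fun n => ?_
  have hintegral : ∀ i, ∫ s, (copies (T i) s : ℝ) ∂(law n).toMeasure =
      ∫ u, (copies (T i) (tree n u) : ℝ) ∂iidMeasure ν := fun i => by
    rw [← hm.map_eq n, integral_map (hm.measurable n).aemeasurable
      (hm.measurable_of _).aestronglyMeasurable]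
  rw [← hm.map_eq n, Measure.map_map (hmeasT n) (hm.measurable n),
    charFun_apply, charFun_apply, integral_map, integral_map]
  · congr 1
    funext u
    congr 2
    norm_cast
    simp only [Function.comp_apply, inner_smul_left, PiLp.inner_apply, countVector, meanVector,
      PiLp.sub_apply, RCLike.inner_apply, conj_trivial, hintegral, one_mul]
    rw [integral_finsetSum _ fun i _ => (((hT i).memLp n 1).integrable le_rfl).const_mul _,
      ← Finset.sum_sub_distrib]
    congr 1
    refine Finset.sum_congr rfl fun i _ => ?_
    rw [integral_const_mul]
    ring
  · exact ((hmeasT n).comp (hm.measurable n)).aemeasurable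
  · fun_prop
  · exact (((hX.measurable n).sub_const _).const_mul _).aemeasurable
  · fun_prop

end Model

/-! ### Cartesian trees of independent random variables -/

section Order

variable {ν : Measure ℝ} [IsProbabilityMeasure ν]

theorem ae_injective [NullSingletonClass ν] : ∀ᵐ u ∂iidMeasure ν, Function.Injective u := by
  have h : ∀ i j : ℕ, i ≠ j → ∀ᵐ u ∂iidMeasure ν, u i ≠ u j := by
    intro i j hij
    have hm : MeasurableSet {p : ℝ × ℝ | p.1 = p.2} := measurableSet_eq_fun measurable_fst measurable_snd
    have h0 : (ν.prod ν) {p : ℝ × ℝ | p.1 = p.2} = 0 := by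
      rw [Measure.measure_prod_null hm]
      refine Eventually.of_forall fun x => ?_
      have : Prod.mk x ⁻¹' {p : ℝ × ℝ | p.1 = p.2} = {x} := by
        ext y
        simp [eq_comm]
      change ν (Prod.mk x ⁻¹' {p : ℝ × ℝ | p.1 = p.2}) = 0
      rw [this]
      simp
    have h1 := Measure.infinitePi_map_eval_prod (P := fun _ : ℕ => ν) hij
    rw [← h1, Measure.map_apply (by fun_prop) hm] at h0
    exact measure_eq_zero_iff_ae_notMem.1 h0
  have h' : ∀ᵐ u ∂iidMeasure ν, ∀ i j : ℕ, i ≠ j → u i ≠ u j := by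
    rw [ae_all_iff]
    intro i
    rw [ae_all_iff]
    intro j
    by_cases hij : i = j
    · simp [hij]
    · filter_upwards [h i j hij] with u hu _ using hu
  filter_upwards [h'] with u hu i j hij
  by_contra hne
  exact hu i j hne hij

/-- The event that the variables `u 1, …, u n` decrease along the permutation `π`. -/
def orderEvent {n : ℕ} (π : Equiv.Perm (Fin n)) : Set (ℕ → ℝ) :=
  {u | StrictAnti fun i : Fin n => u (π i + 1)}

theorem measurableSet_strictAnti (n : ℕ) : MeasurableSet {x : Fin n → ℝ | StrictAnti x} := by
  have : {x : Fin n → ℝ | StrictAnti x} =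
      ⋂ i : Fin n, ⋂ j : Fin n, ⋂ _ : i < j, {x | x j < x i} := by
    ext x
    simp [StrictAnti]
  rw [this]
  exact MeasurableSet.iInter fun i => MeasurableSet.iInter fun j => MeasurableSet.iInter fun _ =>
    measurableSet_lt (measurable_pi_apply j) (measurable_pi_apply i)

theorem measurableSet_orderEvent {n : ℕ} (π : Equiv.Perm (Fin n)) :
    MeasurableSet (orderEvent π) := by
  have : Measurable fun (u : ℕ → ℝ) (i : Fin n) => u (π i + 1) := by fun_prop
  exact this (measurableSet_strictAnti n)

/-- Exchangeability: permuting independent variables of equal law does not change their joint law,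
so the value does not depend on `π`. -/
theorem measure_orderEvent_eq {n : ℕ} (π : Equiv.Perm (Fin n)) :
    iidMeasure ν (orderEvent π) =
      Measure.infinitePi (fun _ : Fin n => ν) {x : Fin n → ℝ | StrictAnti x} := by
  have hinj : Function.Injective fun i : Fin n => (π i : ℕ) + 1 := fun i j h => by
    simpa [Fin.val_inj] using h
  have h := Measure.map_infinitePi_infinitePi_of_inj (P := fun _ : ℕ => ν) hinj
  rw [← h, Measure.map_apply (by fun_prop) (measurableSet_strictAnti n)]
  rfl

theorem eq_of_mem_orderEvent {n : ℕ} {π π' : Equiv.Perm (Fin n)} {u : ℕ → ℝ}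
    (h : u ∈ orderEvent π) (h' : u ∈ orderEvent π') : π = π' := by
  have key : ∀ i j, π.symm i < π.symm j ↔ π'.symm i < π'.symm j := by
    intro i j
    have e1 := StrictAnti.lt_iff_gt h (a := π.symm j) (b := π.symm i)
    have e2 := StrictAnti.lt_iff_gt h' (a := π'.symm j) (b := π'.symm i)
    simp only [Equiv.apply_symm_apply] at e1 e2
    exact e1.symm.trans e2
  let e : Fin n ≃o Fin n := 
    { toEquiv := π.trans π'.symm
      map_rel_iff' := by
        intro a b
        have := key (π b) (π a)
        simp only [Equiv.symm_apply_apply] at this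
        simp only [Equiv.trans_apply, ← not_lt, this] }
  -- The only order automorphism of `Fin n` is the identity.
  have he : e = OrderIso.refl _ := Subsingleton.elim _ _
  ext i
  have : e i = i := by rw [he]; rfl
  have h2 : π'.symm (π i) = i := this
  rw [Equiv.symm_apply_eq] at h2
  rw [h2]

theorem exists_mem_orderEvent {n : ℕ} {u : ℕ → ℝ} (hu : Function.Injective u) :
    ∃ π : Equiv.Perm (Fin n), u ∈ orderEvent π := by
  set x : Fin n → ℝ := fun i => -u (i + 1) with hx
  have hxi : Function.Injective x := fun i j h => by
    have h2 := hu (neg_injective h)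
    exact Fin.ext (by simpa using h2)
  refine ⟨Tuple.sort x, ?_⟩
  have h := (Tuple.monotone_sort x).strictMono_of_injective
    (hxi.comp (Tuple.sort x).injective)
  intro i j hij
  have := h hij
  simpa [hx] using this

/-- The `n!` order events are disjoint, have equal probability, and cover everything except the null
set of ties. -/
theorem measure_orderEvent [NullSingletonClass ν] {n : ℕ} (π : Equiv.Perm (Fin n)) :
    iidMeasure ν (orderEvent π) = (n.factorial : ENNReal)⁻¹ := by
  have hdisj : Set.PairwiseDisjoint ((Finset.univ : Finset (Equiv.Perm (Fin n))) :
      Set (Equiv.Perm (Fin n))) (fun π => orderEvent π) := by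
    intro π _ π' _ hne
    refine Set.disjoint_left.2 fun u h h' => hne (eq_of_mem_orderEvent h h')
  have h := measure_biUnion_finset (μ := iidMeasure ν) hdisj
    (fun π _ => measurableSet_orderEvent π)
  have h1 : iidMeasure ν (⋃ π ∈ (Finset.univ : Finset (Equiv.Perm (Fin n))), orderEvent π) = 1 := by
    rw [prob_compl_eq_zero_iff₀ ?_ |>.symm]
    · refine measure_mono_null ?_ (ae_iff.1 (ae_injective (ν := ν)))
      intro u hu hinj
      obtain ⟨π, hπ⟩ := exists_mem_orderEvent (n := n) hinj
      exact hu (by simpa using ⟨π, hπ⟩)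
    · exact (Finset.measurableSet_biUnion _ fun π _ => measurableSet_orderEvent π).nullMeasurableSet
  rw [h1] at h
  simp only [measure_orderEvent_eq, Finset.sum_const, Finset.card_univ, Fintype.card_perm,
    Fintype.card_fin, nsmul_eq_mul] at h
  rw [measure_orderEvent_eq]
  rw [mul_comm] at h
  exact ENNReal.eq_inv_of_mul_eq_one_left h.symm

theorem shape_eq_bst {n : ℕ} {π : Equiv.Perm (Fin n)} {u : ℕ → ℝ} (hu : u ∈ orderEvent π) :
    shape u 1 n = (bstOfList (List.ofFn fun i => π i)).map fun _ => () := by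
  have hr : List.range' 1 n = (List.finRange n).map fun i : Fin n => (i : ℕ) + 1 := by
    refine List.ext_getElem (by simp) fun i h1 h2 => ?_
    simp [add_comm]
  rw [bstOfList_ofFn_eq_cartTree π (fun i => u (i + 1)) hu, shape, hr, cartTree_map,
    ← BinaryTree.comp_map]
  rfl

/-- The shape of a block is a function of the comparisons within the block. -/
theorem measurable_shape (a k : ℕ) : Measurable fun u => shape u a k := by
  -- The comparison table takes values in a finite type, on which every function is measurable.
  let cmp : (ℕ → ℝ) → Fin k → Fin k → Prop := fun u i j => u (a + i) < u (a + j)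
  have hcmp : Measurable cmp := by
    refine measurable_pi_lambda _ fun i => measurable_pi_lambda _ fun j => ?_
    exact measurableSet_setOfPred.1 (measurableSet_lt (measurable_pi_apply _) (measurable_pi_apply _))
  have hfac : Function.FactorsThrough (fun u => shape u a k) cmp := by
    intro u v huv
    refine shape_congr fun i hi j hj => ?_
    have := congrFun (congrFun huv ⟨i, hi⟩) ⟨j, hj⟩
    exact iff_of_eq this
  set F : (Fin k → Fin k → Prop) → BinaryTree Unit :=
    Function.extend cmp (fun u => shape u a k) fun _ => .nil
  have hF : (fun u => shape u a k) = F ∘ cmp := (hfac.extend_comp _).symm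
  rw [hF]
  exact (measurable_of_finite F).comp hcmp

/-- The order of the priorities is a uniform permutation almost surely, and on each order event the
Cartesian tree is the search tree for that insertion order. -/
theorem map_shape [NullSingletonClass ν] (n : ℕ) :
    (iidMeasure ν).map (fun u => shape u 1 n) = (randomBST n).toMeasure := by
  classical
  ext s hs
  let _ : MeasurableSpace (Equiv.Perm (Fin n)) := ⊤
  set f : Equiv.Perm (Fin n) → BinaryTree Unit := fun π =>
    (bstOfList (List.ofFn fun i => π i)).map fun _ => () with hf
  have hfm : Measurable f := measurable_from_top
  rw [randomBST, ← PMF.toMeasure_map _ _ hfm, Measure.map_apply hfm hs,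
    PMF.toMeasure_uniformOfFintype_apply _ (hfm hs), Measure.map_apply (measurable_shape 1 n) hs]
  have hae : (fun u => shape u 1 n) ⁻¹' s =ᵐ[iidMeasure ν]
      ⋃ π ∈ (f ⁻¹' s).toFinset, orderEvent π := by
    filter_upwards [ae_injective (ν := ν)] with u hu
    obtain ⟨π, hπ⟩ := exists_mem_orderEvent (n := n) hu
    refine propext ⟨fun h => ?_, fun h => ?_⟩
    · refine Set.mem_biUnion (x := π) ?_ hπ
      change shape u 1 n ∈ s at h
      rw [shape_eq_bst hπ] at h
      simpa using h
    · change shape u 1 n ∈ s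
      obtain ⟨π', hπ', h'⟩ := Set.mem_iUnion₂.1 h
      rw [shape_eq_bst h']
      simpa using hπ'
  have hdisj : Set.PairwiseDisjoint ((f ⁻¹' s).toFinset : Set (Equiv.Perm (Fin n))) (fun π => orderEvent π) :=
    fun π _ π' _ hne => Set.disjoint_left.2 fun u h h' => hne (eq_of_mem_orderEvent h h')
  rw [measure_congr hae, measure_biUnion_finset hdisj fun π _ => measurableSet_orderEvent π]
  simp only [measure_orderEvent, Finset.sum_const, nsmul_eq_mul, Fintype.card_perm,
    Fintype.card_fin, Set.toFinset_card]
  rw [div_eq_mul_inv]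

theorem isWindowModel_randomBST [NullSingletonClass ν] :
    IsWindowModel ν randomBST fun n u => shape u 1 n :=
  ⟨fun _ => trivial, fun n => measurable_shape 1 n, map_shape⟩

theorem isWindowModel_randomRRT [NullSingletonClass ν] {τ : Type} [HasFringe τ] [MeasurableSpace τ]
    (hτ : ∀ s : Set τ, MeasurableSet s) (q : OrderedTree Unit → τ) :
    IsWindowModel ν (fun n => (randomRRT n).map q) fun n u =>
      q (rotateTree (shape u 1 (n - 1))) where
  measurableSet := hτ
  measurable n := by
    have hm : Measurable fun t => q (rotateTree t) := fun _ _ => trivial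
    exact hm.comp (measurable_shape 1 (n - 1))
  map_eq n := by
    have key : ∀ n, (iidMeasure ν).map (fun u => q (rotateTree (shape u 1 n))) =
        ((randomRRT (n + 1)).map q).toMeasure := by
      intro n
      have hm : Measurable fun t => q (rotateTree t) := fun _ _ => trivial
      rw [randomRRT_succ, PMF.map_comp]
      have h2 := PMF.toMeasure_map _ (randomBST n) hm
      rw [← map_shape (ν := ν) n, Measure.map_map hm (measurable_shape 1 n)] at h2
      exact h2
    cases n with
    | zero => exact key 0
    | succ n => exact key n

end Order

/-! ### Shape probabilities -/

theorem toReal_randomBST_apply (ν : Measure ℝ) [IsProbabilityMeasure ν] [NullSingletonClass ν] (k : ℕ)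
    (T : BinaryTree Unit) :
    (randomBST k T).toReal = (iidMeasure ν).real {u | shape u 1 k = T} := by
  rw [← PMF.toMeasure_apply_singleton (randomBST k) T trivial, ← map_shape (ν := ν),
    Measure.map_apply (measurable_shape 1 k) trivial]
  rfl

/-- Choose values for the left subtree, larger ones for the right subtree, and a root value above
both. The lower bound `a` is carried through the induction to keep the values distinct. -/
theorem exists_nodup_cartTree_eq (T : BinaryTree Unit) (a : ℝ) : ∃ l : List ℝ, l.Nodup ∧
    (∀ x ∈ l, a < x) ∧ (cartTree id l).map (fun _ => ()) = T := by
  induction T generalizing a with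
  | nil => exact ⟨[], by simp, by simp, rfl⟩
  | node c l r ihl ihr =>
    have hbd : ∀ (l : List ℝ) (a : ℝ), ∃ b, a ≤ b ∧ ∀ x ∈ l, x ≤ b := by
      intro l a
      obtain ⟨b, hb⟩ := (a :: l).toFinset.bddAbove
      exact ⟨b, hb (by simp), fun x hx => hb (by simp [hx])⟩
    obtain ⟨l₁, hd₁, ha₁, h₁⟩ := ihl a
    obtain ⟨b, hab, hb⟩ := hbd l₁ a
    obtain ⟨l₂, hd₂, ha₂, h₂⟩ := ihr b
    obtain ⟨c', hbc, hc⟩ := hbd l₂ b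
    refine ⟨l₁ ++ (c' + 1) :: l₂, ?_, ?_, ?_⟩
    · rw [List.nodup_append, List.nodup_cons]
      refine ⟨hd₁, ⟨fun h => ?_, hd₂⟩, fun x hx y hy hxy => ?_⟩
      · linarith [hc _ h]
      · subst hxy
        rcases List.mem_cons.1 hy with h | h
        · linarith [hb x hx]
        · linarith [hb x hx, ha₂ x h]
    · intro x hx
      rw [List.mem_append, List.mem_cons] at hx
      rcases hx with h | h | h
      · exact ha₁ x h
      · linarith
      · linarith [ha₂ x h]
    · rw [cartTree_append_of_max, BinaryTree.map, h₁, h₂]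
      · intro y hy
        simp only [id]
        linarith [hb y hy]
      · intro y hy
        simp only [id]
        linarith [hc y hy]

theorem randomBST_size_ne_zero (T : BinaryTree Unit) : randomBST (size T) T ≠ 0 := by
  obtain ⟨l, hd, -, hl⟩ := exists_nodup_cartTree_eq T 0
  have hsize : size T = l.length := by rw [← hl, size_map, size_cartTree]
  rw [hsize]
  set x : Fin l.length → ℝ := fun i => -l.get i with hx
  have hxi : Function.Injective x := fun i j h => List.nodup_iff_injective_get.1 hd (neg_injective h)
  set π := Tuple.sort x
  have hanti : StrictAnti fun i => l.get (π i) := by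
    intro i j hij
    have := (Tuple.monotone_sort x).strictMono_of_injective (hxi.comp π.injective) hij
    simpa [hx, π] using this
  have hT : (bstOfList (List.ofFn fun i => π i)).map (fun _ => ()) = T := by
    rw [bstOfList_ofFn_eq_cartTree π l.get hanti, ← hl]
    have h2 : (List.finRange l.length).map l.get = l := by simp
    have h3 := cartTree_map l.get id (List.finRange l.length)
    rw [h2] at h3
    rw [h3, ← BinaryTree.comp_map]
    rfl
  rw [← PMF.mem_support_iff, randomBST, PMF.mem_support_map_iff]
  exact ⟨π, by simp, hT⟩

theorem shapeProb_randomBST_pos (T : BinaryTree Unit) : 0 < shapeProb randomBST T :=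
  ENNReal.toReal_pos (randomBST_size_ne_zero T) (PMF.apply_ne_top _ _)

theorem shapeProb_randomRRT_pos {τ : Type} [HasFringe τ] {q : OrderedTree Unit → τ}
    (hq : FringeHom q) (L : τ) : 0 < shapeProb (fun n => (randomRRT n).map q) L := by
  refine ENNReal.toReal_pos ?_ (PMF.apply_ne_top _ _)
  obtain ⟨t, rfl⟩ := hq.exists_rotateTree L
  rw [hq.size_rotateTree]
  change PMF.map q (randomRRT (size t + 1)) _ ≠ 0
  rw [randomRRT_succ, PMF.map_comp, ← PMF.mem_support_iff,
    PMF.mem_support_map_iff]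
  exact ⟨t, randomBST_size_ne_zero t, rfl⟩

theorem toReal_randomRRT_apply (ν : Measure ℝ) [IsProbabilityMeasure ν] [NullSingletonClass ν] {τ : Type}
    (q : OrderedTree Unit → τ) (k : ℕ) (L : τ) :
    ((randomRRT (k + 1)).map q L).toReal =
      (iidMeasure ν).real {u | q (rotateTree (shape u 1 k)) = L} := by
  let _ : MeasurableSpace τ := ⊤
  have hm : Measurable fun t => q (rotateTree t) := fun _ _ => trivial
  rw [randomRRT_succ, PMF.map_comp, ← PMF.toMeasure_apply_singleton _ L trivial]
  have h2 := PMF.toMeasure_map _ (randomBST k) hm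
  rw [← map_shape (ν := ν) k, Measure.map_map hm (measurable_shape 1 k)] at h2
  change (PMF.toMeasure (PMF.map (fun t => q (rotateTree t)) (randomBST k)) {L}).toReal = _
  rw [← h2, Measure.map_apply (hm.comp (measurable_shape 1 k)) trivial]
  rfl

/-! ### Uniform random variables -/

/-- The uniform distribution on the unit interval. -/
def unif : Measure ℝ := volume.restrict (Set.Ioo 0 1)

instance : IsProbabilityMeasure unif := ⟨by simp [unif]⟩

instance : NullSingletonClass unif := by
  unfold unif
  infer_instance

theorem IndepFun.lintegral_eq {Ω α β : Type*} [MeasurableSpace Ω] [MeasurableSpace α]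
    [MeasurableSpace β] {P : Measure Ω} [IsProbabilityMeasure P] {X : Ω → α} {Y : Ω → β}
    (hX : Measurable X) (hY : Measurable Y) (h : IndepFun X Y P) {F : α × β → ENNReal}
    (hF : Measurable F) :
    ∫⁻ ω, F (X ω, Y ω) ∂P = ∫⁻ ω, ∫⁻ ω', F (X ω, Y ω') ∂P ∂P := by
  have h1 := (indepFun_iff_map_prod_eq_prod_map_map hX.aemeasurable hY.aemeasurable).1 h
  have := Measure.isProbabilityMeasure_map (μ := P) hX.aemeasurable
  have := Measure.isProbabilityMeasure_map (μ := P) hY.aemeasurable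
  rw [← lintegral_map (f := F) hF (hX.prodMk hY), h1, lintegral_prod _ hF.aemeasurable,
    lintegral_map hF.lintegral_prod_right' hX]
  refine lintegral_congr fun ω => ?_
  exact lintegral_map (hF.comp measurable_prodMk_left) hY

theorem ae_mem_Ioo (i : ℕ) : ∀ᵐ u ∂iidMeasure unif, u i ∈ Set.Ioo (0 : ℝ) 1 := by
  have h : ∀ᵐ x ∂unif, x ∈ Set.Ioo (0 : ℝ) 1 := ae_restrict_mem measurableSet_Ioo
  exact (measurePreserving_eval_infinitePi (fun _ : ℕ => unif) i).quasiMeasurePreserving.ae h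

theorem lintegral_eval (i : ℕ) {F : ℝ → ENNReal} (hF : Measurable F) :
    ∫⁻ u, F (u i) ∂iidMeasure unif = ∫⁻ x in Set.Ioo (0 : ℝ) 1, F x :=
  (measurePreserving_eval_infinitePi (fun _ : ℕ => unif) i).lintegral_comp hF

/-- Integrating out one coordinate. -/
theorem lintegral_coordinate (S : Finset ℕ) {i : ℕ} (hi : i ∉ S) {φ : (ℕ → ℝ) → ENNReal}
    {y : (ℕ → ℝ) → ℝ} (hφ : Measurable φ) (hy : Measurable y)
    (hφS : DependsOn φ (S : Set ℕ)) (hyS : DependsOn y (S : Set ℕ)) {F : ℝ → ℝ → ENNReal}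
    (hF : Measurable (Function.uncurry F)) :
    ∫⁻ u, φ u * F (u i) (y u) ∂iidMeasure unif =
      ∫⁻ u, φ u * (∫⁻ x in Set.Ioo (0 : ℝ) 1, F x (y u)) ∂iidMeasure unif := by
  have hind := indepFun_of_dependsOn unif (hφ.prodMk hy) (measurable_pi_apply i) S {i}
    (by simpa using hi) (fun u v h => Prod.ext (hφS h) (hyS h))
    (fun u v h => h i (by simp))
  have hm : Measurable fun p : (ENNReal × ℝ) × ℝ => p.1.1 * F p.2 p.1.2 :=
    measurable_fst.fst.mul (hF.comp (measurable_snd.prodMk measurable_fst.snd))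
  rw [IndepFun.lintegral_eq (hφ.prodMk hy) (measurable_pi_apply i) hind hm]
  refine lintegral_congr fun u => ?_
  have hFy : Measurable fun x => F x (y u) := hF.comp measurable_prodMk_right
  change ∫⁻ v, φ u * F (v i) (y u) ∂iidMeasure unif = _
  rw [← lintegral_eval i hFy]
  exact lintegral_const_mul _ (hFy.comp (measurable_pi_apply i))

/-- The probability that the shape of `k` independent random variables belongs to `Q`. -/
def blockProb (k : ℕ) (Q : Set (BinaryTree Unit)) : ENNReal :=
  iidMeasure unif {u | shape u 1 k ∈ Q}

/-! ### Scale invariance of shapes -/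

section Scaling

variable (a k : ℕ) (Q : Set (BinaryTree Unit))

/-- The vectors whose shape belongs to `Q`. -/
def shapeSet : Set (Fin k → ℝ) :=
  {x | shape (fun j => if h : j < k then x ⟨j, h⟩ else 0) 0 k ∈ Q}

theorem mem_shapeSet_block (u : ℕ → ℝ) :
    (fun j : Fin k => u (a + j)) ∈ shapeSet k Q ↔ shape u a k ∈ Q := by
  rw [shapeSet, Set.mem_ofPred_eq, shape_congr (v := u) (b := a)]
  intro i hi j hj
  simp [hi, hj]

theorem measurableSet_shapeSet : MeasurableSet (shapeSet k Q) := by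
  have hm : Measurable fun (x : Fin k → ℝ) (j : ℕ) => if h : j < k then x ⟨j, h⟩ else 0 := by
    refine measurable_pi_lambda _ fun j => ?_
    by_cases h : j < k
    · simpa [h] using measurable_pi_apply _
    · simp [h]
  exact ((measurable_shape 0 k).comp hm) (trivial : MeasurableSet Q)

theorem map_block : (iidMeasure unif).map (fun u (j : Fin k) => u (a + j)) =
    volume.restrict (Set.univ.pi fun _ => Set.Ioo (0 : ℝ) 1) := by
  have hinj : Function.Injective fun i : Fin k => a + (i : ℕ) := fun i j h => by
    simpa [Fin.val_inj] using h
  rw [Measure.map_infinitePi_infinitePi_of_inj (P := fun _ : ℕ => unif) hinj,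
    Measure.infinitePi_eq_pi, volume_pi, Measure.restrict_pi_pi]
  rfl

open scoped Pointwise in
theorem measure_block_lt {s : ℝ} (hs : s ∈ Set.Ioo (0 : ℝ) 1) :
    iidMeasure unif {u | (∀ j < k, u (a + j) < s) ∧ shape u a k ∈ Q} =
      blockProb k Q * ENNReal.ofReal s ^ k := by
  have hV : ∀ a, Measurable fun (u : ℕ → ℝ) (j : Fin k) => u (a + j) := fun a => by fun_prop
  have hG := measurableSet_shapeSet k Q
  have hI : MeasurableSet (Set.univ.pi fun _ : Fin k => Set.Iio s) :=
    MeasurableSet.univ_pi fun _ => measurableSet_Iio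
  have h1 : {u : ℕ → ℝ | (∀ j < k, u (a + j) < s) ∧ shape u a k ∈ Q} =
      (fun u (j : Fin k) => u (a + j)) ⁻¹' ((Set.univ.pi fun _ => Set.Iio s) ∩ shapeSet k Q) := by
    ext u
    rw [Set.mem_preimage, Set.mem_inter_iff, mem_shapeSet_block]
    simp [Fin.forall_iff]
  have h2 : {u : ℕ → ℝ | shape u 1 k ∈ Q} =
      (fun u (j : Fin k) => u (1 + j)) ⁻¹' shapeSet k Q := by
    ext u
    rw [Set.mem_preimage, mem_shapeSet_block]
    rfl
  rw [blockProb, h1, h2, ← Measure.map_apply (hV a) (hI.inter hG), ← Measure.map_apply (hV 1) hG,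
    map_block, map_block, Measure.restrict_apply (hI.inter hG), Measure.restrict_apply hG]
  -- Multiplication by `s` preserves the order, hence the shape, and maps the unit cube onto the
  -- cube of side `s`; this is the source of the factor `s ^ k`.
  have h3 : (Set.univ.pi fun _ : Fin k => Set.Iio s) ∩ shapeSet k Q ∩
      (Set.univ.pi fun _ => Set.Ioo (0 : ℝ) 1) =
      s • (shapeSet k Q ∩ (Set.univ.pi fun _ => Set.Ioo (0 : ℝ) 1)) := by
    ext x
    rw [Set.mem_smul_set_iff_inv_smul_mem₀ hs.1.ne']
    have hsh : s⁻¹ • x ∈ shapeSet k Q ↔ x ∈ shapeSet k Q := by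
      rw [shapeSet, Set.mem_ofPred_eq, Set.mem_ofPred_eq, shape_congr (v := fun j =>
        if h : j < k then x ⟨j, h⟩ else 0) (b := 0)]
      intro i hi j hj
      simp [hi, hj, hs.1]
    simp only [Set.mem_inter_iff, hsh, Set.mem_pi, Set.mem_univ, true_imp_iff, Set.mem_Iio,
      Set.mem_Ioo, Pi.smul_apply, smul_eq_mul]
    constructor
    · rintro ⟨⟨h4, h5⟩, h6⟩
      refine ⟨h5, fun i => ⟨mul_pos (inv_pos.2 hs.1) (h6 i).1, ?_⟩⟩
      rw [inv_mul_lt_iff₀ hs.1, mul_one]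
      exact h4 i
    · rintro ⟨h5, h6⟩
      have h7 : ∀ i, x i < s := fun i => by
        have := (h6 i).2
        rwa [inv_mul_lt_iff₀ hs.1, mul_one] at this
      refine ⟨⟨h7, h5⟩, fun i => ⟨?_, (h7 i).trans hs.2⟩⟩
      exact (mul_pos_iff_of_pos_left (inv_pos.2 hs.1)).1 (h6 i).1
  rw [h3, Measure.addHaar_smul, Module.finrank_fin_fun, abs_of_pos (pow_pos hs.1 k),
    ENNReal.ofReal_pow hs.1.le, mul_comm]

end Scaling

/-- Integrating out a block of variables below a level which is a function of the others. -/
theorem lintegral_block (a k : ℕ) (Q : Set (BinaryTree Unit)) (S : Finset ℕ)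
    (hS : Disjoint S (Finset.Ico a (a + k))) {φ : (ℕ → ℝ) → ENNReal} {s : (ℕ → ℝ) → ℝ}
    (hφ : Measurable φ) (hs : Measurable s) (hφS : DependsOn φ (S : Set ℕ))
    (hsS : DependsOn s (S : Set ℕ)) (h01 : ∀ᵐ u ∂iidMeasure unif, s u ∈ Set.Ioo (0 : ℝ) 1) :
    ∫⁻ u, φ u * {u | (∀ j < k, u (a + j) < s u) ∧ shape u a k ∈ Q}.indicator 1 u
      ∂iidMeasure unif = blockProb k Q * ∫⁻ u, φ u * ENNReal.ofReal (s u) ^ k ∂iidMeasure unif := by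
  have hV : Measurable fun (u : ℕ → ℝ) (j : Fin k) => u (a + j) := by fun_prop
  have hind := indepFun_of_dependsOn unif (hφ.prodMk hs) hV S (Finset.Ico a (a + k)) hS
    (fun u v h => Prod.ext (hφS h) (hsS h)) (fun u v h => by
      funext j
      exact h _ (by simp))
  set A : Set (ℝ × (Fin k → ℝ)) := {p | (∀ j, p.2 j < p.1) ∧ p.2 ∈ shapeSet k Q} with hA
  have hAm : MeasurableSet A := by
    have : A = (⋂ j, {p | p.2 j < p.1}) ∩ Prod.snd ⁻¹' shapeSet k Q := by
      ext p
      simp [hA]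
    rw [this]
    exact (MeasurableSet.iInter fun j => measurableSet_lt
      ((measurable_pi_apply j).comp measurable_snd) measurable_fst).inter
      (measurable_snd (measurableSet_shapeSet k Q))
  have hAu : ∀ (t : ℝ) (u : ℕ → ℝ), A.indicator (1 : ℝ × (Fin k → ℝ) → ENNReal) (t, fun j => u (a + j)) =
      {u | (∀ j < k, u (a + j) < t) ∧ shape u a k ∈ Q}.indicator 1 u := by
    intro t u
    have hiff : ((t, fun j : Fin k => u (a + j)) ∈ A) ↔
        u ∈ {u : ℕ → ℝ | (∀ j < k, u (a + j) < t) ∧ shape u a k ∈ Q} := by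
      change (∀ j : Fin k, u (a + j) < t) ∧ _ ∈ shapeSet k Q ↔ _
      rw [mem_shapeSet_block, Fin.forall_iff]
      rfl
    by_cases h : (t, fun j : Fin k => u (a + j)) ∈ A
    · rw [Set.indicator_of_mem h, Set.indicator_of_mem (hiff.1 h)]
      rfl
    · rw [Set.indicator_of_notMem h, Set.indicator_of_notMem (h ∘ hiff.2)]
  have hm : Measurable fun p : (ENNReal × ℝ) × (Fin k → ℝ) =>
      p.1.1 * A.indicator (1 : ℝ × (Fin k → ℝ) → ENNReal) (p.1.2, p.2) :=
    measurable_fst.fst.mul ((measurable_one.indicator hAm).comp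
      (measurable_fst.snd.prodMk measurable_snd))
  have h := IndepFun.lintegral_eq (hφ.prodMk hs) hV hind hm
  simp only [hAu] at h
  have hconst : blockProb k Q ≠ ⊤ := measure_ne_top _ _
  rw [← lintegral_const_mul' _ _ hconst]
  refine Eq.trans ?_ (h.trans ?_)
  · refine lintegral_congr fun u => ?_
    rfl
  · refine lintegral_congr_ae ?_
    filter_upwards [h01] with u hu
    have hms : MeasurableSet {v : ℕ → ℝ | (∀ j < k, v (a + j) < s u) ∧ shape v a k ∈ Q} := by
      have : {v : ℕ → ℝ | (∀ j < k, v (a + j) < s u) ∧ shape v a k ∈ Q} =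
          (fun v => (s u, fun j : Fin k => v (a + j))) ⁻¹' A := by
        ext v
        simp only [hA, Set.mem_preimage, Set.mem_ofPred_eq, mem_shapeSet_block, Fin.forall_iff]
      rw [this]
      exact (measurable_const.prodMk hV) hAm
    rw [lintegral_const_mul _ (measurable_one.indicator hms), lintegral_indicator_one hms,
      measure_block_lt a k Q hu]
    ring

/-! ### Probabilities of blocks -/

theorem lintegral_Ioo_ofReal {f : ℝ → ℝ} (hf : Continuous f) {b : ℝ} (hb : 0 ≤ b)
    (h0 : ∀ x ∈ Set.Ioo 0 b, 0 ≤ f x) :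
    ∫⁻ x in Set.Ioo 0 b, ENNReal.ofReal (f x) = ENNReal.ofReal (∫ x in (0 : ℝ)..b, f x) := by
  rw [intervalIntegral.integral_of_le hb, integral_Ioc_eq_integral_Ioo,
    ofReal_integral_eq_lintegral_ofReal]
  · exact (hf.integrableOn_Icc (a := 0) (b := b)).mono_set Set.Ioo_subset_Icc_self
  · exact (ae_restrict_mem measurableSet_Ioo).mono h0

theorem integral_min_pow (k : ℕ) {y : ℝ} (hy : y ∈ Set.Ioo (0 : ℝ) 1) :
    ∫ x in (0 : ℝ)..1, (min x y) ^ k = y ^ k - k / (k + 1) * y ^ (k + 1) := by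
  have hi : ∀ a b, IntervalIntegrable (fun x => (min x y) ^ k) volume a b := fun a b =>
    (by fun_prop : Continuous fun x => (min x y) ^ k).intervalIntegrable a b
  rw [← intervalIntegral.integral_add_adjacent_intervals (hi 0 y) (hi y 1)]
  have h1 : ∫ x in (0 : ℝ)..y, (min x y) ^ k = ∫ x in (0 : ℝ)..y, x ^ k := by
    refine intervalIntegral.integral_congr fun x hx => ?_
    rw [Set.uIcc_of_le hy.1.le] at hx
    simp [min_eq_left hx.2]
  have h2 : ∫ x in y..1, (min x y) ^ k = ∫ x in y..1, y ^ k := by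
    refine intervalIntegral.integral_congr fun x hx => ?_
    rw [Set.uIcc_of_le hy.2.le] at hx
    simp [min_eq_right hx.1]
  rw [h1, h2, integral_pow, intervalIntegral.integral_const]
  have : (k : ℝ) + 1 ≠ 0 := by positivity
  simp only [smul_eq_mul]
  field_simp
  ring

theorem lintegral_min_pow (k : ℕ) {y : ℝ} (hy : y ∈ Set.Ioo (0 : ℝ) 1) :
    ∫⁻ x in Set.Ioo (0 : ℝ) 1, ENNReal.ofReal (min x y) ^ k =
      ENNReal.ofReal (y ^ k - k / (k + 1) * y ^ (k + 1)) := by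
  have h0 : ∀ x ∈ Set.Ioo (0 : ℝ) 1, 0 ≤ min x y := fun x hx => le_min hx.1.le hy.1.le
  rw [← integral_min_pow k hy, ← lintegral_Ioo_ofReal (by fun_prop) zero_le_one
    fun x hx => pow_nonneg (h0 x hx) k]
  exact setLIntegral_congr_fun measurableSet_Ioo fun x hx => (ENNReal.ofReal_pow (h0 x hx) k).symm

theorem pow_sub_nonneg (k : ℕ) {y : ℝ} (hy : y ∈ Set.Ioo (0 : ℝ) 1) :
    0 ≤ y ^ k - k / (k + 1) * y ^ (k + 1) := by
  have h1 : (k : ℝ) / (k + 1) ≤ 1 := by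
    rw [div_le_one (by positivity)]
    linarith
  have h2 : y ^ (k + 1) ≤ y ^ k := pow_le_pow_of_le_one hy.1.le hy.2.le (Nat.le_succ k)
  have h3 := pow_nonneg hy.1.le (k + 1)
  nlinarith

theorem measurable_min_pow (k : ℕ) :
    Measurable (Function.uncurry fun x y : ℝ => ENNReal.ofReal (min x y) ^ k) := by
  unfold Function.uncurry
  fun_prop

theorem lintegral_min_pow_right (S : Finset ℕ) {i j : ℕ} (hi : i ∉ S) (hj : j ∈ S) (k : ℕ)
    {φ : (ℕ → ℝ) → ENNReal} (hφ : Measurable φ) (hφS : DependsOn φ (S : Set ℕ)) :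
    ∫⁻ u, φ u * ENNReal.ofReal (min (u i) (u j)) ^ k ∂iidMeasure unif =
      ∫⁻ u, φ u * ENNReal.ofReal (u j ^ k - k / (k + 1) * u j ^ (k + 1)) ∂iidMeasure unif := by
  rw [lintegral_coordinate S hi hφ (measurable_pi_apply j) hφS (fun u v h => h j hj)
    (measurable_min_pow k)]
  refine lintegral_congr_ae ?_
  filter_upwards [ae_mem_Ioo j] with u hu
  rw [lintegral_min_pow k hu]

/-- Interpretation of the constant: among `k + 2` exchangeable variables, the two end ones must be
the two largest. -/
theorem lintegral_min_pow_fst {i j : ℕ} (hij : i ≠ j) (k : ℕ) :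
    ∫⁻ u, ENNReal.ofReal (min (u i) (u j)) ^ k ∂iidMeasure unif =
      ENNReal.ofReal (2 / ((k + 1) * (k + 2))) := by
  have h := lintegral_min_pow_right {j} (i := i) (j := j) (by simpa using hij) (by simp) k
    (φ := fun _ => 1) measurable_const (fun _ _ _ => rfl)
  simp only [one_mul] at h
  rw [h, lintegral_eval j (F := fun y => ENNReal.ofReal (y ^ k - k / (k + 1) * y ^ (k + 1)))
    (by fun_prop), lintegral_Ioo_ofReal (by fun_prop) zero_le_one fun y => pow_sub_nonneg k]
  congr 1
  rw [intervalIntegral.integral_sub (Continuous.intervalIntegrable (by fun_prop) _ _)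
        (Continuous.intervalIntegrable (by fun_prop) _ _),
    intervalIntegral.integral_const_mul, integral_pow, integral_pow]
  push_cast
  simp
  field_simp
  ring

/-- The expectation of `min(x, y) ^ k * min(y, z) ^ m` for independent uniform variables. -/
def minMoment (k m : ℝ) : ℝ :=
  2 * (k ^ 2 + 3 * k * m + m ^ 2 + 4 * k + 4 * m + 3) /
    ((k + 1) * (m + 1) * (k + m + 1) * (k + m + 2) * (k + m + 3))

/-- Given the shared middle variable `u j = y` the two factors are independent, with conditional
means `y ^ k - k / (k + 1) * y ^ (k + 1)` and the same with `m`. It remains to integrate a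
polynomial in `y`. -/
theorem lintegral_min_pow_mul_min_pow {i j l : ℕ} (hij : i ≠ j) (hil : i ≠ l) (hjl : j ≠ l)
    (k m : ℕ) :
    ∫⁻ u, ENNReal.ofReal (min (u i) (u j)) ^ k * ENNReal.ofReal (min (u j) (u l)) ^ m
      ∂iidMeasure unif = ENNReal.ofReal (minMoment k m) := by
  have h1 := lintegral_min_pow_right {i, j} (i := l) (j := j) (by simp [hil.symm, hjl.symm])
    (by simp) m (φ := fun u => ENNReal.ofReal (min (u i) (u j)) ^ k) (by fun_prop)
    (fun u v h => by simp only [h i (by simp), h j (by simp)])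
  have h2 := lintegral_min_pow_right {j} (i := i) (j := j) (by simpa using hij)
    (by simp) k (φ := fun u => ENNReal.ofReal (u j ^ m - m / (m + 1) * u j ^ (m + 1)))
    (by fun_prop) (fun u v h => by simp only [h j (by simp)])
  simp only [fun u : ℕ → ℝ => min_comm (u j) (u l)]
  have h3 : ∫⁻ u : ℕ → ℝ, ENNReal.ofReal (u j ^ m - m / (m + 1) * u j ^ (m + 1)) *
      ENNReal.ofReal (u j ^ k - k / (k + 1) * u j ^ (k + 1)) ∂iidMeasure unif =
      ENNReal.ofReal (minMoment k m) := by
    rw [lintegral_eval j (F := fun y => ENNReal.ofReal (y ^ m - m / (m + 1) * y ^ (m + 1)) *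
      ENNReal.ofReal (y ^ k - k / (k + 1) * y ^ (k + 1))) (by fun_prop)]
    have h4 : ∫⁻ y in Set.Ioo (0 : ℝ) 1, ENNReal.ofReal (y ^ m - m / (m + 1) * y ^ (m + 1)) *
        ENNReal.ofReal (y ^ k - k / (k + 1) * y ^ (k + 1)) =
        ∫⁻ y in Set.Ioo (0 : ℝ) 1, ENNReal.ofReal ((y ^ m - m / (m + 1) * y ^ (m + 1)) *
          (y ^ k - k / (k + 1) * y ^ (k + 1))) :=
      setLIntegral_congr_fun measurableSet_Ioo fun y hy =>
        (ENNReal.ofReal_mul (pow_sub_nonneg m hy)).symm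
    rw [h4, lintegral_Ioo_ofReal (by fun_prop) zero_le_one fun y hy =>
      mul_nonneg (pow_sub_nonneg m hy) (pow_sub_nonneg k hy)]
    congr 1
    have h5 : ∀ y : ℝ, (y ^ m - m / (m + 1) * y ^ (m + 1)) * (y ^ k - k / (k + 1) * y ^ (k + 1)) =
        y ^ (k + m) - (m / (m + 1) + k / (k + 1)) * y ^ (k + m + 1) +
          m / (m + 1) * (k / (k + 1)) * y ^ (k + m + 2) := by
      intro y
      ring
    simp only [h5]
    rw [intervalIntegral.integral_add (Continuous.intervalIntegrable (by fun_prop) _ _)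
        (Continuous.intervalIntegrable (by fun_prop) _ _),
      intervalIntegral.integral_sub (Continuous.intervalIntegrable (by fun_prop) _ _)
        (Continuous.intervalIntegrable (by fun_prop) _ _),
      intervalIntegral.integral_const_mul, intervalIntegral.integral_const_mul, integral_pow,
      integral_pow, integral_pow, minMoment]
    push_cast
    simp
    field_simp
    ring
  rw [h1, ← h3, ← h2]
  exact lintegral_congr fun u => mul_comm _ _

/-- The indicator of `u j < u i`. -/
def ltIndicator (i j : ℕ) : (ℕ → ℝ) → ENNReal := {u : ℕ → ℝ | u j < u i}.indicator 1

theorem ltIndicator_eq (i j : ℕ) (u : ℕ → ℝ) :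
    ltIndicator i j u = {p : ℝ × ℝ | p.2 < p.1}.indicator 1 (u i, u j) := rfl

theorem measurable_ltIndicator (i j : ℕ) : Measurable (ltIndicator i j) :=
  measurable_one.indicator (measurableSet_lt (measurable_pi_apply j) (measurable_pi_apply i))

theorem dependsOn_ltIndicator {i j : ℕ} {S : Set ℕ} (hi : i ∈ S) (hj : j ∈ S) :
    DependsOn (ltIndicator i j) S := fun u v h => by
  simp only [ltIndicator_eq, h i hi, h j hj]

theorem measurable_indicator_lt :
    Measurable ({p : ℝ × ℝ | p.2 < p.1}.indicator (1 : ℝ × ℝ → ENNReal)) :=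
  measurable_one.indicator (measurableSet_lt measurable_snd measurable_fst)

theorem lintegral_mul_ltIndicator (S : Finset ℕ) {i j : ℕ} (hi : i ∉ S) (hj : j ∈ S)
    {φ : (ℕ → ℝ) → ENNReal} (hφ : Measurable φ) (hφS : DependsOn φ (S : Set ℕ)) :
    ∫⁻ u, φ u * ltIndicator i j u ∂iidMeasure unif =
      ∫⁻ u, φ u * ENNReal.ofReal (1 - u j) ∂iidMeasure unif := by
  simp only [ltIndicator_eq]
  rw [lintegral_coordinate S hi hφ (measurable_pi_apply j) hφS (fun u v h => h j hj)
    (F := fun x y => {p : ℝ × ℝ | p.2 < p.1}.indicator 1 (x, y)) measurable_indicator_lt]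
  refine lintegral_congr_ae ?_
  filter_upwards [ae_mem_Ioo j] with u hu
  have h1 : ∀ x, {p : ℝ × ℝ | p.2 < p.1}.indicator (1 : ℝ × ℝ → ENNReal) (x, u j) =
      (Set.Ioi (u j)).indicator 1 x := fun x => rfl
  simp only [h1]
  rw [lintegral_indicator_one measurableSet_Ioi, Measure.restrict_apply measurableSet_Ioi]
  have h2 : Set.Ioi (u j) ∩ Set.Ioo 0 1 = Set.Ioo (u j) 1 := by
    ext x
    simp only [Set.mem_inter_iff, Set.mem_Ioi, Set.mem_Ioo]
    exact ⟨fun h => ⟨h.1, h.2.2⟩, fun h => ⟨h.1, hu.1.trans h.1, h.2⟩⟩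
  rw [h2, Real.volume_Ioo]

theorem lintegral_mul_ltIndicator_mul_pow (S : Finset ℕ) {i j : ℕ} (hi : i ∉ S) (hj : j ∈ S)
    (m : ℕ) {φ : (ℕ → ℝ) → ENNReal} (hφ : Measurable φ) (hφS : DependsOn φ (S : Set ℕ)) :
    ∫⁻ u, φ u * (ltIndicator j i u * ENNReal.ofReal (u i) ^ m) ∂iidMeasure unif =
      ∫⁻ u, φ u * ENNReal.ofReal (u j ^ (m + 1) / (m + 1)) ∂iidMeasure unif := by
  simp only [ltIndicator_eq]
  rw [lintegral_coordinate S hi hφ (measurable_pi_apply j) hφS (fun u v h => h j hj)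
    (F := fun x y => {p : ℝ × ℝ | p.2 < p.1}.indicator 1 (y, x) * ENNReal.ofReal x ^ m)
    ((measurable_indicator_lt.comp measurable_swap).mul (by fun_prop))]
  refine lintegral_congr_ae ?_
  filter_upwards [ae_mem_Ioo j] with u hu
  have h1 : ∀ x, {p : ℝ × ℝ | p.2 < p.1}.indicator (1 : ℝ × ℝ → ENNReal) (u j, x) *
      ENNReal.ofReal x ^ m = (Set.Iio (u j)).indicator (fun x => ENNReal.ofReal x ^ m) x := by
    intro x
    by_cases hx : x < u j <;> simp [hx]
  simp only [h1]
  rw [lintegral_indicator measurableSet_Iio, Measure.restrict_restrict measurableSet_Iio]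
  have h2 : Set.Iio (u j) ∩ Set.Ioo 0 1 = Set.Ioo 0 (u j) := by
    ext x
    simp only [Set.mem_inter_iff, Set.mem_Iio, Set.mem_Ioo]
    exact ⟨fun h => ⟨h.2.1, h.1⟩, fun h => ⟨h.2, h.1, h.2.trans hu.2⟩⟩
  rw [h2]
  have h3 : ∫ x in (0 : ℝ)..u j, x ^ m = u j ^ (m + 1) / (m + 1) := by
    rw [integral_pow]
    simp
  rw [← h3, ← lintegral_Ioo_ofReal (by fun_prop) hu.1.le fun x hx => pow_nonneg hx.1.le m]
  congr 1
  exact setLIntegral_congr_fun measurableSet_Ioo fun x hx => (ENNReal.ofReal_pow hx.1.le m).symm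

theorem lintegral_one_sub_mul_pow (j m : ℕ) {c : ℝ} (hc : 0 ≤ c) :
    ∫⁻ u : ℕ → ℝ, ENNReal.ofReal (1 - u j) * ENNReal.ofReal (u j ^ m * c) ∂iidMeasure unif =
      ENNReal.ofReal (c / ((m + 1) * (m + 2))) := by
  rw [lintegral_eval j (F := fun y => ENNReal.ofReal (1 - y) * ENNReal.ofReal (y ^ m * c))
    (by fun_prop)]
  have h1 : ∫⁻ y in Set.Ioo (0 : ℝ) 1, ENNReal.ofReal (1 - y) * ENNReal.ofReal (y ^ m * c) =
      ∫⁻ y in Set.Ioo (0 : ℝ) 1, ENNReal.ofReal ((1 - y) * (y ^ m * c)) :=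
    setLIntegral_congr_fun measurableSet_Ioo fun y hy =>
      (ENNReal.ofReal_mul (by linarith [hy.2])).symm
  rw [h1, lintegral_Ioo_ofReal (by fun_prop) zero_le_one fun y hy =>
    mul_nonneg (by linarith [hy.2]) (mul_nonneg (pow_nonneg hy.1.le m) hc)]
  congr 1
  have h2 : ∀ y : ℝ, (1 - y) * (y ^ m * c) = c * y ^ m - c * y ^ (m + 1) := by
    intro y
    ring
  simp only [h2]
  rw [intervalIntegral.integral_sub (Continuous.intervalIntegrable (by fun_prop) _ _)
    (Continuous.intervalIntegrable (by fun_prop) _ _), intervalIntegral.integral_const_mul,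
    intervalIntegral.integral_const_mul, integral_pow, integral_pow]
  push_cast
  simp
  field_simp
  ring

theorem lintegral_ltIndicator_mul_pow {i j : ℕ} (hij : i ≠ j) (k : ℕ) :
    ∫⁻ u, ltIndicator i j u * ENNReal.ofReal (u j) ^ k ∂iidMeasure unif =
      ENNReal.ofReal (1 / ((k + 1) * (k + 2))) := by
  have h1 := lintegral_mul_ltIndicator {j} (i := i) (j := j) (by simpa using hij) (by simp)
    (φ := fun u => ENNReal.ofReal (u j) ^ k) (by fun_prop)
    (fun u v h => by simp only [h j (by simp)])
  simp only [mul_comm _ (ltIndicator i j _)] at h1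
  rw [h1, ← lintegral_one_sub_mul_pow j k zero_le_one]
  refine lintegral_congr_ae ?_
  filter_upwards [ae_mem_Ioo j] with u hu
  rw [mul_one, ENNReal.ofReal_pow hu.1.le, mul_comm]

/-- Interpretation of the constant: `u i` is the largest of `k + m + 3` variables, `u j` the largest
of the other `k + m + 2`, and `u l` the largest of the `m + 1` variables formed by the second block
and itself. -/
theorem lintegral_ltIndicator_mul_pow_mul {i j l : ℕ} (hij : i ≠ j) (hil : i ≠ l) (hjl : j ≠ l)
    (k m : ℕ) :
    ∫⁻ u, (ltIndicator i j u * ENNReal.ofReal (u j) ^ k) *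
      (ltIndicator j l u * ENNReal.ofReal (u l) ^ m) ∂iidMeasure unif =
      ENNReal.ofReal (1 / ((m + 1) * (k + m + 2) * (k + m + 3))) := by
  have h1 := lintegral_mul_ltIndicator_mul_pow {i, j} (i := l) (j := j)
    (by simp [hil.symm, hjl.symm]) (by simp) m
    (φ := fun u => ltIndicator i j u * ENNReal.ofReal (u j) ^ k)
    ((measurable_ltIndicator i j).mul (by fun_prop))
    (fun u v h => by
      simp only [h j (by simp), dependsOn_ltIndicator (i := i) (j := j)
        (S := ({i, j} : Finset ℕ))
        (by simp) (by simp) h])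
  rw [h1]
  have h2 := lintegral_mul_ltIndicator {j} (i := i) (j := j) (by simpa using hij) (by simp)
    (φ := fun u => ENNReal.ofReal (u j) ^ k * ENNReal.ofReal (u j ^ (m + 1) / (m + 1)))
    (by fun_prop) (fun u v h => by simp only [h j (by simp)])
  have hc : (0 : ℝ) ≤ 1 / (m + 1) := by positivity
  have h3 := lintegral_one_sub_mul_pow j (k + m + 1) hc
  have h4 : 1 / ((m + 1) * (k + m + 2) * (k + m + 3) : ℝ) =
      1 / (m + 1) / (((k + m + 1 : ℕ) + 1) * ((k + m + 1 : ℕ) + 2)) := by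
    push_cast
    field_simp
    ring
  rw [h4, ← h3]
  refine Eq.trans (lintegral_congr fun u => ?_) (h2.trans (lintegral_congr_ae ?_))
  · ring
  · filter_upwards [ae_mem_Ioo j] with u hu
    rw [← ENNReal.ofReal_pow hu.1.le, ← ENNReal.ofReal_mul (pow_nonneg hu.1.le k), mul_comm]
    congr 2
    ring

section BlockEvents

variable (i k m : ℕ) (Q R : Set (BinaryTree Unit))

/-- The block of length `k` after position `i` lies below its two neighbours and has its shape
in `Q`. -/
def fringeSet : Set (ℕ → ℝ) :=
  {u | (∀ j < k, u (i + 1 + j) < min (u i) (u (i + k + 1))) ∧ shape u (i + 1) k ∈ Q}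

/-- The block of length `k` after position `i` lies below the next variable, which is smaller than
the one before the block, and the block has its shape in `Q`. -/
def recursiveSet : Set (ℕ → ℝ) :=
  {u | u (i + k + 1) < u i ∧ (∀ j < k, u (i + 1 + j) < u (i + k + 1)) ∧ shape u (i + 1) k ∈ Q}

variable {i k Q}

theorem mem_fringeSet {u : ℕ → ℝ} :
    u ∈ fringeSet i k Q ↔ IsFringeBlock u i k ∧ shape u (i + 1) k ∈ Q := by
  refine and_congr_left fun _ => ⟨fun h j h1 h2 => ?_, fun h j hj => ?_⟩
  · have := h (j - (i + 1)) (by omega)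
    rw [show i + 1 + (j - (i + 1)) = j by omega] at this
    exact lt_min_iff.1 this
  · exact lt_min_iff.2 (h (i + 1 + j) (by omega) (by omega))

theorem mem_recursiveSet {u : ℕ → ℝ} :
    u ∈ recursiveSet i k Q ↔ IsRecursiveBlock u i (k + 1) ∧ shape u (i + 1) k ∈ Q := by
  rw [IsRecursiveBlock, and_assoc]
  refine and_congr_right fun _ => and_congr_left fun _ => ⟨fun h j h1 h2 => ?_, fun h j hj => ?_⟩
  · have := h (j - (i + 1)) (by omega)
    rwa [show i + 1 + (j - (i + 1)) = j by omega] at this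
  · exact h (i + 1 + j) (by omega) (by omega)

theorem shape_shift (a i k : ℕ) (u : ℕ → ℝ) : shape (shift a u) i k = shape u (a + i) k :=
  shape_congr fun _ _ _ _ => by simp [shift, add_assoc]

theorem shift_mem_fringeSet {a : ℕ} {u : ℕ → ℝ} :
    shift a u ∈ fringeSet 0 k Q ↔ u ∈ fringeSet a k Q := by
  simp only [fringeSet, Set.mem_ofPred_eq, shape_shift, shift, add_zero, zero_add, ← add_assoc]

theorem shift_mem_recursiveSet {a : ℕ} {u : ℕ → ℝ} :
    shift a u ∈ recursiveSet 0 k Q ↔ u ∈ recursiveSet a k Q := by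
  simp only [recursiveSet, Set.mem_ofPred_eq, shape_shift, shift, add_zero, zero_add, ← add_assoc]

theorem measurableSet_below (a k : ℕ) (Q : Set (BinaryTree Unit)) {s : (ℕ → ℝ) → ℝ}
    (hs : Measurable s) :
    MeasurableSet {u : ℕ → ℝ | (∀ j < k, u (a + j) < s u) ∧ shape u a k ∈ Q} := by
  have : {u : ℕ → ℝ | (∀ j < k, u (a + j) < s u) ∧ shape u a k ∈ Q} =
      (⋂ j : Fin k, {u | u (a + j) < s u}) ∩ (fun u => shape u a k) ⁻¹' Q := by
    ext u
    simp [Fin.forall_iff]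
  rw [this]
  exact (MeasurableSet.iInter fun j => measurableSet_lt (measurable_pi_apply _) hs).inter
    (measurable_shape a k trivial)

theorem measurableSet_fringeSet : MeasurableSet (fringeSet i k Q) :=
  measurableSet_below (i + 1) k Q (by fun_prop)

theorem measurableSet_recursiveSet : MeasurableSet (recursiveSet i k Q) :=
  (measurableSet_lt (measurable_pi_apply (i + k + 1)) (measurable_pi_apply i)).inter
    (measurableSet_below (i + 1) k Q (measurable_pi_apply (i + k + 1)))

theorem mem_fringeSet_congr {u v : ℕ → ℝ} (h : ∀ j ∈ Finset.Ico i (i + k + 2), u j = v j) :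
    u ∈ fringeSet i k Q ↔ v ∈ fringeSet i k Q := by
  have h' : ∀ j < k, u (i + 1 + j) = v (i + 1 + j) := fun j hj =>
    h _ (Finset.mem_Ico.2 ⟨by omega, by omega⟩)
  have h1 := h i (Finset.mem_Ico.2 ⟨by omega, by omega⟩)
  have h2 := h (i + k + 1) (Finset.mem_Ico.2 ⟨by omega, by omega⟩)
  simp only [fringeSet, Set.mem_ofPred_eq]
  rw [shape_congr (v := v) (b := i + 1) fun a ha b hb => by rw [h' a ha, h' b hb], h1, h2]
  refine and_congr_left fun _ => forall₂_congr fun j hj => by rw [h' j hj]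

theorem mem_recursiveSet_congr {u v : ℕ → ℝ} (h : ∀ j ∈ Finset.Ico i (i + k + 2), u j = v j) :
    u ∈ recursiveSet i k Q ↔ v ∈ recursiveSet i k Q := by
  have h' : ∀ j < k, u (i + 1 + j) = v (i + 1 + j) := fun j hj =>
    h _ (Finset.mem_Ico.2 ⟨by omega, by omega⟩)
  have h1 := h i (Finset.mem_Ico.2 ⟨by omega, by omega⟩)
  have h2 := h (i + k + 1) (Finset.mem_Ico.2 ⟨by omega, by omega⟩)
  simp only [recursiveSet, Set.mem_ofPred_eq]
  rw [shape_congr (v := v) (b := i + 1) fun a ha b hb => by rw [h' a ha, h' b hb], h1, h2]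
  refine and_congr_right fun _ => and_congr_left fun _ => forall₂_congr fun j hj => by rw [h' j hj]

theorem dependsOn_indicator {E : Set (ℕ → ℝ)} {S : Set ℕ} {M : Type*} [Zero M] [One M]
    (h : ∀ u v : ℕ → ℝ, (∀ j ∈ S, u j = v j) → (u ∈ E ↔ v ∈ E)) :
    DependsOn (E.indicator (1 : (ℕ → ℝ) → M)) S := by
  intro u v huv
  by_cases hu : u ∈ E
  · rw [Set.indicator_of_mem hu, Set.indicator_of_mem ((h u v huv).1 hu)]
    rfl
  · rw [Set.indicator_of_notMem hu, Set.indicator_of_notMem (hu ∘ (h u v huv).2)]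

theorem ae_min_mem (i j : ℕ) : ∀ᵐ u ∂iidMeasure unif, min (u i) (u j) ∈ Set.Ioo (0 : ℝ) 1 := by
  filter_upwards [ae_mem_Ioo i, ae_mem_Ioo j] with u hi hj
  exact ⟨lt_min hi.1 hj.1, (min_le_left _ _).trans_lt hi.2⟩

theorem dependsOn_min_eval {i j : ℕ} {S : Set ℕ} (hi : i ∈ S) (hj : j ∈ S) :
    DependsOn (fun u : ℕ → ℝ => min (u i) (u j)) S := fun u v h => by
  simp only [h i hi, h j hj]

theorem measure_fringeSet : iidMeasure unif (fringeSet 0 k Q) =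
    blockProb k Q * ENNReal.ofReal (2 / ((k + 1) * (k + 2))) := by
  have h := lintegral_block (0 + 1) k Q {0, k + 1} (by
      rw [Finset.disjoint_left]
      intro j hj
      simp only [Finset.mem_insert, Finset.mem_singleton, Finset.mem_Ico] at *
      omega) (φ := fun _ => 1) (s := fun u => min (u 0) (u (0 + k + 1)))
    measurable_const (by fun_prop) (fun _ _ _ => rfl)
    (dependsOn_min_eval (by simp) (by simp)) (ae_min_mem _ _)
  simp only [one_mul] at h
  rw [lintegral_min_pow_fst (by omega)] at h
  rw [← h]
  exact (lintegral_indicator_one (measurableSet_fringeSet (i := 0))).symm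

/-- The adjacent blocks share the neighbour at `k + 1`. Given the three separating variables at `0`,
`k + 1` and `k + m + 2`, the blocks are independent and are integrated out one after the other,
leaving the moment of the two minima. -/
theorem measure_fringeSet_inter : iidMeasure unif (fringeSet 0 k Q ∩ fringeSet (k + 1) m R) =
    blockProb k Q * blockProb m R * ENNReal.ofReal (minMoment k m) := by
  -- The event of the second block plays the role of the weight here, since it does not read the
  -- variables inside the first block.
  have h := lintegral_block (0 + 1) k Q ({0} ∪ Finset.Ico (k + 1) (k + 1 + m + 2)) (by
      rw [Finset.disjoint_left]
      intro j hj
      simp only [Finset.mem_union, Finset.mem_singleton, Finset.mem_Ico] at *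
      omega) (φ := (fringeSet (k + 1) m R).indicator 1) (s := fun u => min (u 0) (u (0 + k + 1)))
    (measurable_one.indicator measurableSet_fringeSet) (by fun_prop)
    (dependsOn_indicator fun u v huv => mem_fringeSet_congr fun j hj => huv j (by
      simp only [Finset.coe_union, Set.mem_union, Finset.mem_coe]
      exact Or.inr hj))
    (dependsOn_min_eval (by simp) (by simp; omega)) (ae_min_mem _ _)
  have h2 := lintegral_block (k + 1 + 1) m R {0, k + 1, k + 1 + m + 1} (by
      rw [Finset.disjoint_left]
      intro j hj
      simp only [Finset.mem_insert, Finset.mem_singleton, Finset.mem_Ico] at *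
      omega) (φ := fun u => ENNReal.ofReal (min (u 0) (u (k + 1))) ^ k)
    (s := fun u => min (u (k + 1)) (u (k + 1 + m + 1)))
    (by fun_prop) (by fun_prop)
    (fun u v h => by simp only [h 0 (by simp), h (k + 1) (by simp)])
    (dependsOn_min_eval (by simp) (by simp)) (ae_min_mem _ _)
  rw [lintegral_min_pow_mul_min_pow (by omega) (by omega) (by omega)] at h2
  rw [← lintegral_indicator_one (measurableSet_fringeSet.inter measurableSet_fringeSet), mul_assoc,
    ← h2]
  refine Eq.trans (lintegral_congr fun u => ?_) (h.trans ?_)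
  · rw [Set.inter_comm, Set.inter_indicator_one]
    rfl
  · congr 1
    refine lintegral_congr fun u => ?_
    rw [mul_comm, zero_add]
    rfl

theorem measure_recursiveSet : iidMeasure unif (recursiveSet 0 k Q) =
    blockProb k Q * ENNReal.ofReal (1 / ((k + 1) * (k + 2))) := by
  have h := lintegral_block (0 + 1) k Q {0, k + 1} (by
      rw [Finset.disjoint_left]
      intro j hj
      simp only [Finset.mem_insert, Finset.mem_singleton, Finset.mem_Ico] at *
      omega) (φ := ltIndicator 0 (0 + k + 1)) (s := fun u => u (0 + k + 1))
    (measurable_ltIndicator _ _) (by fun_prop) (dependsOn_ltIndicator (by simp) (by simp))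
    (fun u v h => h _ (by simp)) (ae_mem_Ioo _)
  rw [lintegral_ltIndicator_mul_pow (by omega)] at h
  rw [← h, ← lintegral_indicator_one measurableSet_recursiveSet]
  refine lintegral_congr fun u => ?_
  exact congrFun (Set.inter_indicator_one (s := {u : ℕ → ℝ | u (0 + k + 1) < u 0})
    (t := {u : ℕ → ℝ | (∀ j < k, u (0 + 1 + j) < u (0 + k + 1)) ∧ shape u (0 + 1) k ∈ Q})) u

/-- The variable at `k + 1` is both the maximum ending the first run and the left neighbour of the
second. The separators must satisfy `u (k + m + 2) < u (k + 1) < u 0`. -/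
theorem measure_recursiveSet_inter :
    iidMeasure unif (recursiveSet 0 k Q ∩ recursiveSet (k + 1) m R) =
    blockProb k Q * blockProb m R *
      ENNReal.ofReal (1 / ((m + 1) * (k + m + 2) * (k + m + 3))) := by
  have h := lintegral_block (0 + 1) k Q ({0} ∪ Finset.Ico (k + 1) (k + 1 + m + 2)) (by
      rw [Finset.disjoint_left]
      intro j hj
      simp only [Finset.mem_union, Finset.mem_singleton, Finset.mem_Ico] at *
      omega)
    (φ := fun u => ltIndicator 0 (0 + k + 1) u * (recursiveSet (k + 1) m R).indicator 1 u)
    (s := fun u => u (0 + k + 1))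
    ((measurable_ltIndicator _ _).mul (measurable_one.indicator measurableSet_recursiveSet))
    (by fun_prop)
    (fun u v huv => by
      have h1 := dependsOn_ltIndicator (i := 0) (j := 0 + k + 1) (by simp) (by simp; omega) huv
      have h2 := dependsOn_indicator (M := ENNReal) (E := recursiveSet (k + 1) m R)
        (fun u v huv => mem_recursiveSet_congr fun j hj => huv j (by
          simp only [Finset.coe_union, Set.mem_union, Finset.mem_coe]
          exact Or.inr hj)) huv
      simp only [h1, h2])
    (fun u v h => h _ (by simp; omega)) (ae_mem_Ioo _)
  have h2 := lintegral_block (k + 1 + 1) m R {0, k + 1, k + 1 + m + 1} (by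
      rw [Finset.disjoint_left]
      intro j hj
      simp only [Finset.mem_insert, Finset.mem_singleton, Finset.mem_Ico] at *
      omega)
    (φ := fun u => ltIndicator 0 (k + 1) u * ENNReal.ofReal (u (k + 1)) ^ k *
      ltIndicator (k + 1) (k + 1 + m + 1) u)
    (s := fun u => u (k + 1 + m + 1))
    (((measurable_ltIndicator _ _).mul (by fun_prop)).mul (measurable_ltIndicator _ _))
    (by fun_prop)
    (fun u v h => by
      have h1 := dependsOn_ltIndicator (i := 0) (j := k + 1) (by simp) (by simp) h
      have h2 := dependsOn_ltIndicator (i := k + 1) (j := k + 1 + m + 1) (by simp) (by simp) h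
      simp only [h1, h2, h (k + 1) (by simp)])
    (fun u v h => h _ (by simp)) (ae_mem_Ioo _)
  simp only [mul_assoc] at h2
  simp only [← mul_assoc (ltIndicator 0 (k + 1) _)] at h2
  rw [lintegral_ltIndicator_mul_pow_mul (by omega) (by omega) (by omega)] at h2
  rw [← lintegral_indicator_one (measurableSet_recursiveSet.inter measurableSet_recursiveSet),
    mul_assoc, ← h2]
  have e : ∀ (i k : ℕ) (Q : Set (BinaryTree Unit)) (u : ℕ → ℝ),
      (recursiveSet i k Q).indicator (1 : (ℕ → ℝ) → ENNReal) u = ltIndicator i (i + k + 1) u *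
      {u : ℕ → ℝ | (∀ j < k, u (i + 1 + j) < u (i + k + 1)) ∧
        shape u (i + 1) k ∈ Q}.indicator 1 u := fun i k Q u =>
    congrFun (Set.inter_indicator_one (s := {u : ℕ → ℝ | u (i + k + 1) < u i})
      (t := {u : ℕ → ℝ | (∀ j < k, u (i + 1 + j) < u (i + k + 1)) ∧ shape u (i + 1) k ∈ Q})) u
  refine Eq.trans (lintegral_congr fun u => ?_) (h.trans ?_)
  · rw [Set.inter_indicator_one, Pi.mul_apply, e 0 k]
    ring
  · congr 1
    refine lintegral_congr fun u => ?_
    rw [e (k + 1) m, zero_add]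
    ring

end BlockEvents

/-! ### Covariances of window indicators -/

section Covariance

variable {ν : Measure ℝ} [IsProbabilityMeasure ν]

theorem isWindow_indicator {E : Set (ℕ → ℝ)} (hE : MeasurableSet E) {w : ℕ}
    (h : ∀ u v : ℕ → ℝ, (∀ j < w, u j = v j) → (u ∈ E ↔ v ∈ E)) :
    IsWindow (E.indicator 1) w 1 where
  measurable := measurable_one.indicator hE
  dependsOn := dependsOn_indicator fun u v huv => h u v fun j hj => huv j hj
  bound u := by
    by_cases hu : u ∈ E
    · rw [Set.indicator_of_mem hu]
      simp
    · rw [Set.indicator_of_notMem hu]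
      simp

theorem IsWindow.mono {g : (ℕ → ℝ) → ℝ} {w w' : ℕ} {C : ℝ} (hg : IsWindow g w C) (h : w ≤ w') :
    IsWindow g w' C :=
  ⟨hg.measurable, hg.dependsOn.mono (Set.Iio_subset_Iio h), hg.bound⟩

theorem windowCov_comm (g h : (ℕ → ℝ) → ℝ) (i j : ℕ) :
    windowCov ν g h i j = windowCov ν h g j i :=
  covariance_comm _ _

/-- In each expression one sum runs over the lags `0, …, w - 1` and the other over `1, …, w`. They
agree after exchange because lag `w` contributes nothing. -/
theorem asympCov_comm {g h : (ℕ → ℝ) → ℝ} {w : ℕ} {C D : ℝ} (hg : IsWindow g w C)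
    (hh : IsWindow h w D) : asympCov ν g h w = asympCov ν h g w := by
  cases w with
  | zero => simp [asympCov]
  | succ w =>
    have h1 := windowCov_eq_zero (ν := ν) hg hh (i := w + 1) (j := 0) (by omega)
    have h2 := windowCov_eq_zero (ν := ν) hh hg (i := w + 1) (j := 0) (by omega)
    rw [asympCov, asympCov, Finset.sum_range_succ', Finset.sum_range_succ, h1,
      Finset.sum_range_succ' (fun l => windowCov ν h g 0 l),
      Finset.sum_range_succ (fun l => windowCov ν h g (l + 1) 0), h2]
    simp only [windowCov_comm (ν := ν) g h]
    ring

theorem windowCov_indicator {A B : Set (ℕ → ℝ)} (hA : MeasurableSet A) (hB : MeasurableSet B)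
    (i j : ℕ) : windowCov ν (A.indicator 1) (B.indicator 1) i j =
      (iidMeasure ν).real {u | shift i u ∈ A ∧ shift j u ∈ B} -
        (iidMeasure ν).real A * (iidMeasure ν).real B := by
  have e : ∀ (E : Set (ℕ → ℝ)) (i : ℕ) (u : ℕ → ℝ), E.indicator (1 : (ℕ → ℝ) → ℝ) (shift i u) =
      (shift i ⁻¹' E).indicator 1 u := fun E i u => rfl
  have hAi := measurable_shift i hA
  have hBj := measurable_shift j hB
  have hm : ∀ (E : Set (ℕ → ℝ)), MeasurableSet E →
      MemLp (E.indicator (1 : (ℕ → ℝ) → ℝ)) 2 (iidMeasure ν) := fun E hE =>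
    memLp_indicator_const 2 hE 1 (Or.inr (measure_ne_top _ _))
  simp only [windowCov, e]
  rw [covariance_eq_sub (hm _ hAi) (hm _ hBj), integral_indicator_one hAi,
    integral_indicator_one hBj, ← Set.inter_indicator_one,
    integral_indicator_one (hAi.inter hBj)]
  have h : ∀ (E : Set (ℕ → ℝ)) (i : ℕ), MeasurableSet E →
      (iidMeasure ν).real (shift i ⁻¹' E) = (iidMeasure ν).real E := fun E i hE =>
    congrArg ENNReal.toReal ((measurePreserving_shift ν i).measure_preimage hE.nullMeasurableSet)
  rw [h A i hA, h B j hB]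
  rfl

/-- The lags fall into four kinds. For `0 ≤ l ≤ a - b` the second window may be nested in the first,
and the total is `c`. Partial overlaps are impossible. At lag `a`, or `b` in the other direction,
the windows share exactly one coordinate. Farther windows are independent. The product of the
probabilities is subtracted once for each of the `a + b + 1` remaining lags. -/
theorem asympCov_indicator {A B : Set (ℕ → ℝ)} {a b w : ℕ} {c : ℝ} (hA : MeasurableSet A)
    (hB : MeasurableSet B) (hgA : IsWindow (A.indicator 1) (a + 1) 1)
    (hgB : IsWindow (B.indicator 1) (b + 1) 1) (hb : 1 ≤ b) (hba : b ≤ a) (haw : a < w)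
    (hnest : ∀ᵐ u ∂iidMeasure ν, u ∈ A →
      ∑ l ∈ Finset.range (a - b + 1), B.indicator (1 : (ℕ → ℝ) → ℝ) (shift l u) = c)
    (hover : ∀ l, a - b < l → l < a → ∀ u, u ∈ A → shift l u ∉ B)
    (hover' : ∀ l, 0 < l → l < b → ∀ u, u ∈ B → shift l u ∉ A) :
    asympCov ν (A.indicator 1) (B.indicator 1) w =
      c * (iidMeasure ν).real A + (iidMeasure ν).real {u | u ∈ A ∧ shift a u ∈ B} +
        (iidMeasure ν).real {u | u ∈ B ∧ shift b u ∈ A} -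
          (a + b + 1) * ((iidMeasure ν).real A * (iidMeasure ν).real B) := by
  set π := (iidMeasure ν).real A * (iidMeasure ν).real B with hπ
  have hcut : ∀ (f : ℕ → ℝ) (n : ℕ), n ≤ w → (∀ l, n ≤ l → f l = 0) →
      ∑ l ∈ Finset.range w, f l = ∑ l ∈ Finset.range n, f l := by
    intro f n hn hf
    refine (Finset.sum_subset (Finset.range_mono hn) fun l _ hl => hf l ?_).symm
    rw [Finset.mem_range] at hl
    omega
  have h1 : ∑ l ∈ Finset.range w, windowCov ν (A.indicator 1) (B.indicator 1) 0 l =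
      c * (iidMeasure ν).real A + (iidMeasure ν).real {u | u ∈ A ∧ shift a u ∈ B} -
        (a + 1) * π := by
    rw [hcut _ (a + 1) haw fun l hl => windowCov_eq_zero hgA hgB (by omega)]
    simp only [windowCov_indicator hA hB, shift_zero]
    rw [Finset.sum_sub_distrib, Finset.sum_const, Finset.card_range, Finset.sum_range_succ]
    -- The lags strictly between `a - b` and `a` are the partial overlaps and give empty events.
    have h2 : ∑ l ∈ Finset.range a, (iidMeasure ν).real {u | u ∈ A ∧ shift l u ∈ B} =
        ∑ l ∈ Finset.range (a - b + 1), (iidMeasure ν).real {u | u ∈ A ∧ shift l u ∈ B} := by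
      refine (Finset.sum_subset (Finset.range_mono (by omega)) fun l hl hl' => ?_).symm
      rw [Finset.mem_range] at hl hl'
      have : {u | u ∈ A ∧ shift l u ∈ B} = ∅ := by
        ext u
        simpa using hover l (by omega) hl u
      rw [this]
      simp
    have h3 : ∑ l ∈ Finset.range (a - b + 1), (iidMeasure ν).real {u | u ∈ A ∧ shift l u ∈ B} =
        c * (iidMeasure ν).real A := by
      have e : ∀ l, (iidMeasure ν).real {u | u ∈ A ∧ shift l u ∈ B} =
          ∫ u, A.indicator 1 u * B.indicator (1 : (ℕ → ℝ) → ℝ) (shift l u) ∂iidMeasure ν := by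
        intro l
        have hE : MeasurableSet {u | u ∈ A ∧ shift l u ∈ B} := hA.inter (measurable_shift l hB)
        rw [← integral_indicator_one hE]
        exact congrArg _ (Set.inter_indicator_one (s := A) (t := shift l ⁻¹' B))
      simp only [e]
      rw [← integral_finsetSum]
      · rw [← integral_indicator_one hA, ← integral_const_mul]
        refine integral_congr_ae ?_
        filter_upwards [hnest] with u hu
        rw [← Finset.mul_sum]
        by_cases huA : u ∈ A
        · rw [hu huA, mul_comm]
        · simp [huA]
      · intro l _
        refine ((memLp_of_bound (hgA.measurable.mul (hgB.measurable.comp (measurable_shift l)))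
          (C := 1) fun u => ?_) 1).integrable le_rfl
        rw [Pi.mul_apply, abs_mul]
        exact mul_le_one₀ (hgA.bound u) (abs_nonneg _) (hgB.bound _)
    rw [h2, h3]
    simp only [nsmul_eq_mul]
    push_cast
    ring
  have h2 : ∑ l ∈ Finset.range w, windowCov ν (A.indicator 1) (B.indicator 1) (l + 1) 0 =
      (iidMeasure ν).real {u | u ∈ B ∧ shift b u ∈ A} - b * π := by
    simp only [windowCov_comm (ν := ν) (A.indicator 1)]
    rw [hcut _ b (by omega) fun l hl => windowCov_eq_zero hgB hgA (by omega)]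
    obtain ⟨b, rfl⟩ := Nat.exists_eq_add_of_le' hb
    simp only [windowCov_indicator hB hA, shift_zero]
    rw [Finset.sum_sub_distrib, Finset.sum_const, Finset.card_range, Finset.sum_range_succ,
      Finset.sum_eq_zero]
    · rw [hπ]
      simp only [nsmul_eq_mul]
      push_cast
      ring
    · intro l hl
      rw [Finset.mem_range] at hl
      have : {u | u ∈ B ∧ shift (l + 1) u ∈ A} = ∅ := by
        ext u
        simpa using hover' (l + 1) (by omega) (by omega) u
      rw [this]
      simp
  rw [asympCov, h1, h2]
  ring

end Covariance

/-! ### Counts as sums over windows -/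

/-- Only end effects differ: the first position, the last `k` positions, and the additional term at
`n`. -/
theorem abs_count_sub_count_le {x y : ℕ → Prop} [DecidablePred x] [DecidablePred y] {n k : ℕ}
    (h : ∀ i, 0 < i → i + k < n → (x i ↔ y i)) :
    |(∑ i ∈ Finset.range (n + 1), if x i then (1 : ℝ) else 0) -
      ∑ i ∈ Finset.range n, if y i then (1 : ℝ) else 0| ≤ k + 3 := by
  set s : Finset ℕ := insert 0 (Finset.Ico (n - k) n) with hs
  have hcard : (s.card : ℝ) ≤ k + 1 := by
    have : s.card ≤ k + 1 := by
      refine (Finset.card_insert_le _ _).trans ?_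
      rw [Nat.card_Ico]
      omega
    exact_mod_cast this
  rw [Finset.sum_range_succ, add_sub_right_comm, ← Finset.sum_sub_distrib]
  have h1 : |∑ i ∈ Finset.range n, ((if x i then (1 : ℝ) else 0) - if y i then 1 else 0)| ≤
      s.card := by
    refine (Finset.abs_sum_le_sum_abs _ _).trans ?_
    calc _ ≤ ∑ i ∈ Finset.range n, if i ∈ s then (1 : ℝ) else 0 := by
          refine Finset.sum_le_sum fun i hi => ?_
          rw [Finset.mem_range] at hi
          by_cases his : i ∈ s
          · rw [if_pos his]
            split_ifs <;> simp
          · rw [if_neg his]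
            simp only [hs, Finset.mem_insert, Finset.mem_Ico, not_or, not_and] at his
            simp [h i (by omega) (by omega)]
      _ = ((Finset.range n).filter (· ∈ s)).card := by rw [Finset.sum_boole]
      _ ≤ _ := by
          exact_mod_cast Finset.card_le_card fun i hi => (Finset.mem_filter.1 hi).2
  have h2 : |if x n then (1 : ℝ) else 0| ≤ 1 := by split_ifs <;> simp
  refine (abs_add_le _ _).trans ?_
  linarith

theorem exists_forall_lt (u : ℕ → ℝ) (n : ℕ) : ∃ M, ∀ j < n, u j < M := by
  obtain ⟨b, hb⟩ := ((Finset.range n).image u).bddAbove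
  refine ⟨b + 1, fun j hj => ?_⟩
  have : u j ≤ b := hb (by simpa using ⟨j, hj, rfl⟩)
  linarith

/-- The sequence `u` with the variables at `0` and `n` replaced. -/
def replaceEnds (u : ℕ → ℝ) (n : ℕ) (x y : ℝ) : ℕ → ℝ :=
  fun j => if j = 0 then x else if j = n then y else u j

theorem replaceEnds_of_ne {u : ℕ → ℝ} {n : ℕ} {x y : ℝ} {j : ℕ} (h0 : j ≠ 0) (hn : j ≠ n) :
    replaceEnds u n x y j = u j := by
  simp [replaceEnds, h0, hn]

theorem injOn_replaceEnds {u : ℕ → ℝ} (hu : Function.Injective u) (n : ℕ) (x y : ℝ) :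
    Set.InjOn (replaceEnds u (n + 1) x y) (Set.Ico (0 + 1) (0 + 1 + n)) := by
  intro i hi j hj h
  rw [Set.mem_Ico] at hi hj
  rw [replaceEnds_of_ne (by omega) (by omega), replaceEnds_of_ne (by omega) (by omega)] at h
  exact hu h

theorem shape_replaceEnds (u : ℕ → ℝ) (n : ℕ) (x y : ℝ) :
    shape (replaceEnds u (n + 1) x y) 1 n = shape u 1 n :=
  shape_congr fun i hi j hj => by
    rw [replaceEnds_of_ne (by omega) (by omega), replaceEnds_of_ne (by omega) (by omega)]

theorem windowSum_indicator (E : Set (ℕ → ℝ)) (n : ℕ) (u : ℕ → ℝ) [DecidablePred (· ∈ E)] :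
    windowSum (E.indicator 1) n u =
      ∑ i ∈ Finset.range n, if shift i u ∈ E then (1 : ℝ) else 0 := by
  refine Finset.sum_congr rfl fun i _ => ?_
  simp [Set.indicator_apply]

/-! ### The binary search tree -/

theorem isWindow_fringeSet (k : ℕ) (Q : Set (BinaryTree Unit)) :
    IsWindow ((fringeSet 0 k Q).indicator 1) (k + 2) 1 :=
  isWindow_indicator measurableSet_fringeSet fun u v h => mem_fringeSet_congr fun j hj =>
    h j (by simpa using hj)

open Classical in
-- The finite tree is placed between two sentinels above all its variables, which makes the whole
-- range a fringe block. Only windows touching a sentinel can be counted differently from those of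
-- the infinite sequence.
theorem isApproxWindowSum_copies_shape {T : BinaryTree Unit} (hT : T ≠ .nil) :
    IsApproxWindowSum unif (fun n u => (copies T (shape u 1 n) : ℝ))
      ((fringeSet 0 (size T) {T}).indicator 1) (size T + 2) 1 (size T + 3) where
  isWindow := isWindow_fringeSet _ _
  measurable n := by
    have hm : Measurable fun t : BinaryTree Unit => (copies T t : ℝ) := fun _ _ => trivial
    exact hm.comp (measurable_shape 1 n)
  approx n := by
    filter_upwards [ae_injective (ν := unif)] with u hu
    obtain ⟨M, hM⟩ := exists_forall_lt u (n + 1)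
    set v := replaceEnds u (n + 1) M M with hv
    have hv0 : v 0 = M := by simp [hv, replaceEnds]
    have hvn : v (0 + n + 1) = M := by simp [hv, replaceEnds]
    have hblock : IsFringeBlock v 0 n := fun j h1 h2 => by
      rw [hv0, hvn, hv, replaceEnds_of_ne (by omega) (by omega)]
      exact ⟨hM j (by omega), hM j (by omega)⟩
    have h := copies_shape_eq_sum T hT v 0 n (injOn_replaceEnds hu n M M) hblock
    rw [zero_add, shape_replaceEnds] at h
    rw [windowSum_indicator, h]
    push_cast
    refine abs_count_sub_count_le fun i hi hik => ?_
    rw [shift_mem_fringeSet, zero_add, mem_fringeSet_congr (v := v) fun j hj => ?_, mem_fringeSet]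
    · simp only [Set.mem_singleton_iff]
      exact and_iff_right (by omega)
    · rw [Finset.mem_Ico] at hj
      rw [hv, replaceEnds_of_ne (by omega) (by omega)]

/-- In a partial overlap each block contains a neighbour of the other, namely `l` and `k + 1`, and
each of these two variables would be smaller than the other. -/
theorem isFringeBlock_not_overlap {u : ℕ → ℝ} {k l m : ℕ} (h : IsFringeBlock u 0 k)
    (h' : IsFringeBlock u l m) (hl : 0 < l) (hlk : l < k + 1) (hkl : k < l + m) : False :=
  lt_asymm (h l hl (by omega)).2 (by simpa using (h' (0 + k + 1) (by omega) (by omega)).1)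

theorem real_fringeSet (k : ℕ) (Q : Set (BinaryTree Unit)) :
    (iidMeasure unif).real (fringeSet 0 k Q) =
      (blockProb k Q).toReal * (2 / ((k + 1) * (k + 2))) := by
  rw [measureReal_def, measure_fringeSet, ENNReal.toReal_mul, ENNReal.toReal_ofReal (by positivity)]

theorem real_fringeSet_inter (k m : ℕ) (Q R : Set (BinaryTree Unit)) :
    (iidMeasure unif).real {u | u ∈ fringeSet 0 k Q ∧ shift (k + 1) u ∈ fringeSet 0 m R} =
      (blockProb k Q).toReal * (blockProb m R).toReal * minMoment k m := by
  have h := measure_fringeSet_inter (k := k) (m := m) (Q := Q) (R := R)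
  simp only [shift_mem_fringeSet]
  rw [measureReal_def]
  change (iidMeasure unif (fringeSet 0 k Q ∩ fringeSet (k + 1) m R)).toReal = _
  rw [h, ENNReal.toReal_mul, ENNReal.toReal_mul, ENNReal.toReal_ofReal]
  unfold minMoment
  positivity

theorem toReal_blockProb_size (T : BinaryTree Unit) :
    (blockProb (size T) {T}).toReal = shapeProb randomBST T := by
  rw [shapeProb, toReal_randomBST_apply unif]
  rfl

open Classical in
-- With `a` and `b` one more than the sizes, the `k + m + 3` products of probabilities give the
-- first term of `gammaBST`; the second is twice the symmetric `minMoment`, from the two adjacent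
-- placements.
theorem asympCov_fringeSet_of_le {T T' : BinaryTree Unit} (hT' : T' ≠ .nil)
    (hle : size T' ≤ size T) {w : ℕ} (hw : size T + 2 ≤ w) :
    asympCov unif ((fringeSet 0 (size T) {T}).indicator 1)
      ((fringeSet 0 (size T') {T'}).indicator 1) w = sigmaBSTOfLE T T' := by
  have hpos : 0 < size T' := Nat.pos_of_ne_zero (size_ne_zero hT')
  have h := asympCov_indicator (ν := unif) (a := size T + 1) (b := size T' + 1) (w := w)
    (c := copies T' T) (measurableSet_fringeSet (i := 0) (k := size T) (Q := {T}))
    (measurableSet_fringeSet (i := 0) (k := size T') (Q := {T'}))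
    (isWindow_fringeSet _ _) (isWindow_fringeSet _ _) (by omega) (by omega) (by omega)
    (by
      filter_upwards [ae_injective (ν := unif)] with u hu huA
      rw [mem_fringeSet, zero_add, Set.mem_singleton_iff] at huA
      have hc := copies_shape_eq_sum T' hT' u 0 (size T) hu.injOn huA.1
      rw [zero_add, huA.2] at hc
      rw [hc]
      push_cast
      rw [← Finset.sum_subset (Finset.range_mono (by omega : size T + 1 - (size T' + 1) + 1 ≤
        size T + 1))]
      · refine Finset.sum_congr (by congr 1; omega) fun i hi => ?_
        rw [Finset.mem_range] at hi
        rw [Set.indicator_apply, shift_mem_fringeSet, mem_fringeSet, Set.mem_singleton_iff, zero_add]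
        have hi' : i + size T' ≤ size T := by omega
        split_ifs <;> tauto
      · intro i _ hi
        rw [Finset.mem_range] at hi
        exact if_neg fun hc => by omega)
    (fun l h1 h2 u hu hu' => by
      rw [shift_mem_fringeSet, mem_fringeSet] at hu'
      rw [mem_fringeSet] at hu
      exact isFringeBlock_not_overlap hu.1 hu'.1 (by omega) (by omega) (by omega))
    (fun l h1 h2 u hu hu' => by
      rw [shift_mem_fringeSet, mem_fringeSet] at hu'
      rw [mem_fringeSet] at hu
      exact isFringeBlock_not_overlap hu.1 hu'.1 (by omega) (by omega) (by omega))
  rw [h, real_fringeSet_inter, real_fringeSet_inter, real_fringeSet, real_fringeSet,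
    toReal_blockProb_size, toReal_blockProb_size, sigmaBSTOfLE, gammaBST, minMoment, minMoment]
  push_cast
  field_simp
  ring

theorem asympCov_fringeSet {T T' : BinaryTree Unit} (hT : T ≠ .nil) (hT' : T' ≠ .nil) {w : ℕ}
    (hw : size T + 2 ≤ w) (hw' : size T' + 2 ≤ w) :
    asympCov unif ((fringeSet 0 (size T) {T}).indicator 1)
      ((fringeSet 0 (size T') {T'}).indicator 1) w = sigmaBST T T' := by
  rw [sigmaBST]
  split_ifs with hle
  · exact asympCov_fringeSet_of_le hT' hle hw
  · rw [asympCov_comm ((isWindow_fringeSet _ _).mono hw) ((isWindow_fringeSet _ _).mono hw')]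
    exact asympCov_fringeSet_of_le hT (by omega) hw'

/-! ### The random recursive tree -/

theorem isWindow_recursiveSet (k : ℕ) (Q : Set (BinaryTree Unit)) :
    IsWindow ((recursiveSet 0 k Q).indicator 1) (k + 2) 1 :=
  isWindow_indicator measurableSet_recursiveSet fun u v h => mem_recursiveSet_congr fun j hj =>
    h j (by simpa using hj)

section Recursive

variable {τ : Type} [HasFringe τ] {q : OrderedTree Unit → τ}

/-- The binary trees which represent `L`. -/
def rotateFiber (q : OrderedTree Unit → τ) (L : τ) : Set (BinaryTree Unit) :=
  {t | q (rotateTree t) = L}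

open Classical in
theorem isApproxWindowSum_copies_rotateTree (hq : FringeHom q) (L : τ) :
    IsApproxWindowSum unif (fun n u => (copies L (q (rotateTree (shape u 1 (n - 1)))) : ℝ))
      ((recursiveSet 0 (size L - 1) (rotateFiber q L)).indicator 1) (size L + 1) 1
      (size L + 3 + copies L (q (rotateTree .nil))) where
  isWindow := by
    have h1 := isWindow_recursiveSet (size L - 1) (rotateFiber q L)
    rwa [show size L - 1 + 2 = size L + 1 by have := hq.one_le_size L; omega] at h1
  measurable n := by
    have hm : Measurable fun t : BinaryTree Unit => (copies L (q (rotateTree t)) : ℝ) :=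
      fun _ _ => trivial
    exact hm.comp (measurable_shape 1 (n - 1))
  approx n := by
    have hL := hq.one_le_size L
    rcases n with _ | n
    -- For `n = 0` the tree is a single node by convention while the window sum is empty; the last
    -- summand of the error bound covers this case.
    · refine Eventually.of_forall fun u => ?_
      rw [windowSum, Finset.sum_range_zero, sub_zero, Nat.abs_cast, Nat.zero_sub, shape_zero]
      have : (0 : ℝ) ≤ size L := Nat.cast_nonneg _
      linarith
    filter_upwards [ae_injective (ν := unif)] with u hu
    obtain ⟨M, hM⟩ := exists_forall_lt u (n + 1)
    -- The right sentinel is the root and so the maximum of the run; the left one must be strictly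
    -- above it.
    set v := replaceEnds u (n + 1) (M + 1) M with hv
    have hv0 : v 0 = M + 1 := by simp [hv, replaceEnds]
    have hvn : v (0 + (n + 1)) = M := by simp [hv, replaceEnds]
    have hblock : IsRecursiveBlock v 0 (n + 1) := by
      rw [IsRecursiveBlock, hv0, hvn]
      refine ⟨by linarith, fun j h1 h2 => ?_⟩
      rw [hv, replaceEnds_of_ne (by omega) (by omega)]
      exact hM j (by omega)
    have h := hq.copies_rotateTree_shape_eq_sum L v 0 n (injOn_replaceEnds hu n (M + 1) M) hblock
    rw [zero_add, shape_replaceEnds] at h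
    rw [windowSum_indicator, Nat.add_sub_cancel, h]
    push_cast
    refine (abs_count_sub_count_le (k := size L) fun i hi hik => ?_).trans (by simp)
    rw [shift_mem_recursiveSet, zero_add, mem_recursiveSet_congr (v := v) fun j hj => ?_,
      mem_recursiveSet, Nat.sub_add_cancel hL]
    · exact and_iff_right (by omega)
    · rw [Finset.mem_Ico] at hj
      rw [hv, replaceEnds_of_ne (by omega) (by omega)]

/-- In a partial overlap `u l < u k` because `l` lies in the first run, while `u k < u (l + m) < u
l` because `k` lies in the second. -/
theorem isRecursiveBlock_not_overlap {u : ℕ → ℝ} {k l m : ℕ} (h : IsRecursiveBlock u 0 k)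
    (h' : IsRecursiveBlock u l m) (hl : 0 < l) (hlk : l < k) (hkl : k < l + m) : False := by
  have h1 := h.2 l hl (by omega)
  have h2 := h'.2 (0 + k) (by omega) (by omega)
  exact lt_asymm h1 (h2.trans h'.1)

theorem real_recursiveSet (k : ℕ) (Q : Set (BinaryTree Unit)) :
    (iidMeasure unif).real (recursiveSet 0 k Q) =
      (blockProb k Q).toReal * (1 / ((k + 1) * (k + 2))) := by
  rw [measureReal_def, measure_recursiveSet, ENNReal.toReal_mul,
    ENNReal.toReal_ofReal (by positivity)]

theorem real_recursiveSet_inter (k m : ℕ) (Q R : Set (BinaryTree Unit)) :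
    (iidMeasure unif).real {u | u ∈ recursiveSet 0 k Q ∧ shift (k + 1) u ∈ recursiveSet 0 m R} =
      (blockProb k Q).toReal * (blockProb m R).toReal *
        (1 / ((m + 1) * (k + m + 2) * (k + m + 3))) := by
  have h := measure_recursiveSet_inter (k := k) (m := m) (Q := Q) (R := R)
  simp only [shift_mem_recursiveSet]
  rw [measureReal_def]
  change (iidMeasure unif (recursiveSet 0 k Q ∩ recursiveSet (k + 1) m R)).toReal = _
  rw [h, ENNReal.toReal_mul, ENNReal.toReal_mul, ENNReal.toReal_ofReal (by positivity)]

theorem toReal_blockProb_rotateFiber (hq : FringeHom q) (L : τ) :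
    (blockProb (size L - 1) (rotateFiber q L)).toReal =
      shapeProb (fun n => (randomRRT n).map q) L := by
  have h := toReal_randomRRT_apply unif q (size L - 1) L
  rw [Nat.sub_add_cancel (hq.one_le_size L)] at h
  exact h.symm

open Classical in
-- A tree of size `K` comes from a block of length `K - 1`. The two adjacent placements add up to `1
-- / (K * M * (K + M + 1))`, and subtracting this from the `K + M + 1` products of probabilities
-- leaves `gammaRRT`.
theorem asympCov_recursiveSet_of_le (hq : FringeHom q) {L L' : τ} (hle : size L' ≤ size L) {w : ℕ}
    (hw : size L + 1 ≤ w) :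
    asympCov unif ((recursiveSet 0 (size L - 1) (rotateFiber q L)).indicator 1)
      ((recursiveSet 0 (size L' - 1) (rotateFiber q L')).indicator 1) w =
      sigmaRRTOfLE (fun n => (randomRRT n).map q) L L' := by
  obtain ⟨k, hk⟩ := Nat.exists_eq_add_of_le' (hq.one_le_size L)
  obtain ⟨m, hm⟩ := Nat.exists_eq_add_of_le' (hq.one_le_size L')
  have hpk := toReal_blockProb_rotateFiber hq L
  have hpm := toReal_blockProb_rotateFiber hq L'
  rw [hk, Nat.add_sub_cancel] at hpk
  rw [hm, Nat.add_sub_cancel] at hpm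
  simp only [hk, hm, Nat.add_sub_cancel]
  have h := asympCov_indicator (ν := unif) (a := k + 1) (b := m + 1) (w := w)
    (c := copies L' L) (measurableSet_recursiveSet (i := 0) (k := k) (Q := rotateFiber q L))
    (measurableSet_recursiveSet (i := 0) (k := m) (Q := rotateFiber q L'))
    (isWindow_recursiveSet _ _) (isWindow_recursiveSet _ _) (by omega) (by omega) (by omega)
    (by
      filter_upwards [ae_injective (ν := unif)] with u hu huA
      rw [mem_recursiveSet, zero_add] at huA
      have hc := hq.copies_rotateTree_shape_eq_sum L' u 0 k hu.injOn huA.1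
      rw [zero_add, show q (rotateTree (shape u 1 k)) = L from huA.2] at hc
      rw [hc]
      push_cast
      rw [← Finset.sum_subset (Finset.range_mono (by omega : k + 1 - (m + 1) + 1 ≤ k + 2))]
      · refine Finset.sum_congr (by congr 1; omega) fun i hi => ?_
        rw [Finset.mem_range] at hi
        rw [Set.indicator_apply, shift_mem_recursiveSet, mem_recursiveSet, zero_add, hm,
          Nat.add_sub_cancel]
        have hi' : i + (m + 1) ≤ k + 1 := by omega
        have hmem : shape u (i + 1) m ∈ rotateFiber q L' ↔
          q (rotateTree (shape u (i + 1) m)) = L' := Iff.rfl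
        split_ifs <;> tauto
      · intro i _ hi
        rw [Finset.mem_range] at hi
        exact if_neg fun hc => by omega)
    (fun l h1 h2 u hu hu' => by
      rw [shift_mem_recursiveSet, mem_recursiveSet] at hu'
      rw [mem_recursiveSet] at hu
      exact isRecursiveBlock_not_overlap hu.1 hu'.1 (by omega) (by omega) (by omega))
    (fun l h1 h2 u hu hu' => by
      rw [shift_mem_recursiveSet, mem_recursiveSet] at hu'
      rw [mem_recursiveSet] at hu
      exact isRecursiveBlock_not_overlap hu.1 hu'.1 (by omega) (by omega) (by omega))
  rw [h, real_recursiveSet_inter, real_recursiveSet_inter, real_recursiveSet, real_recursiveSet,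
    hpk, hpm, sigmaRRTOfLE, gammaRRT, hk, hm]
  push_cast
  field_simp
  ring

theorem asympCov_recursiveSet (hq : FringeHom q) (L L' : τ) {w : ℕ} (hw : size L + 1 ≤ w)
    (hw' : size L' + 1 ≤ w) :
    asympCov unif ((recursiveSet 0 (size L - 1) (rotateFiber q L)).indicator 1)
      ((recursiveSet 0 (size L' - 1) (rotateFiber q L')).indicator 1) w =
      sigmaRRT (fun n => (randomRRT n).map q) L L' := by
  rw [sigmaRRT]
  split_ifs with hle
  · exact asympCov_recursiveSet_of_le hq hle hw
  · rw [asympCov_comm ((isApproxWindowSum_copies_rotateTree hq L).isWindow.mono hw)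
      ((isApproxWindowSum_copies_rotateTree hq L').isWindow.mono hw')]
    exact asympCov_recursiveSet_of_le hq (by omega) hw'

end Recursive

/-! ### Linear independence of subtree counts -/

/-- A class of trees that is closed under adding a root to one tree or to two trees. -/
structure IsFringeClass {τ : Type} [HasFringe τ] (V : τ → Prop) : Prop where
  copies_self : ∀ T, V T → copies T T ≠ 0
  size_lt : ∀ T S, V S → copies T S ≠ 0 → T ≠ S → size T < size S
  exists_extend : ∀ s, V s → ∃ r, V r ∧ size r = size s + 1 ∧
    ∀ T, size T < size r → copies T r = copies T s
  exists_join : ∀ s t, V s → V t → ∃ r, V r ∧ size r = size s + size t + 1 ∧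
    ∀ T, size T < size r → copies T r = copies T s + copies T t

section FringeClass

variable {τ : Type} [HasFringe τ] {V : τ → Prop}

theorem IsFringeClass.exists_extend_add (hV : IsFringeClass V) {s : τ} (hs : V s) (N : ℕ) :
    ∃ r, V r ∧ size r = size s + N ∧ ∀ T, size T ≤ size s → copies T r = copies T s := by
  induction N with
  | zero => exact ⟨s, hs, rfl, fun _ _ => rfl⟩
  | succ N ih =>
    obtain ⟨r, hr, h1, h2⟩ := ih
    obtain ⟨r', hr', h3, h4⟩ := hV.exists_extend r hr
    exact ⟨r', hr', by omega, fun T hT => (h4 T (by omega)).trans (h2 T hT)⟩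

/-- A linear combination of subtree counts that is a function of the size is trivial. -/
theorem IsFringeClass.eq_zero_of_size (hV : IsFringeClass V) {d : ℕ} {T : Fin d → τ}
    (hT : Function.Injective T) (hTV : ∀ i, V (T i)) {c : Fin d → ℝ} {M : ℕ}
    (hM : ∀ i, size (T i) ≤ M) {f : ℕ → ℝ}
    (hf : ∀ S, V S → M < size S → ∑ i, c i * copies (T i) S = f (size S)) : c = 0 := by
  have hjoin : ∀ s t r : τ, (∀ i, copies (T i) r = copies (T i) s + copies (T i) t) →
      ∑ i, c i * copies (T i) r = ∑ i, c i * copies (T i) s + ∑ i, c i * copies (T i) t := by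
    intro s t r h
    rw [← Finset.sum_add_distrib]
    refine Finset.sum_congr rfl fun i _ => ?_
    rw [h i]
    push_cast
    ring
  -- Joining `s` to itself and extending `s` by `size s + 1` nodes give trees of equal size; the
  -- first doubles the combination and the second preserves it, so the value is zero.
  have hbig : ∀ s, V s → M < size s → ∑ i, c i * copies (T i) s = 0 := by
    intro s hs hsM
    obtain ⟨r, hr, h1, h2⟩ := hV.exists_join s s hs hs
    obtain ⟨r', hr', h3, h4⟩ := hV.exists_extend_add hs (size s + 1)
    have e1 := hjoin s s r fun i => h2 _ (by have := hM i; omega)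
    have e2 : ∑ i, c i * (copies (T i) r' : ℝ) = ∑ i, c i * (copies (T i) s : ℝ) :=
      Finset.sum_congr rfl fun i _ => by rw [h4 _ (by have := hM i; omega)]
    rw [hf r hr (by omega), h1] at e1
    rw [hf r' hr' (by omega), h3, ← add_assoc] at e2
    linarith
  -- A small tree is joined to a large one; the join and the large tree both have value zero.
  have hall : ∀ s, V s → ∑ i, c i * copies (T i) s = 0 := by
    intro s hs
    obtain ⟨b, hb, h1, -⟩ := hV.exists_extend_add hs (M + 1)
    obtain ⟨r, hr, h2, h3⟩ := hV.exists_join s b hs hb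
    have e1 := hjoin s b r fun i => h3 _ (by have := hM i; omega)
    rw [hbig r hr (by omega), hbig b hb (by omega)] at e1
    linarith
  by_contra hc
  have hne : (Finset.univ.filter fun i => c i ≠ 0).Nonempty := by
    obtain ⟨i, hi⟩ := Function.ne_iff.1 hc
    exact ⟨i, by simpa using hi⟩
  -- Evaluating at a smallest `T i` with nonzero coefficient leaves only its own term: no other tree
  -- with nonzero coefficient is small enough to occur in it.
  obtain ⟨i, hi, hmin⟩ := Finset.exists_min_image _ (fun i => size (T i)) hne
  have hci : c i ≠ 0 := (Finset.mem_filter.1 hi).2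
  have h := hall (T i) (hTV i)
  rw [Finset.sum_eq_single i] at h
  · rcases mul_eq_zero.1 h with h | h
    · exact hci h
    · exact hV.copies_self _ (hTV i) (by exact_mod_cast h)
  · intro j _ hji
    by_cases hcj : c j = 0
    · simp [hcj]
    have hle := hmin j (by simpa using hcj)
    have : copies (T j) (T i) = 0 := by
      by_contra h0
      have := hV.size_lt _ _ (hTV i) h0 fun e => hji (hT e)
      omega
    simp [this]
  · simp

end FringeClass

/-! ### Non-singularity -/

theorem IsApproxWindowSum.mono {ν : Measure ℝ} [IsProbabilityMeasure ν] {X : ℕ → (ℕ → ℝ) → ℝ}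
    {g : (ℕ → ℝ) → ℝ} {w w' : ℕ} {C B : ℝ} (hX : IsApproxWindowSum ν X g w C B) (h : w ≤ w') :
    IsApproxWindowSum ν X g w' C B :=
  ⟨hX.isWindow.mono h, hX.measurable, hX.approx⟩

theorem eq_zero_of_quadratic_nonneg {a b : ℝ} (h : ∀ x : ℝ, 0 ≤ x * (x * a) + 2 * x * b) :
    b = 0 := by
  have h1 : ∀ x : ℝ, 0 ≤ a * (x * x) + 2 * b * x + 0 := fun x => (h x).trans_eq (by ring)
  have h2 := discrim_le_zero h1
  rw [discrim] at h2
  nlinarith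

/-- Joint normality for counts given by windows whose asymptotic covariances have the form of those
for random binary search trees and random recursive trees. -/
theorem jointNormalLimit_of_model {τ : Type} [HasFringe τ] [MeasurableSpace τ] {ν : Measure ℝ}
    [IsProbabilityMeasure ν] {law : ℕ → PMF τ} {tree : ℕ → (ℕ → ℝ) → τ}
    (hm : IsWindowModel ν law tree) {V : τ → Prop} (hV : IsFringeClass V)
    {g : τ → (ℕ → ℝ) → ℝ} {w : τ → ℕ} {B : τ → ℝ} {σ : τ → τ → ℝ}
    (happ : ∀ T, V T →
      IsApproxWindowSum ν (fun n u => (copies T (tree n u) : ℝ)) (g T) (w T) 1 (B T))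
    (hσ : ∀ T T', V T → V T' → ∀ n, w T ≤ n → w T' ≤ n → asympCov ν (g T) (g T') n = σ T T')
    {a : ℕ → ℝ} {γ : ℕ → ℕ → ℝ} {p : τ → ℝ} (ha : ∀ T, V T → a (size T) ≠ 0)
    (hp : ∀ T, V T → p T ≠ 0)
    (hform : ∀ T S, V T → V S → size T < size S →
      σ S T = a (size S) * copies T S * p S - γ (size S) (size T) * p S * p T)
    {d : ℕ} {T : Fin d → τ} (hT : Function.Injective T) (hTV : ∀ i, V (T i)) :
    JointNormalLimit law T (Matrix.of fun i j => σ (T i) (T j)) := by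
  have hbd : ∀ {ι : Type} [Fintype ι] (W : ι → ℕ), ∃ n, ∀ i, W i ≤ n := fun W =>
    ⟨∑ i, W i, fun i => Finset.single_le_sum (fun _ _ => Nat.zero_le _) (Finset.mem_univ i)⟩
  have hsymm : ∀ S S', V S → V S' → σ S S' = σ S' S := by
    intro S S' hS hS'
    have h1 := le_max_left (w S) (w S')
    have h2 := le_max_right (w S) (w S')
    rw [← hσ S S' hS hS' _ h1 h2, ← hσ S' S hS' hS _ h2 h1]
    exact asympCov_comm ((happ S hS).mono h1).isWindow ((happ S' hS').mono h2).isWindow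
  have hquad : ∀ {ι : Type} [Fintype ι] (S : ι → τ), (∀ i, V (S i)) → ∀ t : ι → ℝ,
      0 ≤ ∑ i, ∑ j, t i * (t j * σ (S i) (S j)) := by
    intro ι _ S hS t
    obtain ⟨n, hn⟩ := hbd fun i => w (S i)
    have happ' := fun i => (happ (S i) (hS i)).mono (hn i)
    refine quadraticForm_nonneg (T := S) (Γ := fun i j => σ (S i) (S j)) hm happ'
      (fun i j => ?_) t
    rw [← hσ _ _ (hS i) (hS j) n (hn i) (hn j)]
    exact hm.tendsto_covariance (happ' i) (happ' j)
  obtain ⟨n, hn⟩ := hbd fun i => w (T i)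
  refine jointNormalLimit_of_windows hm (fun i => (happ (T i) (hTV i)).mono (hn i))
    (fun i j => hσ _ _ (hTV i) (hTV j) n (hn i) (hn j)) fun hdet => ?_
  obtain ⟨c, hc, hΓc⟩ := Matrix.exists_mulVec_eq_zero_iff.2 hdet
  have hrow : ∀ i, ∑ j, c j * σ (T i) (T j) = 0 := fun i => by
    have := congrFun hΓc i
    simpa [Matrix.mulVec, dotProduct, mul_comm] using this
  -- The quadratic form is evaluated on the family enlarged by `S`, with coefficients `x` and `c`.
  -- As `c` is in the kernel, only `x ^ 2 * σ S S` and a term linear in `x` remain, and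
  -- nonnegativity for all `x` kills the linear one.
  have horth : ∀ S, V S → ∑ i, c i * σ S (T i) = 0 := by
    intro S hS
    refine eq_zero_of_quadratic_nonneg (a := σ S S) fun x => ?_
    have h := hquad (ι := Option (Fin d)) (fun o => o.elim S T)
      (fun o => by cases o <;> simp [hS, hTV]) fun o => o.elim x c
    simp only [Fintype.sum_option, Option.elim_none, Option.elim_some] at h
    have h1 : ∑ i, (c i * (x * σ (T i) S) + ∑ j, c i * (c j * σ (T i) (T j))) =
        x * ∑ i, c i * σ S (T i) := by
      rw [Finset.mul_sum]
      refine Finset.sum_congr rfl fun i _ => ?_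
      rw [← Finset.mul_sum, hrow i, hsymm _ _ (hTV i) hS]
      ring
    have h2 : ∑ i, x * (c i * σ S (T i)) = x * ∑ i, c i * σ S (T i) := by
      rw [Finset.mul_sum]
    rw [h1, h2] at h
    linarith
  obtain ⟨M, hM⟩ := hbd fun i => size (T i)
  -- For `S` larger than every `T i`, each `σ S (T i)` contains the factor `p S`. Cancelling it
  -- expresses the combination of counts in `S` through the size of `S` alone.
  refine hc (hV.eq_zero_of_size hT hTV hM
    (f := fun N => (∑ i, c i * (γ N (size (T i)) * p (T i))) / a N) fun S hS hSM => ?_)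
  have h := horth S hS
  have h1 : ∑ i, c i * σ S (T i) = p S * (a (size S) * ∑ i, c i * copies (T i) S -
      ∑ i, c i * (γ (size S) (size (T i)) * p (T i))) := by
    rw [mul_sub, Finset.mul_sum, Finset.mul_sum, Finset.mul_sum, ← Finset.sum_sub_distrib]
    refine Finset.sum_congr rfl fun i _ => ?_
    rw [hform (T i) S (hTV i) hS ((hM i).trans_lt hSM)]
    ring
  rw [h1, mul_eq_zero, or_iff_right (hp S hS), sub_eq_zero] at h
  rw [eq_div_iff (ha S hS), mul_comm]
  exact h

/-! ### The two classes of trees -/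

theorem size_le_of_copies_ne_zero {T t : BinaryTree Unit} (h : copies T t ≠ 0) :
    T = t ∨ size T < size t := by
  induction t with
  | nil => simp at h
  | node a l r ihl ihr =>
    rw [or_iff_not_imp_left]
    intro hne
    rw [copies_binaryNode, if_neg (Ne.symm hne), add_zero] at h
    rw [size_binaryNode]
    rcases Nat.eq_zero_or_pos (copies T l) with hl | hl
    · rcases ihr (by omega) with h1 | h1
      · rw [h1]; omega
      · omega
    · rcases ihl hl.ne' with h1 | h1
      · rw [h1]; omega
      · omega

/-- A new root adds a single fringe tree, namely the whole tree, so counts of smaller trees are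
additive; the extension uses an empty right subtree. -/
theorem isFringeClass_binaryTree : IsFringeClass fun T : BinaryTree Unit => T ≠ .nil := by
  have hnode : ∀ (a : Unit) (l r T : BinaryTree Unit), size T < size (BinaryTree.node a l r) →
      copies T (.node a l r) = copies T l + copies T r := by
    intro a l r T hT
    rw [copies_binaryNode, if_neg, add_zero]
    rintro rfl
    exact lt_irrefl _ hT
  refine ⟨fun T hT => ?_, fun T S _ h hne => (size_le_of_copies_ne_zero h).resolve_left hne,
    fun s _ => ⟨.node () s .nil, by simp, by simp [size, HasFringe.fringe, binaryFringe],
      fun T hT => by rw [hnode _ _ _ _ hT, copies_nil, add_zero]⟩,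
    fun s t _ _ => ⟨.node () s t, by simp, size_binaryNode _ _ _, fun T hT => hnode _ _ _ _ hT⟩⟩
  cases T with
  | nil => exact absurd rfl hT
  | node a l r =>
    rw [copies_binaryNode, if_pos rfl]
    omega

section Recursive

variable {τ : Type} [HasFringe τ] {q : OrderedTree Unit → τ}

theorem FringeHom.size_le_of_copies_ne_zero (hq : FringeHom q) {L : τ} {t : OrderedTree Unit}
    (h : copies L (q t) ≠ 0) : L = q t ∨ size L < size (q t) := by
  induction hn : size (q t) using Nat.strong_induction_on generalizing t with
  | _ n ih =>
    subst hn
    obtain ⟨a, cs⟩ := t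
    rw [or_iff_not_imp_left]
    intro hne
    rw [hq.copies_node, if_neg (Ne.symm hne), add_zero, forestCopies] at h
    obtain ⟨x, hx, hx0⟩ : ∃ x ∈ cs.map fun t => copies L (q t), x ≠ 0 := by
      by_contra! hall
      exact h (List.sum_eq_zero hall)
    obtain ⟨t, ht, rfl⟩ := List.mem_map.1 hx
    have hlt : size (q t) < size (q (.node a cs)) := by
      rw [hq.size_node, Nat.lt_succ_iff]
      exact List.single_le_sum (fun _ _ => Nat.zero_le _) _ (List.mem_map.2 ⟨t, ht, rfl⟩)
    rcases ih _ hlt hx0 rfl with h1 | h1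
    · rwa [h1]
    · exact h1.trans hlt

theorem FringeHom.isFringeClass (hq : FringeHom q) : IsFringeClass fun _ : τ => True := by
  have hnode : ∀ (cs : List (OrderedTree Unit)) (T : τ), size T < size (q (.node () cs)) →
      copies T (q (.node () cs)) = forestCopies q T cs := by
    intro cs T hT
    rw [hq.copies_node, if_neg, add_zero]
    rintro rfl
    exact lt_irrefl _ hT
  refine ⟨fun T _ => ?_, fun T S _ h hne => ?_, fun s _ => ?_, fun s t _ _ => ?_⟩
  · obtain ⟨⟨a, cs⟩, rfl⟩ := hq.surjective T
    rw [hq.copies_node, if_pos rfl]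
    omega
  · obtain ⟨t, rfl⟩ := hq.surjective S
    exact (hq.size_le_of_copies_ne_zero h).resolve_left hne
  · obtain ⟨s, rfl⟩ := hq.surjective s
    refine ⟨q (.node () [s]), trivial, ?_, fun T hT => ?_⟩
    · simp [hq.size_node, forestSize]
    · simp [hnode _ _ hT, forestCopies]
  · obtain ⟨s, rfl⟩ := hq.surjective s
    obtain ⟨t, rfl⟩ := hq.surjective t
    refine ⟨q (.node () [s, t]), trivial, ?_, fun T hT => ?_⟩
    · simp [hq.size_node, forestSize]
    · simp [hnode _ _ hT, forestCopies]

theorem jointNormalLimit_randomRRT [MeasurableSpace τ] (hτ : ∀ s : Set τ, MeasurableSet s)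
    (hq : FringeHom q) {d : ℕ} {L : Fin d → τ} (hL : Function.Injective L) :
    JointNormalLimit (fun n => (randomRRT n).map q) L
      (Matrix.of fun i j => sigmaRRT (fun n => (randomRRT n).map q) (L i) (L j)) := by
  refine jointNormalLimit_of_model (isWindowModel_randomRRT (ν := unif) hτ q) hq.isFringeClass
    (a := fun n => 1 / ((n : ℝ) * (n + 1))) (γ := fun k m => gammaRRT k m)
    (p := shapeProb fun n => (randomRRT n).map q)
    (fun T _ => isApproxWindowSum_copies_rotateTree hq T)
    (fun T T' _ _ n hn hn' => asympCov_recursiveSet hq T T' hn hn')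
    (fun T _ => ?_) (fun T _ => (shapeProb_randomRRT_pos hq T).ne') (fun T S _ _ h => ?_) hL
    fun _ => trivial
  · have : (0 : ℝ) < size T := by exact_mod_cast hq.one_le_size T
    positivity
  · rw [sigmaRRT, if_pos h.le, sigmaRRTOfLE]

end Recursive

theorem jointNormalLimit_randomBST {d : ℕ} {T : Fin d → BinaryTree Unit}
    (hT : Function.Injective T) (hnil : ∀ i, T i ≠ .nil) :
    JointNormalLimit randomBST T (Matrix.of fun i j => sigmaBST (T i) (T j)) := by
  refine jointNormalLimit_of_model (isWindowModel_randomBST (ν := unif)) isFringeClass_binaryTree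
    (a := fun n => 2 / (((n : ℝ) + 1) * (n + 2))) (γ := fun k m => gammaBST k m)
    (p := shapeProb randomBST) (fun T hT => isApproxWindowSum_copies_shape hT)
    (fun T T' hT hT' n hn hn' => asympCov_fringeSet hT hT' hn hn')
    (fun T _ => by positivity) (fun T _ => (shapeProb_randomBST_pos T).ne') (fun T S _ _ h => ?_) hT
    hnil
  rw [sigmaBST, if_pos h.le, sigmaBSTOfLE]

end FringeTrees
end

theorem theorem7 :
    (∀ (d : ℕ) (T : Fin d → BinaryTree Unit), Function.Injective T →
      (∀ i, T i ≠ BinaryTree.nil) →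
      FringeTrees.JointNormalLimit FringeTrees.randomBST T
        (Matrix.of fun i j => FringeTrees.sigmaBST (T i) (T j))) ∧
    (∀ (d : ℕ) (L : Fin d → FringeTrees.OrderedTree Unit), Function.Injective L →
      FringeTrees.JointNormalLimit FringeTrees.randomRRT L
        (Matrix.of fun i j => FringeTrees.sigmaRRT FringeTrees.randomRRT (L i) (L j))) ∧
    (∀ (d : ℕ) (L : Fin d → FringeTrees.UnorderedTree), Function.Injective L →
      FringeTrees.JointNormalLimit FringeTrees.randomUnorderedRRT L
        (Matrix.of fun i j => FringeTrees.sigmaRRT FringeTrees.randomUnorderedRRT (L i) (L j))) := by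
  refine ⟨fun d T hT hnil => FringeTrees.jointNormalLimit_randomBST hT hnil, fun d L hL => ?_,
    fun d L hL => FringeTrees.jointNormalLimit_randomRRT (fun _ => MeasurableSpace.measurableSet_top)
      FringeTrees.fringeHom_toUnordered hL⟩
  have h := FringeTrees.jointNormalLimit_randomRRT (fun _ => MeasurableSpace.measurableSet_top) FringeTrees.fringeHom_id hL
  have e : (fun n => (FringeTrees.randomRRT n).map id) = FringeTrees.randomRRT :=
    funext fun n => PMF.map_id _
  rwa [e] at h
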